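/- Let $n \ge 1$ and let $M \subset \mathbb{C}^n$ be a $C^2$-smooth (embedded) real submanifold of real dimension $m$ which is generic, i.e. $T_zM + J\,T_zM = \mathbb{C}^n$ for every $z \in M$, where $T_zM$ is the real tangent space and $J$ is multiplication by $i$. Let $I \subset M$ be an arbitrary subset of measure zero in $M$, i.e. of $m$-dimensional Hausdorff measure $H_m(I)=0$. Then $M \setminus I$ is not plurithin at any point of $M$: for every $z^0 \in M$ there is no function $u$, plurisubharmonic in an open neighbourhood of $z^0$ in $\mathbb{C}^n$, such that $$ u(z^0) > \limsup_{z \to z^0,\ z \in (M\setminus I)\setminus\{z^0\}} u(z). $$ Here plurisubharmonic functions take values in $[-\infty,+\infty)$ and the upper limit over an empty set is $-\infty$ (in particular, the statement includes that every $z^0\in M$ is an accumulation point of $M \setminus I$). -/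

import Mathlib

namespace Plurithin

/-- The space `ℂⁿ` with its Euclidean norm. -/
abbrev Cn (n : ℕ) : Type := EuclideanSpace ℂ (Fin n)

/-- `M ⊆ ℂⁿ` is a real `C²` submanifold (embedded, without boundary) of real dimension `m`:
near each of its points it is the zero set of a `C²` map to `ℝᵏ`, `k = 2n - m`, whose real
differential is onto at the points of `M`. -/
def IsC2Submanifold {n : ℕ} (m : ℕ) (M : Set (Cn n)) : Prop :=
  ∃ k : ℕ, m + k = 2 * n ∧
    ∀ p ∈ M, ∃ U : Set (Cn n), IsOpen U ∧ p ∈ U ∧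
      ∃ ρ : Cn n → EuclideanSpace ℝ (Fin k),
        ContDiffOn ℝ 2 ρ U ∧
        (∀ z ∈ M ∩ U, Function.Surjective (fderiv ℝ ρ z)) ∧
        M ∩ U = {z ∈ U | ρ z = 0}

/-- The real tangent space `T_p M`: the velocities at `p` of the curves that lie in `M`. -/
def tangentSpace {n : ℕ} (M : Set (Cn n)) (p : Cn n) : Set (Cn n) :=
  {v | ∃ γ : ℝ → Cn n, γ 0 = p ∧ (∀ᶠ t in nhds 0, γ t ∈ M) ∧ HasDerivAt γ v 0}

/-- `M` is generic: `T_z M + J T_z M = ℂⁿ` for all `z ∈ M`, where `J` is multiplication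
by `i`. -/
def IsGeneric {n : ℕ} (M : Set (Cn n)) : Prop :=
  ∀ z ∈ M, ∀ w : Cn n, ∃ a ∈ tangentSpace M z, ∃ b ∈ tangentSpace M z,
    w = a + Complex.I • b

/-- The integral mean `(1 / 2π) ∫₀^{2π} u (z + e^{iθ} w) dθ` of an extended-real function, as the
mean of the positive part minus the mean of the negative part. For an upper semicontinuous
`u < +∞` the first of these is finite, so the mean is well defined, with values in `[-∞, +∞)`. -/
noncomputable def circleMean {n : ℕ} (u : Cn n → EReal) (z w : Cn n) : EReal :=
  (((∫⁻ θ in Set.Ioc (0 : ℝ) (2 * Real.pi),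
      (u (z + Complex.exp (θ * Complex.I) • w)).toENNReal)
        / ENNReal.ofReal (2 * Real.pi) : ENNReal) : EReal) -
  (((∫⁻ θ in Set.Ioc (0 : ℝ) (2 * Real.pi),
      (-u (z + Complex.exp (θ * Complex.I) • w)).toENNReal)
        / ENNReal.ofReal (2 * Real.pi) : ENNReal) : EReal)

/-- `u` is plurisubharmonic on the open set `G ⊆ ℂⁿ`: it is upper semicontinuous with values in
`[-∞, +∞)`, and has the sub-mean value property on every closed affine complex disc in `G`.
(The constant `-∞` is allowed.) -/
structure IsPlurisubharmonicOn {n : ℕ} (u : Cn n → EReal) (G : Set (Cn n)) : Prop where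
  lt_top : ∀ z ∈ G, u z < ⊤
  usc : UpperSemicontinuousOn u G
  submean : ∀ z w : Cn n, (∀ ζ : ℂ, ‖ζ‖ ≤ 1 → z + ζ • w ∈ G) → u z ≤ circleMean u z w

/-- `E` is plurithin at `z₀`: some function `u`, plurisubharmonic in a neighbourhood of `z₀`,
satisfies `u z₀ > limsup u z` as `z → z₀`, `z ∈ E`, `z ≠ z₀`. If `z₀` is not an accumulation
point of `E`, the upper limit is `-∞` and `E` is plurithin at `z₀`; so a set that is not plurithin
at `z₀` has `z₀` as an accumulation point. -/
def IsPlurithinAt {n : ℕ} (E : Set (Cn n)) (z₀ : Cn n) : Prop :=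
  ∃ G : Set (Cn n), IsOpen G ∧ z₀ ∈ G ∧
    ∃ u : Cn n → EReal, IsPlurisubharmonicOn u G ∧
      Filter.limsup u (nhdsWithin z₀ (E \ {z₀})) < u z₀

end Plurithin

/-!
The proof attaches analytic discs to a totally real slice of `M`.

*Reduction to a graph.* Suppose that `u < c < u z₀` at the points of `M \ I` near `z₀`, other than
`z₀` itself. Near `z₀` the submanifold is parametrized by its tangent space `F`, and the parameters
of the points of `I` form a null set, since a Lipschitz map inverts the parametrization
(`IsC2Submanifold.exists_parametrization`). As `M` is generic, `F` contains a complex basis of `ℂⁿ`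
(`exists_linearIndependent_of_generic`). By Fubini's theorem this basis can be perturbed so that the
set of its real combinations meets the parameters of `I` in a null set only
(`exists_slice_ae_notMem`). In the complex linear coordinates of that basis the slice is a `C²`
graph `x ↦ x + g x` over `ℝⁿ` with `g 0 = 0` and `g' 0 = 0`, and `u < c` at almost every point of
it. This contradicts `not_ae_lt_on_graph`.

*The discs.* Bishop's classical discs attached to such a graph do not have their centre at the given
point of it, so the discs used here are meromorphic with a simple pole at `1/2`:
`φ = κ v + κ₁ η + p`, where `κ ζ = ζ / ((1 - ζ / 2) (ζ - 1 / 2))` is real on the unit circle and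
vanishes at `0`, where `κ₁` is real on the circle with `κ₁ 0 = -i`, and where `p` is a polynomial
whose imaginary part is prescribed on the circle. The vector `η` is chosen such that `φ 0 = 0`. To
avoid singular integral operators, the boundary condition is imposed only at the `N`-th roots of
unity: the conjugation operator becomes a finite Fourier multiplier (`conjPoly`), the discrete
Bishop equation is solved by contraction in `ℓ²`, and a discrete `H¹` norm (`sob`) controls the disc
between the nodes uniformly in `N`. The result is `exists_attached_discs`. The points of attachment
depend on the parameter `v ∈ ℝⁿ` in a bi-Lipschitz way, because `κ` is bounded away from zero on the
circle. Averaging over `v` therefore gives a disc for which only a small proportion of the nodes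
falls into a given set of small measure (`exists_few_bad_nodes`).

*The pole.* Let `U ≤ 0` be a normalisation of `u` with `U = -1` where `u < c` and with `U 0` close
to `0`. The function `max (1 + U ∘ φ + 12/25 (|ζ - 1/2|² - 9/4)) 0` (`discFun`) is subharmonic on
the whole disc: where it does not vanish identically one is away from the pole, because the
quadratic term is below `-1` near `1/2`. At the centre the quadratic term is only `-24/25`, so the
value there is positive. On the unit circle the quadratic term is nonpositive, hence the function is
at most `1` there and vanishes on the arcs whose nodes are mapped well inside the open set `u < c`,
which are most of them. The sub-mean value inequality at the centre
(`discFun_zero_le_circleAverage`) gives the contradiction. That inequality is proved for `U` of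
class `C¹` with Lipschitz derivative, for which the function satisfies it on small circles up to a
cubic error (`le_circleAverage_of_asymptotic`); the general case is reduced to this one by
mollification (`exists_mollification`).
-/

namespace Plurithin

open Finset

/-! ### Trigonometric interpolation at the roots of unity -/

section Interpolation

lemma cast_ne_cast {N k l : ℕ} (hk : k < N) (hl : l < N) (h : k ≠ l) : (k : ZMod N) ≠ l := by
  intro h'
  rw [ZMod.natCast_eq_natCast_iff'] at h'
  rw [Nat.mod_eq_of_lt hk, Nat.mod_eq_of_lt hl] at h'
  exact h h'

variable {N : ℕ} [NeZero N]

/-- The `N`-th root of unity `exp (2πij / N)`. -/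
noncomputable abbrev node (j : ZMod N) : ℂ := ZMod.stdAddChar j

lemma norm_node (j : ZMod N) : ‖node j‖ = 1 := by
  rw [node, ZMod.stdAddChar_apply, Circle.norm_coe]

lemma node_pow (j : ZMod N) (k : ℕ) : node j ^ k = node (N := N) (j * k) := by
  rw [node, ← AddChar.map_nsmul_eq_pow, nsmul_eq_mul, mul_comm]

lemma conj_node (j : ZMod N) : starRingEnd ℂ (node j) = node (-j) := by
  rw [node, node, AddChar.map_neg_eq_inv, Complex.inv_def, Complex.normSq_eq_norm_sq,
    norm_node]
  simp

lemma sum_node_mul (m : ZMod N) : ∑ j : ZMod N, node (j * m) = if m = 0 then (N : ℂ) else 0 := by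
  have := AddChar.sum_mulShift m (ZMod.isPrimitive_stdAddChar N)
  rw [ZMod.card] at this
  rw [this]; push_cast; rfl

/-- The polynomial `∑_{k ≤ K} c_k ζ ^ k`. -/
def sumPow (K : ℕ) (c : ℕ → ℂ) (ζ : ℂ) : ℂ := ∑ k ∈ range (K + 1), c k * ζ ^ k

/-- Parseval's identity for polynomials of degree less than the number of nodes. -/
lemma sum_norm_sumPow_sq {K : ℕ} (hK : K < N) (c : ℕ → ℂ) :
    ∑ j : ZMod N, ‖sumPow K c (node j)‖ ^ 2 = N * ∑ k ∈ range (K + 1), ‖c k‖ ^ 2 := by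
  have key : ∑ j : ZMod N, sumPow K c (node j) * starRingEnd ℂ (sumPow K c (node j))
      = N * ∑ k ∈ range (K + 1), c k * starRingEnd ℂ (c k) := by
    have h1 : ∀ j : ZMod N, sumPow K c (node j) * starRingEnd ℂ (sumPow K c (node j))
        = ∑ k ∈ range (K + 1), ∑ l ∈ range (K + 1),
          c k * starRingEnd ℂ (c l) * node (N := N) (j * ((k : ZMod N) - l)) := by
      intro j
      simp only [sumPow, map_sum, map_mul, conj_node, node_pow, sum_mul_sum]
      refine sum_congr rfl fun k _ => sum_congr rfl fun l _ => ?_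
      have : node (N := N) (j * (k - l)) = node (N := N) (j * k) * node (N := N) (-(j * l)) := by
        rw [node, node, node, ← AddChar.map_add_eq_mul]; congr 1; ring
      rw [this]; ring
    simp_rw [h1]
    rw [sum_comm]
    rw [mul_sum]
    refine sum_congr rfl fun k hk => ?_
    rw [sum_comm]
    simp_rw [← mul_sum, sum_node_mul]
    rw [sum_eq_single k]
    · simp; ring
    · intro l hl hlk
      rw [if_neg]; · simp
      rw [sub_eq_zero]
      simp only [mem_range] at hk hl
      exact cast_ne_cast (by omega) (by omega) hlk.symm
    · intro h; exact absurd hk h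
  have h2 : ∀ z : ℂ, z * starRingEnd ℂ z = ((‖z‖ ^ 2 : ℝ) : ℂ) := by
    intro z; rw [Complex.mul_conj, Complex.normSq_eq_norm_sq]
  simp_rw [h2] at key
  exact_mod_cast key

/-- The mean of the squares of a polynomial without constant term vanishes, so that its real and
imaginary parts have the same mean square: this is the `L²` bound for the conjugation operator. -/
lemma sum_re_sq_eq_sum_im_sq {K : ℕ} (hK : 2 * K < N) (c : ℕ → ℂ) (hc : c 0 = 0) :
    ∑ j : ZMod N, (sumPow K c (node j)).re ^ 2 = ∑ j : ZMod N, (sumPow K c (node j)).im ^ 2 := by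
  have key : ∑ j : ZMod N, sumPow K c (node j) * sumPow K c (node j) = 0 := by
    have h1 : ∀ j : ZMod N, sumPow K c (node j) * sumPow K c (node j)
        = ∑ k ∈ range (K + 1), ∑ l ∈ range (K + 1),
          c k * c l * node (j * ((k + l : ℕ) : ZMod N)) := by
      intro j
      simp only [sumPow, ← node_pow, sum_mul_sum]
      refine sum_congr rfl fun k _ => sum_congr rfl fun l _ => ?_
      ring
    simp_rw [h1]
    rw [sum_comm]
    refine sum_eq_zero fun k hk => ?_
    rw [sum_comm]
    refine sum_eq_zero fun l hl => ?_
    simp_rw [← mul_sum, sum_node_mul]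
    simp only [mem_range] at hk hl
    rcases Nat.eq_zero_or_pos k with rfl | hk0
    · simp [hc]
    rw [if_neg]; · simp
    have := cast_ne_cast (N := N) (k := k + l) (l := 0) (by omega) (by omega) (by omega)
    simpa using this
  have := congrArg Complex.re key
  simp only [Complex.re_sum, Complex.mul_re, Complex.zero_re, sum_sub_distrib] at this
  simp only [pow_two]
  linarith

/-- The coefficients of the polynomial with prescribed imaginary part at the nodes. -/
noncomputable def conjCoef (y : ZMod N → ℝ) (k : ℕ) : ℂ :=
  (if k = 0 then 1 else 2) * Complex.I * ((N : ℂ)⁻¹ * ∑ l : ZMod N, y l * node (-l) ^ k)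

/-- The polynomial of degree at most `K` with imaginary part `y` at the `2K + 1` nodes and with
purely imaginary value at `0`. -/
noncomputable def conjPoly (K : ℕ) (y : ZMod N → ℝ) : ℂ → ℂ := sumPow K (conjCoef y)

/-- The real part of `1 + 2 (ζ + ⋯ + ζ ^ K)` is the Dirichlet kernel, which at the nodes is `N` times
the indicator function of `ζ = 1`. -/
lemma re_one_add_two_sum {K : ℕ} (hN : N = 2 * K + 1) (m : ZMod N) :
    (∑ k ∈ range (K + 1), (if k = 0 then 1 else 2) * node m ^ k).re = if m = 0 then (N : ℝ) else 0 := by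
  have h1 : (∑ k ∈ range (K + 1), (if k = 0 then 1 else 2) * node m ^ k).re
      = (∑ k ∈ range N, node m ^ k).re := by
    have hre : ∀ k ∈ range K, (node m ^ (K + 1 + k)).re = (node m ^ (K - k)).re := by
      intro k hk
      simp only [mem_range] at hk
      rw [node_pow, node_pow]
      have : m * ((K + 1 + k : ℕ) : ZMod N) = -(m * ((K - k : ℕ) : ZMod N)) := by
        have h : ((K + 1 + k : ℕ) : ZMod N) + ((K - k : ℕ) : ZMod N) = 0 := by
          rw [← Nat.cast_add, show K + 1 + k + (K - k) = N by omega]; simp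
        linear_combination m * h
      rw [this, ← conj_node, Complex.conj_re]
    have h2 : ∑ k ∈ range K, (node m ^ (K + 1 + k)).re = ∑ k ∈ range K, (node m ^ (k + 1)).re := by
      rw [sum_congr rfl hre, ← sum_range_reflect]
      refine sum_congr rfl fun k hk => ?_
      simp only [mem_range] at hk
      congr 2; omega
    rw [sum_range_succ', show range N = range (K + 1 + K) by rw [hN]; congr 1; ring,
      sum_range_add, sum_range_succ']
    simp only [Complex.add_re, Complex.re_sum, h2]
    simp
    rw [← mul_sum]; ring
  rw [h1]
  have h2 : ∑ k ∈ range N, node m ^ k = ∑ k : ZMod N, node (k * m) := by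
    rw [← Fin.sum_univ_eq_sum_range (fun k => node m ^ k)]
    obtain ⟨n, rfl⟩ : ∃ n, N = n + 1 := ⟨2 * K, hN⟩
    refine sum_congr rfl fun (k : ZMod (n + 1)) _ => ?_
    rw [node_pow, mul_comm]
    congr 2
    exact ZMod.natCast_zmod_val k
  rw [h2, sum_node_mul]
  split_ifs <;> simp

lemma conjPoly_im {K : ℕ} (hN : N = 2 * K + 1) (y : ZMod N → ℝ) (j : ZMod N) :
    (conjPoly K y (node j)).im = y j := by
  have h1 : conjPoly K y (node j) = Complex.I * ∑ l : ZMod N, ((N : ℝ)⁻¹ * y l : ℝ) *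
      ∑ k ∈ range (K + 1), (if k = 0 then 1 else 2) * node (j - l) ^ k := by
    simp only [conjPoly, sumPow, conjCoef]
    simp_rw [mul_sum, sum_mul]
    rw [sum_comm]
    refine sum_congr rfl fun l _ => sum_congr rfl fun k _ => ?_
    have : node (j - l) = node j * node (-l) := by
      rw [node, node, node, ← AddChar.map_add_eq_mul, sub_eq_add_neg]
    rw [this]; push_cast; ring
  have hN0 : (N : ℝ) ≠ 0 := Nat.cast_ne_zero.2 (NeZero.ne N)
  rw [h1, Complex.I_mul_im, Complex.re_sum]
  simp_rw [Complex.re_ofReal_mul, re_one_add_two_sum hN, sub_eq_zero]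
  simp
  field_simp

lemma conjCoef_zero (y : ZMod N → ℝ) : conjCoef y 0 = Complex.I * ((N : ℝ)⁻¹ * ∑ l, y l : ℝ) := by
  simp [conjCoef]

lemma conjPoly_zero (K : ℕ) (y : ZMod N → ℝ) :
    conjPoly K y 0 = Complex.I * ((N : ℝ)⁻¹ * ∑ l, y l : ℝ) := by
  rw [← conjCoef_zero, conjPoly, sumPow, sum_eq_single 0]
  · simp
  · intro k _ hk; simp [hk]
  · simp

lemma conjCoef_sub (y y' : ZMod N → ℝ) (k : ℕ) :
    conjCoef (y - y') k = conjCoef y k - conjCoef y' k := by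
  simp only [conjCoef, Pi.sub_apply, Complex.ofReal_sub, sub_mul, sum_sub_distrib]
  ring

lemma conjPoly_sub (K : ℕ) (y y' : ZMod N → ℝ) (ζ : ℂ) :
    conjPoly K (y - y') ζ = conjPoly K y ζ - conjPoly K y' ζ := by
  simp only [conjPoly, sumPow, conjCoef_sub, sub_mul, sum_sub_distrib]

lemma conjCoef_shift (y : ZMod N → ℝ) (k : ℕ) :
    conjCoef (fun j => y (j + 1)) k = node (1 : ZMod N) ^ k * conjCoef y k := by
  simp only [conjCoef]
  have : ∑ l : ZMod N, (y l : ℂ) * node (-l) ^ k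
      = ∑ l : ZMod N, (y (l + 1) : ℂ) * node (-(l + 1)) ^ k :=
    (Equiv.sum_comp (Equiv.addRight (1 : ZMod N)) (fun l => (y l : ℂ) * node (-l) ^ k)).symm
  rw [this]
  have h2 : ∀ l : ZMod N, node (-l) = node (1 : ZMod N) * node (-(l + 1)) := by
    intro l; rw [node, node, node, ← AddChar.map_add_eq_mul]; congr 1; ring
  have h3 : ∑ l : ZMod N, (y (l + 1) : ℂ) * node (-l) ^ k
      = node (1 : ZMod N) ^ k * ∑ l : ZMod N, (y (l + 1) : ℂ) * node (-(l + 1)) ^ k := by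
    rw [mul_sum]
    refine sum_congr rfl fun l _ => ?_
    rw [h2 l]; ring
  rw [h3]; ring

/-- Interpolation commutes with rotation by one node. -/
lemma conjPoly_diff (K : ℕ) (y : ZMod N → ℝ) (ζ : ℂ) :
    conjPoly K (fun j => y (j + 1) - y j) ζ = conjPoly K y (node (1 : ZMod N) * ζ) - conjPoly K y ζ := by
  have := conjPoly_sub K (fun j => y (j + 1)) y ζ
  rw [show (fun j => y (j + 1) - y j) = (fun j => y (j + 1)) - y from rfl, this]
  congr 1
  simp only [conjPoly, sumPow, conjCoef_shift, mul_pow]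
  refine sum_congr rfl fun k _ => ?_
  ring

/-- The `L²` bound for the real part of the interpolating polynomial. -/
lemma sum_conjPoly_re_sq_le {K : ℕ} (hN : N = 2 * K + 1) (y : ZMod N → ℝ) :
    ∑ j : ZMod N, (conjPoly K y (node j)).re ^ 2 ≤ ∑ j, y j ^ 2 := by
  set c : ℕ → ℂ := fun k => if k = 0 then 0 else conjCoef y k with hc
  have hp : ∀ ζ, conjPoly K y ζ = sumPow K c ζ + conjCoef y 0 := by
    intro ζ
    simp only [conjPoly, sumPow, hc]
    rw [sum_range_succ', sum_range_succ']
    simp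
  have h := sum_re_sq_eq_sum_im_sq (N := N) (K := K) (by omega) c (by simp [hc])
  set η : ℝ := (N : ℝ)⁻¹ * ∑ l, y l with hη
  have h0 : conjCoef y 0 = Complex.I * η := conjCoef_zero y
  have hre : ∀ j : ZMod N, (conjPoly K y (node j)).re = (sumPow K c (node j)).re := by
    intro j; rw [hp, h0]; simp
  have him : ∀ j : ZMod N, (sumPow K c (node j)).im = y j - η := by
    intro j
    have := conjPoly_im hN y j
    rw [hp, h0] at this; simp at this; linarith
  simp_rw [hre, h, him]
  have hN0 : (N : ℝ) ≠ 0 := Nat.cast_ne_zero.2 (NeZero.ne N)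
  have hs : ∑ l, y l = N * η := by rw [hη]; field_simp
  have : ∑ j : ZMod N, (y j - η) ^ 2 = ∑ j, y j ^ 2 - N * η ^ 2 := by
    simp only [sub_sq, sum_add_distrib, sum_sub_distrib, ← sum_mul, ← mul_sum, hs]
    simp [ZMod.card]; ring
  rw [this]
  nlinarith [sq_nonneg η, (Nat.cast_nonneg N : (0 : ℝ) ≤ N)]

lemma sum_norm_conjPoly_sq_le {K : ℕ} (hN : N = 2 * K + 1) (y : ZMod N → ℝ) :
    ∑ j : ZMod N, ‖conjPoly K y (node j)‖ ^ 2 ≤ 2 * ∑ j, y j ^ 2 := by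
  have : ∀ j : ZMod N, ‖conjPoly K y (node j)‖ ^ 2 = (conjPoly K y (node j)).re ^ 2 + y j ^ 2 := by
    intro j
    rw [← Complex.normSq_eq_norm_sq, Complex.normSq_apply, conjPoly_im hN]; ring
  simp_rw [this, sum_add_distrib]
  linarith [sum_conjPoly_re_sq_le hN y]

lemma node_one : node (1 : ZMod N) = Complex.exp ((2 * Real.pi / N : ℝ) * Complex.I) := by
  have := ZMod.stdAddChar_coe (N := N) 1
  simp only [Int.cast_one] at this
  rw [node, this]; congr 1; push_cast; ring

lemma norm_exp_sub_one_le_of_le {s t : ℝ} (hs : 0 ≤ s) (hst : s ≤ t) (ht : t ≤ Real.pi) :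
    ‖Complex.exp (s * Complex.I) - 1‖ ≤ ‖Complex.exp (t * Complex.I) - 1‖ := by
  have h : ∀ s : ℝ, ‖Complex.exp (s * Complex.I) - 1‖ ^ 2 = 2 - 2 * Real.cos s := by
    intro s
    rw [← Complex.normSq_eq_norm_sq, Complex.normSq_apply]
    simp [Complex.exp_ofReal_mul_I_re, Complex.exp_ofReal_mul_I_im]
    nlinarith [Real.sin_sq_add_cos_sq s]
  apply le_of_sq_le_sq _ (norm_nonneg _)
  rw [h, h]
  linarith [Real.cos_le_cos_of_nonneg_of_le_pi hs ht hst]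

/-- Between two neighbouring nodes the interpolating polynomial varies no more than it does over
all the nodes: every Fourier mode `k ≤ K` turns by less than a half turn between two nodes. -/
lemma norm_conjPoly_rotate_sq_le {K : ℕ} (hN : N = 2 * K + 1) (y : ZMod N → ℝ) (j : ZMod N)
    {α : ℝ} (h0 : 0 ≤ α) (h1 : α ≤ 2 * Real.pi / N) :
    ‖conjPoly K y (Complex.exp (α * Complex.I) * node j) - conjPoly K y (node j)‖ ^ 2
      ≤ 2 * ∑ j, (y (j + 1) - y j) ^ 2 := by
  refine le_trans ?_ (sum_norm_conjPoly_sq_le hN (fun j => y (j + 1) - y j))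
  set c : ℕ → ℂ := fun k => conjCoef y k * (Complex.exp (α * Complex.I) ^ k - 1) with hc
  set c' : ℕ → ℂ := fun k => conjCoef y k * (node (1 : ZMod N) ^ k - 1) with hc'
  have hp : ∀ ζ, conjPoly K y (Complex.exp (α * Complex.I) * ζ) - conjPoly K y ζ = sumPow K c ζ := by
    intro ζ
    simp only [conjPoly, sumPow, hc, ← sum_sub_distrib, mul_pow]
    refine sum_congr rfl fun k _ => ?_
    ring
  have hp' : ∀ ζ, conjPoly K (fun j => y (j + 1) - y j) ζ = sumPow K c' ζ := by
    intro ζ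
    rw [conjPoly_diff]
    simp only [conjPoly, sumPow, hc', ← sum_sub_distrib, mul_pow]
    refine sum_congr rfl fun k _ => ?_
    ring
  rw [hp]
  simp_rw [hp']
  refine le_trans (single_le_sum (f := fun j : ZMod N => ‖sumPow K c (node j)‖ ^ 2)
    (fun i _ => sq_nonneg _) (mem_univ j)) ?_
  rw [sum_norm_sumPow_sq (by omega), sum_norm_sumPow_sq (by omega)]
  gcongr with k hk
  simp only [hc, hc', norm_mul]
  gcongr ?_ * ?_
  rw [node_one, ← Complex.exp_nat_mul, ← Complex.exp_nat_mul]
  simp only [mem_range] at hk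
  have e1 : (k : ℂ) * (α * Complex.I) = ((k * α : ℝ) : ℂ) * Complex.I := by push_cast; ring
  have e2 : (k : ℂ) * (((2 * Real.pi / N : ℝ) : ℂ) * Complex.I)
      = ((k * (2 * Real.pi / N) : ℝ) : ℂ) * Complex.I := by push_cast; ring
  rw [e1, e2]
  apply norm_exp_sub_one_le_of_le (by positivity) (by gcongr)
  have hN0 : (0 : ℝ) < N := Nat.cast_pos.2 (NeZero.pos N)
  rw [mul_div_assoc', div_le_iff₀ hN0]
  have : (2 * k : ℝ) ≤ N := by exact_mod_cast (by omega : 2 * k ≤ N)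
  nlinarith [Real.pi_pos]

end Interpolation

end Plurithin

namespace Plurithin

open Finset

/-! ### A discrete Sobolev norm -/

section Sobolev

variable {N : ℕ} {V : Type*} [NormedAddCommGroup V]

/-- The forward difference of a function on `ZMod N`. -/
def diff (f : ZMod N → V) (j : ZMod N) : V := f (j + 1) - f j

lemma diff_add (f g : ZMod N → V) : diff (f + g) = diff f + diff g := by
  funext j; simp only [diff, Pi.add_apply]; abel

lemma norm_add_natCast_sub_le (f : ZMod N → V) (i : ZMod N) (k : ℕ) :
    ‖f (i + k) - f i‖ ≤ ∑ l ∈ range k, ‖diff f (i + l)‖ := by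
  induction k with
  | zero => simp
  | succ k ih =>
    rw [sum_range_succ]
    have : f (i + (k + 1 : ℕ)) - f i = (f (i + k) - f i) + diff f (i + k) := by
      simp only [diff]; push_cast; rw [← add_assoc]; abel
    rw [this]
    exact (norm_add_le _ _).trans (by gcongr)

variable [NeZero N]

/-- The (unnormalised) `ℓ²` norm of a vector-valued function on `ZMod N`. -/
noncomputable def l2 (f : ZMod N → V) : ℝ := ‖(WithLp.toLp 2 f : PiLp 2 (fun _ : ZMod N => V))‖

/-- The discrete counterpart of the Sobolev norm `‖f‖_{L²} + ‖f'‖_{L²}` on the circle. Unlike the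
supremum norm, it is respected by the conjugation operator; and it dominates the supremum norm. -/
noncomputable def sob (f : ZMod N → V) : ℝ := l2 f / √N + √N * l2 (diff f)

lemma l2_sq (f : ZMod N → V) : l2 f ^ 2 = ∑ j, ‖f j‖ ^ 2 := by
  rw [l2, PiLp.norm_sq_eq_of_L2]

lemma l2_nonneg (f : ZMod N → V) : 0 ≤ l2 f := norm_nonneg _

lemma sob_nonneg (f : ZMod N → V) : 0 ≤ sob f := by
  have := l2_nonneg f
  have := l2_nonneg (diff f)
  unfold sob; positivity

lemma sqrt_pos_of_neZero : 0 < √(N : ℝ) := Real.sqrt_pos.2 (Nat.cast_pos.2 (NeZero.pos N))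

lemma l2_add_le (f g : ZMod N → V) : l2 (f + g) ≤ l2 f + l2 g := by
  unfold l2; rw [WithLp.toLp_add]; exact norm_add_le _ _

lemma l2_sub_le (f g : ZMod N → V) : l2 (f - g) ≤ l2 f + l2 g := by
  unfold l2; rw [WithLp.toLp_sub]; exact norm_sub_le _ _

lemma l2_le_of_sq_le {W : Type*} [NormedAddCommGroup W] {f : ZMod N → V} {g : ZMod N → W} {c : ℝ}
    (hc : 0 ≤ c) (h : ∑ j, ‖f j‖ ^ 2 ≤ c ^ 2 * ∑ j, ‖g j‖ ^ 2) : l2 f ≤ c * l2 g := by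
  apply le_of_sq_le_sq _ (mul_nonneg hc (l2_nonneg g))
  rwa [mul_pow, l2_sq, l2_sq]

lemma l2_le_of_le {W : Type*} [NormedAddCommGroup W] {f : ZMod N → V} {g : ZMod N → W} {c : ℝ}
    (hc : 0 ≤ c) (h : ∀ j, ‖f j‖ ≤ c * ‖g j‖) : l2 f ≤ c * l2 g := by
  apply l2_le_of_sq_le hc
  rw [mul_sum]
  gcongr with j
  rw [← mul_pow]
  gcongr
  exact h j

lemma l2_le_of_le_const {f : ZMod N → V} {b : ℝ} (hb : 0 ≤ b) (h : ∀ j, ‖f j‖ ≤ b) :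
    l2 f ≤ √N * b := by
  apply le_of_sq_le_sq _ (by positivity)
  rw [l2_sq, mul_pow, Real.sq_sqrt (Nat.cast_nonneg N)]
  calc ∑ j, ‖f j‖ ^ 2 ≤ ∑ _j : ZMod N, b ^ 2 := by gcongr with j; exact h j
    _ = N * b ^ 2 := by simp [ZMod.card]

lemma sum_norm_le_l2 (f : ZMod N → V) : ∑ j, ‖f j‖ ≤ √N * l2 f := by
  apply le_of_sq_le_sq _ (by have := l2_nonneg f; positivity)
  rw [mul_pow, Real.sq_sqrt (Nat.cast_nonneg N), l2_sq]
  have := sq_sum_le_card_mul_sum_sq (s := (univ : Finset (ZMod N))) (f := fun j => ‖f j‖)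
  simpa [ZMod.card] using this

lemma norm_mean_le_l2 [NormedSpace ℝ V] (f : ZMod N → V) : ‖(N : ℝ)⁻¹ • ∑ j, f j‖ ≤ l2 f / √N := by
  have hN := sqrt_pos_of_neZero (N := N)
  have hN0 : (0 : ℝ) < N := Nat.cast_pos.2 (NeZero.pos N)
  rw [norm_smul, norm_inv, Real.norm_natCast]
  calc (N : ℝ)⁻¹ * ‖∑ j, f j‖ ≤ (N : ℝ)⁻¹ * (√N * l2 f) := by
        gcongr; exact (norm_sum_le _ _).trans (sum_norm_le_l2 f)
    _ = l2 f / √N := by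
        field_simp; rw [Real.sq_sqrt hN0.le]

lemma sum_range_natCast (F : ZMod N → ℝ) : ∑ k ∈ range N, F k = ∑ j : ZMod N, F j := by
  rw [← Fin.sum_univ_eq_sum_range (fun k => F k)]
  obtain ⟨n, hn⟩ : ∃ n, N = n + 1 := ⟨N - 1, by have := NeZero.pos N; omega⟩
  subst hn
  refine sum_congr rfl fun (k : ZMod (n + 1)) _ => ?_
  congr 1
  exact ZMod.natCast_zmod_val k

/-- The discrete Sobolev embedding. -/
lemma norm_le_sob (f : ZMod N → V) (j : ZMod N) : ‖f j‖ ≤ sob f := by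
  have hN := sqrt_pos_of_neZero (N := N)
  -- The value at some node is at most the mean value, the variation is at most the sum of `diff f`.
  obtain ⟨i, hi⟩ : ∃ i, ‖f i‖ ≤ l2 f / √N := by
    by_contra! h
    have h1 : ∑ _j : ZMod N, l2 f / √N < ∑ j, ‖f j‖ := sum_lt_sum_of_nonempty univ_nonempty
      fun j _ => h j
    have h2 : ∑ _j : ZMod N, l2 f / √N = √N * l2 f := by
      simp only [sum_const, card_univ, ZMod.card, nsmul_eq_mul]
      field_simp; rw [Real.sq_sqrt (Nat.cast_nonneg N)]; ring
    linarith [sum_norm_le_l2 f]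
  have h1 : ‖f j - f i‖ ≤ √N * l2 (diff f) := by
    have h2 := norm_add_natCast_sub_le f i (j - i).val
    rw [ZMod.natCast_zmod_val, add_sub_cancel] at h2
    refine h2.trans (le_trans ?_ (sum_norm_le_l2 (diff f)))
    calc ∑ l ∈ range (j - i).val, ‖diff f (i + l)‖ ≤ ∑ l ∈ range N, ‖diff f (i + l)‖ :=
          sum_le_sum_of_subset_of_nonneg (range_mono (ZMod.val_lt _).le)
            fun _ _ _ => norm_nonneg _
      _ = ∑ l : ZMod N, ‖diff f (i + l)‖ := sum_range_natCast (fun l => ‖diff f (i + l)‖)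
      _ = ∑ l : ZMod N, ‖diff f l‖ := Equiv.sum_comp (Equiv.addLeft i) (fun l => ‖diff f l‖)
  calc ‖f j‖ = ‖f i + (f j - f i)‖ := by congr 1; abel
    _ ≤ ‖f i‖ + ‖f j - f i‖ := norm_add_le _ _
    _ ≤ sob f := by unfold sob; gcongr

lemma sob_add_le (f g : ZMod N → V) : sob (f + g) ≤ sob f + sob g := by
  have h1 := l2_add_le f g
  have h2 := l2_add_le (diff f) (diff g)
  calc sob (f + g) ≤ (l2 f + l2 g) / √N + √N * (l2 (diff f) + l2 (diff g)) := by
        unfold sob; rw [diff_add]; gcongr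
    _ = sob f + sob g := by unfold sob; ring

/-- Composition with a map of small Lipschitz constant. -/
lemma sob_comp_le {W : Type*} [NormedAddCommGroup W] {g : V → W} {δ : ℝ}
    (hδ : 0 ≤ δ) (h0 : g 0 = 0) (hg : ∀ x y, ‖g x - g y‖ ≤ δ * ‖x - y‖) (x : ZMod N → V) :
    sob (fun j => g (x j)) ≤ δ * sob x := by
  have h1 : l2 (fun j => g (x j)) ≤ δ * l2 x := l2_le_of_le hδ fun j => by
    simpa [h0] using hg (x j) 0
  have h2 : l2 (diff fun j => g (x j)) ≤ δ * l2 (diff x) := l2_le_of_le hδ fun j => hg _ _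
  calc sob (fun j => g (x j)) ≤ (δ * l2 x) / √N + √N * (δ * l2 (diff x)) := by
        unfold sob; gcongr
    _ = δ * sob x := by unfold sob; ring

/-- Composition with a map which is small in `C^{1,1}` is Lipschitz in the Sobolev norm. -/
lemma sob_comp_sub_le {W : Type*} [NormedAddCommGroup W] {g : V → W} {δ R : ℝ}
    (hδ : 0 ≤ δ) (hg : ∀ x y, ‖g x - g y‖ ≤ δ * ‖x - y‖)
    (hg2 : ∀ x y x' y', ‖x‖ ≤ R → ‖y‖ ≤ R → ‖x'‖ ≤ R → ‖y'‖ ≤ R →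
      ‖(g y - g x) - (g y' - g x')‖ ≤
        δ * (‖(y - x) - (y' - x')‖ + (‖x - x'‖ + ‖y - y'‖) * ‖y' - x'‖))
    {x x' : ZMod N → V} (hx : ∀ j, ‖x j‖ ≤ R) (hx' : ∀ j, ‖x' j‖ ≤ R) :
    sob (fun j => g (x j) - g (x' j)) ≤ δ * (1 + 2 * sob x') * sob (x - x') := by
  have hN := sqrt_pos_of_neZero (N := N)
  set s := sob (x - x') with hs
  have hs0 : 0 ≤ s := sob_nonneg _
  have h1 : l2 (fun j => g (x j) - g (x' j)) ≤ δ * l2 (x - x') := l2_le_of_le hδ fun j => hg _ _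
  have hl := l2_nonneg (diff (x - x'))
  have hl' := l2_nonneg (diff x')
  have h2 : l2 (diff fun j => g (x j) - g (x' j)) ≤
      δ * l2 (diff (x - x')) + (δ * (2 * s)) * l2 (diff x') := by
    set a : ZMod N → ℝ := fun j => δ * ‖diff (x - x') j‖ with ha
    set b : ZMod N → ℝ := fun j => (δ * (2 * s)) * ‖diff x' j‖ with hb
    have e1 : l2 (diff fun j => g (x j) - g (x' j)) ≤ 1 * l2 (a + b) := by
      refine l2_le_of_le zero_le_one fun j => ?_
      have e2 := hg2 (x j) (x (j + 1)) (x' j) (x' (j + 1)) (hx _) (hx _) (hx' _) (hx' _)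
      have e3 : ‖x j - x' j‖ ≤ s := norm_le_sob (x - x') j
      have e4 : ‖x (j + 1) - x' (j + 1)‖ ≤ s := norm_le_sob (x - x') (j + 1)
      have e5 : diff (fun j => g (x j) - g (x' j)) j
          = (g (x (j + 1)) - g (x j)) - (g (x' (j + 1)) - g (x' j)) := by
        simp only [diff]; abel
      have e6 : diff (x - x') j = (x (j + 1) - x j) - (x' (j + 1) - x' j) := by
        simp only [diff, Pi.sub_apply]; abel
      have e7 : (‖x j - x' j‖ + ‖x (j + 1) - x' (j + 1)‖) * ‖x' (j + 1) - x' j‖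
          ≤ (2 * s) * ‖x' (j + 1) - x' j‖ := by gcongr; linarith
      rw [e5, one_mul]
      refine le_trans ?_ (le_abs_self _)
      simp only [Pi.add_apply, ha, hb, e6]
      calc _ ≤ _ := e2
        _ ≤ δ * (‖(x (j + 1) - x j) - (x' (j + 1) - x' j)‖ + (2 * s) * ‖x' (j + 1) - x' j‖) := by
            gcongr
        _ = _ := by simp only [diff]; ring
    have e2 : l2 a ≤ δ * l2 (diff (x - x')) := l2_le_of_le hδ fun j => by
      simp [ha, abs_of_nonneg hδ]
    have e3 : l2 b ≤ (δ * (2 * s)) * l2 (diff x') := l2_le_of_le (by positivity) fun j => by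
      simp [hb, abs_of_nonneg hδ, abs_of_nonneg hs0]
    linarith [l2_add_le a b]
  have h3 : √N * l2 (diff x') ≤ sob x' := by
    have := l2_nonneg x'
    unfold sob
    have : 0 ≤ l2 x' / √N := by positivity
    linarith
  calc sob (fun j => g (x j) - g (x' j))
      ≤ (δ * l2 (x - x')) / √N + √N * (δ * l2 (diff (x - x')) + (δ * (2 * s)) * l2 (diff x')) := by
        unfold sob; gcongr
    _ = δ * s + (δ * (2 * s)) * (√N * l2 (diff x')) := by rw [hs]; unfold sob; ring
    _ ≤ δ * s + (δ * (2 * s)) * sob x' := by gcongr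
    _ = _ := by ring

end Sobolev

end Plurithin

namespace Plurithin

open Finset

/-! ### Vector-valued interpolation and the basic meromorphic discs -/

section Coordinates

variable {n : ℕ}

/-- The Euclidean space `ℝⁿ`. -/
abbrev Rn (n : ℕ) : Type := EuclideanSpace ℝ (Fin n)

/-- The inclusion `ℝⁿ ⊆ ℂⁿ`. -/
noncomputable def ofE (x : Rn n) : Cn n := WithLp.toLp 2 fun i => (x i : ℂ)

/-- The componentwise real part `ℂⁿ → ℝⁿ`. -/
noncomputable def reV (z : Cn n) : Rn n := WithLp.toLp 2 fun i => (z i).re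

/-- The componentwise imaginary part `ℂⁿ → ℝⁿ`. -/
noncomputable def imV (z : Cn n) : Rn n := WithLp.toLp 2 fun i => (z i).im

@[simp] lemma ofE_apply (x : Rn n) (i : Fin n) : ofE x i = (x i : ℂ) := rfl
@[simp] lemma reV_apply (z : Cn n) (i : Fin n) : reV z i = (z i).re := rfl
@[simp] lemma imV_apply (z : Cn n) (i : Fin n) : imV z i = (z i).im := rfl

lemma reV_sub (z w : Cn n) : reV (z - w) = reV z - reV w := by ext i; simp
lemma imV_sub (z w : Cn n) : imV (z - w) = imV z - imV w := by ext i; simp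

lemma norm_sq_eq_re_add_im (z : Cn n) : ‖z‖ ^ 2 = ‖reV z‖ ^ 2 + ‖imV z‖ ^ 2 := by
  rw [EuclideanSpace.norm_sq_eq, EuclideanSpace.norm_sq_eq, EuclideanSpace.norm_sq_eq,
    ← sum_add_distrib]
  refine sum_congr rfl fun i _ => ?_
  rw [← Complex.normSq_eq_norm_sq, Complex.normSq_apply]
  simp [pow_two]

lemma norm_reV_le (z : Cn n) : ‖reV z‖ ≤ ‖z‖ :=
  le_of_sq_le_sq (by rw [norm_sq_eq_re_add_im z]; nlinarith [sq_nonneg ‖imV z‖]) (norm_nonneg _)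

lemma norm_imV_le (z : Cn n) : ‖imV z‖ ≤ ‖z‖ :=
  le_of_sq_le_sq (by rw [norm_sq_eq_re_add_im z]; nlinarith [sq_nonneg ‖reV z‖]) (norm_nonneg _)

lemma norm_le_reV_add_imV (z : Cn n) : ‖z‖ ≤ ‖reV z‖ + ‖imV z‖ := by
  refine le_of_sq_le_sq ?_ (by positivity)
  rw [norm_sq_eq_re_add_im z]; nlinarith [norm_nonneg (reV z), norm_nonneg (imV z)]

lemma norm_ofE (x : Rn n) : ‖ofE x‖ = ‖x‖ := by
  rw [EuclideanSpace.norm_eq, EuclideanSpace.norm_eq]; simp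

end Coordinates

section Conjugate

variable {n N : ℕ} [NeZero N]

/-- The vector-valued version of `conjPoly`. -/
noncomputable def conjPolyV (K : ℕ) (y : ZMod N → Rn n) (ζ : ℂ) : Cn n :=
  WithLp.toLp 2 fun i => conjPoly K (fun j => y j i) ζ

lemma conjPolyV_im {K : ℕ} (hN : N = 2 * K + 1) (y : ZMod N → Rn n) (j : ZMod N) :
    imV (conjPolyV K y (node j)) = y j := by
  ext i; exact conjPoly_im hN (fun j => y j i) j

lemma conjPolyV_zero (K : ℕ) (y : ZMod N → Rn n) :
    conjPolyV K y 0 = Complex.I • ofE ((N : ℝ)⁻¹ • ∑ j, y j) := by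
  ext i
  have := conjPoly_zero K (fun j => y j i)
  simpa [conjPolyV] using this

lemma conjPolyV_sub (K : ℕ) (y y' : ZMod N → Rn n) (ζ : ℂ) :
    conjPolyV K (y - y') ζ = conjPolyV K y ζ - conjPolyV K y' ζ := by
  ext i; exact conjPoly_sub K (fun j => y j i) (fun j => y' j i) ζ

lemma conjPolyV_diff (K : ℕ) (y : ZMod N → Rn n) (j : ZMod N) :
    conjPolyV K (diff y) (node j) = conjPolyV K y (node (j + 1)) - conjPolyV K y (node j) := by
  have : node (j + 1) = node (1 : ZMod N) * node j := by
    rw [node, node, node, ← AddChar.map_add_eq_mul, add_comm]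
  rw [this]
  ext i; exact conjPoly_diff K (fun j => y j i) (node j)

lemma differentiable_conjPolyV (K : ℕ) (y : ZMod N → Rn n) : Differentiable ℂ (conjPolyV K y) := by
  rw [differentiable_euclidean]
  intro i
  change Differentiable ℂ fun ζ => ∑ k ∈ range (K + 1), conjCoef (fun j => y j i) k * ζ ^ k
  fun_prop

lemma l2_reV_conjPolyV_le {K : ℕ} (hN : N = 2 * K + 1) (y : ZMod N → Rn n) :
    l2 (fun j : ZMod N => reV (conjPolyV K y (node j))) ≤ l2 y := by
  rw [← one_mul (l2 y)]
  apply l2_le_of_sq_le zero_le_one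
  simp only [EuclideanSpace.norm_sq_eq, Real.norm_eq_abs, sq_abs, one_pow, one_mul]
  rw [sum_comm, sum_comm (t := (univ : Finset (Fin n)))]
  exact sum_le_sum fun i _ => sum_conjPoly_re_sq_le hN (fun j => y j i)

lemma norm_conjPolyV_rotate_le {K : ℕ} (hN : N = 2 * K + 1) (y : ZMod N → Rn n) (j : ZMod N)
    {α : ℝ} (h0 : 0 ≤ α) (h1 : α ≤ 2 * Real.pi / N) :
    ‖conjPolyV K y (Complex.exp (α * Complex.I) * node j) - conjPolyV K y (node j)‖
      ≤ 2 * l2 (diff y) := by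
  have hl := l2_nonneg (diff y)
  refine le_of_sq_le_sq ?_ (by positivity)
  have : ‖conjPolyV K y (Complex.exp (α * Complex.I) * node j) - conjPolyV K y (node j)‖ ^ 2
      ≤ 2 * l2 (diff y) ^ 2 := by
    rw [l2_sq]
    simp only [EuclideanSpace.norm_sq_eq (𝕜 := ℝ), Real.norm_eq_abs, sq_abs]
    rw [sum_comm, EuclideanSpace.norm_sq_eq, mul_sum]
    exact sum_le_sum fun i _ => norm_conjPoly_rotate_sq_le hN (fun j => y j i) j h0 h1
  nlinarith [sq_nonneg (l2 (diff y))]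

/-- The conjugation operator does not increase the Sobolev norm, since it commutes with `diff`. -/
lemma sob_reV_conjPolyV_le {K : ℕ} (hN : N = 2 * K + 1) (y : ZMod N → Rn n) :
    sob (fun j : ZMod N => reV (conjPolyV K y (node j))) ≤ sob y := by
  have h1 := l2_reV_conjPolyV_le hN y
  have h2 := l2_reV_conjPolyV_le hN (diff y)
  have h3 : diff (fun j : ZMod N => reV (conjPolyV K y (node j)))
      = fun j : ZMod N => reV (conjPolyV K (diff y) (node j)) := by
    funext j; rw [conjPolyV_diff, reV_sub]; rfl
  unfold sob
  rw [h3]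
  gcongr

/-- Every point of the unit circle lies between two neighbouring nodes. -/
lemma exists_node_mul_exp {ζ : ℂ} (hζ : ‖ζ‖ = 1) :
    ∃ (j : ZMod N) (α : ℝ), 0 ≤ α ∧ α ≤ 2 * Real.pi / N ∧ ζ = Complex.exp (α * Complex.I) * node j := by
  have hN0 : (0 : ℝ) < N := Nat.cast_pos.2 (NeZero.pos N)
  have hπ := Real.pi_pos
  set θ := Complex.arg ζ
  have hz : ζ = Complex.exp (θ * Complex.I) := by
    have := Complex.norm_mul_exp_arg_mul_I ζ
    rw [hζ] at this; simpa using this.symm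
  set q : ℤ := ⌊θ / (2 * Real.pi / N)⌋ with hq
  have hs : 0 < 2 * Real.pi / N := by positivity
  refine ⟨(q : ZMod N), θ - q * (2 * Real.pi / N), ?_, ?_, ?_⟩
  · have := Int.floor_le (θ / (2 * Real.pi / N))
    rw [le_div_iff₀ hs, ← hq] at this; linarith
  · have := (Int.lt_floor_add_one (θ / (2 * Real.pi / N))).le
    rw [div_le_iff₀ hs, ← hq] at this; linarith
  · rw [node, ZMod.stdAddChar_coe, ← Complex.exp_add, hz]
    congr 1
    have : (N : ℂ) ≠ 0 := Nat.cast_ne_zero.2 (NeZero.ne N)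
    push_cast
    field_simp
    ring

lemma one_le_sqrt : 1 ≤ √(N : ℝ) := by
  rw [Real.one_le_sqrt]; exact_mod_cast NeZero.pos N

lemma l2_diff_le_sob {V : Type*} [NormedAddCommGroup V] (y : ZMod N → V) :
    l2 (diff y) ≤ sob y / √N := by
  have hN := sqrt_pos_of_neZero (N := N)
  rw [le_div_iff₀ hN, sob]
  have : 0 ≤ l2 y / √N := div_nonneg (l2_nonneg _) hN.le
  linarith

/-- The interpolating polynomial is bounded by the Sobolev norm of its data, uniformly in `N`: at the
nodes by the Sobolev embedding, on the circle by the estimate between the nodes, on the disc by the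
maximum principle. -/
lemma norm_conjPolyV_le {K : ℕ} (hN : N = 2 * K + 1) (y : ZMod N → Rn n) {ζ : ℂ} (hζ : ‖ζ‖ ≤ 1) :
    ‖conjPolyV K y ζ‖ ≤ 4 * sob y := by
  have hs := sob_nonneg y
  have hcirc : ∀ ζ : ℂ, ‖ζ‖ = 1 → ‖conjPolyV K y ζ‖ ≤ 4 * sob y := by
    intro ζ hζ
    obtain ⟨j, α, h0, h1, rfl⟩ := exists_node_mul_exp (N := N) hζ
    have e1 := norm_conjPolyV_rotate_le hN y j h0 h1
    have e2 : l2 (diff y) ≤ sob y := (l2_diff_le_sob y).trans (div_le_self hs one_le_sqrt)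
    have e3 : ‖conjPolyV K y (node j)‖ ≤ 2 * sob y := by
      have a1 := norm_le_reV_add_imV (conjPolyV K y (node j))
      have a2 := norm_le_sob (fun j : ZMod N => reV (conjPolyV K y (node j))) j
      have a3 := sob_reV_conjPolyV_le hN y
      rw [conjPolyV_im hN] at a1
      have a4 := norm_le_sob y j
      linarith
    have e4 := norm_le_norm_add_norm_sub' (conjPolyV K y (Complex.exp (α * Complex.I) * node j))
      (conjPolyV K y (node j))
    linarith
  refine Complex.norm_le_of_forall_mem_frontier_norm_le (U := Metric.ball (0 : ℂ) 1)
    Metric.isBounded_ball (differentiable_conjPolyV K y).diffContOnCl ?_ ?_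
  · intro z hz
    rw [frontier_ball _ one_ne_zero] at hz
    exact hcirc z (by simpa using hz)
  · rw [closure_ball _ one_ne_zero]; simpa using hζ

end Conjugate

section BaseDisc

/-- The function `ζ / ((1 - ζ/2) (ζ - 1/2))`: it is positive on the unit circle, has a zero at the
centre and one pole in the unit disc. -/
noncomputable def kap (ζ : ℂ) : ℂ := ζ / ((1 - ζ / 2) * (ζ - 1 / 2))

/-- A function which is real on the unit circle, with value `-i` at the centre and one pole, at
`1/2`, in the unit disc. -/
noncomputable def kapI (ζ : ℂ) : ℂ := Complex.I * (1 - ζ ^ 2) / (2 * ((1 - ζ / 2) * (ζ - 1 / 2)))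

/-- The values of `kap` on the unit circle. -/
noncomputable def kapCirc (ζ : ℂ) : ℝ := (Complex.normSq (1 - ζ / 2))⁻¹

lemma kap_denom {ζ : ℂ} (hζ : ‖ζ‖ = 1) :
    (1 - ζ / 2) * (ζ - 1 / 2) = ζ * (Complex.normSq (1 - ζ / 2) : ℂ) := by
  have h : ζ * starRingEnd ℂ ζ = 1 := by
    rw [Complex.mul_conj, Complex.normSq_eq_norm_sq, hζ]; simp
  rw [← Complex.mul_conj]
  simp only [map_sub, map_one, map_div₀, Complex.conj_ofNat]
  linear_combination (1 - ζ / 2) / 2 * h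

lemma quarter_le_normSq {ζ : ℂ} (hζ : ‖ζ‖ = 1) : 1 / 4 ≤ Complex.normSq (1 - ζ / 2) := by
  have h1 : ‖(1 : ℂ)‖ - ‖ζ / 2‖ ≤ ‖1 - ζ / 2‖ := norm_sub_norm_le _ _
  have h2 : ‖ζ / 2‖ = 1 / 2 := by simp [hζ]
  rw [h2, norm_one] at h1
  rw [Complex.normSq_eq_norm_sq]
  nlinarith

lemma normSq_le {ζ : ℂ} (hζ : ‖ζ‖ = 1) : Complex.normSq (1 - ζ / 2) ≤ 9 / 4 := by
  have h1 : ‖1 - ζ / 2‖ ≤ ‖(1 : ℂ)‖ + ‖ζ / 2‖ := norm_sub_le _ _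
  have h2 : ‖ζ / 2‖ = 1 / 2 := by simp [hζ]
  rw [h2, norm_one] at h1
  rw [Complex.normSq_eq_norm_sq]
  nlinarith [norm_nonneg (1 - ζ / 2)]

lemma kap_of_norm {ζ : ℂ} (hζ : ‖ζ‖ = 1) : kap ζ = (kapCirc ζ : ℂ) := by
  have h0 : ζ ≠ 0 := by rintro rfl; simp at hζ
  have h1 : (Complex.normSq (1 - ζ / 2) : ℂ) ≠ 0 := by
    have := quarter_le_normSq hζ
    exact_mod_cast (by linarith : (0 : ℝ) < Complex.normSq (1 - ζ / 2)).ne'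
  rw [kap, kap_denom hζ, kapCirc]
  push_cast
  field_simp

lemma kapI_of_norm {ζ : ℂ} (hζ : ‖ζ‖ = 1) : kapI ζ = ((ζ.im * kapCirc ζ : ℝ) : ℂ) := by
  have h0 : ζ ≠ 0 := by rintro rfl; simp at hζ
  have h1 : (Complex.normSq (1 - ζ / 2) : ℂ) ≠ 0 := by
    have := quarter_le_normSq hζ
    exact_mod_cast (by linarith : (0 : ℝ) < Complex.normSq (1 - ζ / 2)).ne'
  have h : ζ * starRingEnd ℂ ζ = 1 := by
    rw [Complex.mul_conj, Complex.normSq_eq_norm_sq, hζ]; simp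
  have h2 : ζ - starRingEnd ℂ ζ = (2 * ζ.im : ℝ) * Complex.I := Complex.sub_conj ζ
  have h3 : Complex.I * (1 - ζ ^ 2) = 2 * ζ * ζ.im := by
    have : 1 - ζ ^ 2 = -ζ * ((2 * ζ.im : ℝ) * Complex.I) := by
      rw [← h2]; linear_combination -h
    rw [this]; push_cast
    linear_combination (-2 * ζ * ζ.im) * Complex.I_mul_I
  rw [kapI, kap_denom hζ, kapCirc, h3]
  push_cast
  field_simp

lemma kap_zero : kap 0 = 0 := by simp [kap]

lemma kapI_zero : kapI 0 = -Complex.I := by simp [kapI, div_neg]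

lemma kapCirc_bounds {ζ : ℂ} (hζ : ‖ζ‖ = 1) : 4 / 9 ≤ kapCirc ζ ∧ kapCirc ζ ≤ 4 := by
  have h1 := quarter_le_normSq hζ
  have h2 := normSq_le hζ
  unfold kapCirc
  constructor
  · rw [le_inv_comm₀ (by norm_num) (by linarith)]; linarith
  · rw [inv_le_comm₀ (by linarith) (by norm_num)]; linarith

lemma abs_kapCirc_sub_le {ζ ξ : ℂ} (hζ : ‖ζ‖ = 1) (hξ : ‖ξ‖ = 1) : |kapCirc ζ - kapCirc ξ| ≤ 24 * ‖ζ - ξ‖ := by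
  have h1 := quarter_le_normSq hζ
  have h2 := quarter_le_normSq hξ
  have h3 := normSq_le hζ
  have h4 := normSq_le hξ
  set p := Complex.normSq (1 - ζ / 2) with hp
  set q := Complex.normSq (1 - ξ / 2) with hq
  have e1 : |p - q| ≤ 3 / 2 * ‖ζ - ξ‖ := by
    have a1 : |‖1 - ζ / 2‖ - ‖1 - ξ / 2‖| ≤ ‖ζ - ξ‖ / 2 := by
      refine (abs_norm_sub_norm_le _ _).trans (le_of_eq ?_)
      rw [show 1 - ζ / 2 - (1 - ξ / 2) = (ξ - ζ) / 2 by ring, norm_div, norm_sub_rev]; simp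
    have a2 : ‖1 - ζ / 2‖ ≤ 3 / 2 := by
      rw [Complex.normSq_eq_norm_sq] at hp; nlinarith [norm_nonneg (1 - ζ / 2)]
    have a3 : ‖1 - ξ / 2‖ ≤ 3 / 2 := by
      rw [Complex.normSq_eq_norm_sq] at hq; nlinarith [norm_nonneg (1 - ξ / 2)]
    rw [hp, hq, Complex.normSq_eq_norm_sq, Complex.normSq_eq_norm_sq, sq_sub_sq, abs_mul,
      abs_of_nonneg (by positivity)]
    calc _ ≤ (3 / 2 + 3 / 2) * (‖ζ - ξ‖ / 2) := by gcongr
      _ = _ := by ring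
  have e2 : kapCirc ζ - kapCirc ξ = (q - p) / (p * q) := by
    unfold kapCirc
    have : p ≠ 0 := by linarith
    have : q ≠ 0 := by linarith
    rw [← hp, ← hq]; field_simp
  rw [e2, abs_div, abs_of_pos (by positivity : 0 < p * q), div_le_iff₀ (by positivity), abs_sub_comm]
  have : 1 / 16 ≤ p * q := by nlinarith
  nlinarith [norm_nonneg (ζ - ξ)]

lemma abs_im_mul_kapCirc_le {ζ : ℂ} (hζ : ‖ζ‖ = 1) : |ζ.im * kapCirc ζ| ≤ 4 := by
  obtain ⟨h1, h2⟩ := kapCirc_bounds hζ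
  have h3 := Complex.abs_im_le_norm ζ
  rw [hζ] at h3
  rw [abs_mul, abs_of_nonneg (by linarith : 0 ≤ kapCirc ζ)]
  nlinarith [abs_nonneg ζ.im]

lemma abs_im_mul_kapCirc_sub_le {ζ ξ : ℂ} (hζ : ‖ζ‖ = 1) (hξ : ‖ξ‖ = 1) :
    |ζ.im * kapCirc ζ - ξ.im * kapCirc ξ| ≤ 28 * ‖ζ - ξ‖ := by
  have h1 := abs_kapCirc_sub_le hζ hξ
  obtain ⟨_, h2⟩ := kapCirc_bounds hξ
  obtain ⟨h2', _⟩ := kapCirc_bounds hξ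
  have h3 := Complex.abs_im_le_norm ζ
  rw [hζ] at h3
  have h4 := Complex.abs_im_le_norm (ζ - ξ)
  rw [Complex.sub_im] at h4
  have e : ζ.im * kapCirc ζ - ξ.im * kapCirc ξ = ζ.im * (kapCirc ζ - kapCirc ξ) + (ζ.im - ξ.im) * kapCirc ξ := by ring
  rw [e]
  refine (abs_add_le _ _).trans ?_
  rw [abs_mul, abs_mul, abs_of_nonneg (by linarith : 0 ≤ kapCirc ξ)]
  have : |ζ.im| * |kapCirc ζ - kapCirc ξ| ≤ 1 * (24 * ‖ζ - ξ‖) := by gcongr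
  have : |ζ.im - ξ.im| * kapCirc ξ ≤ ‖ζ - ξ‖ * 4 := by gcongr
  linarith

lemma norm_kap_le {ζ : ℂ} (hζ : ‖ζ‖ ≤ 1) (h : 1 / 3 ≤ ‖ζ - 1 / 2‖) : ‖kap ζ‖ ≤ 6 ∧ ‖kapI ζ‖ ≤ 6 := by
  have h1 : 1 / 2 ≤ ‖1 - ζ / 2‖ := by
    have h1 : ‖(1 : ℂ)‖ - ‖ζ / 2‖ ≤ ‖1 - ζ / 2‖ := norm_sub_norm_le _ _
    have h2 : ‖ζ / 2‖ ≤ 1 / 2 := by rw [norm_div]; simp; linarith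
    rw [norm_one] at h1; linarith
  have h2 : 1 / 6 ≤ ‖(1 - ζ / 2) * (ζ - 1 / 2)‖ := by rw [norm_mul]; nlinarith
  constructor
  · rw [kap, norm_div, div_le_iff₀ (by linarith)]; linarith
  · have h3 : ‖1 - ζ ^ 2‖ ≤ 2 := by
      refine (norm_sub_le _ _).trans ?_
      rw [norm_one, norm_pow]; nlinarith [norm_nonneg ζ]
    rw [kapI, norm_div, norm_mul, norm_mul, Complex.norm_I, one_mul, Complex.norm_two,
      div_le_iff₀ (by linarith)]
    linarith

lemma differentiableAt_kap {ζ : ℂ} (h1 : ζ ≠ 1 / 2) (h2 : ζ ≠ 2) :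
    DifferentiableAt ℂ kap ζ ∧ DifferentiableAt ℂ kapI ζ := by
  have h : (1 - ζ / 2) * (ζ - 1 / 2) ≠ 0 := by
    refine mul_ne_zero ?_ (sub_ne_zero.2 h1)
    intro h; exact h2 (by linear_combination -2 * h)
  unfold kap kapI
  exact ⟨by fun_prop (disch := exact h), by
    fun_prop (disch := exact mul_ne_zero two_ne_zero h)⟩

end BaseDisc

end Plurithin

namespace Plurithin

open Finset

/-! ### Bishop's equation at the nodes -/

section Bishop

variable {n N : ℕ} [NeZero N]

/-- The linear operator of the discrete Bishop equation. If `x = κ v + corr (g ∘ x)` at the nodes,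
then the disc `κ v + kapI η + conjPolyV y`, with `y = Im g (x)` and `η` the mean of `y`, takes the
values `x + g (x)` at the nodes and the value `0` at the centre. -/
noncomputable def corr (K : ℕ) (G : ZMod N → Cn n) (j : ZMod N) : Rn n :=
  ((node j).im * kapCirc (node j)) • ((N : ℝ)⁻¹ • ∑ l, imV (G l))
    + reV (conjPolyV K (fun l => imV (G l)) (node j)) - reV (G j)

lemma corr_sub (K : ℕ) (G G' : ZMod N → Cn n) :
    corr K (fun j => G j - G' j) = corr K G - corr K G' := by
  funext j
  have h : (fun l => imV (G l - G' l)) = (fun l => imV (G l)) - fun l => imV (G' l) := by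
    funext l; exact imV_sub _ _
  unfold corr
  rw [h, conjPolyV_sub]
  simp only [Pi.sub_apply, reV_sub, sum_sub_distrib, smul_sub]
  abel

lemma norm_mean_imV_le (G : ZMod N → Cn n) : ‖(N : ℝ)⁻¹ • ∑ l, imV (G l)‖ ≤ l2 G / √N := by
  refine (norm_mean_le_l2 fun l => imV (G l)).trans ?_
  have : l2 (fun l => imV (G l)) ≤ 1 * l2 G := l2_le_of_le zero_le_one fun j => by
    rw [one_mul]; exact norm_imV_le _
  rw [one_mul] at this
  gcongr

lemma l2_imV_le (G : ZMod N → Cn n) : l2 (fun l => imV (G l)) ≤ l2 G := by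
  have : l2 (fun l => imV (G l)) ≤ 1 * l2 G := l2_le_of_le zero_le_one fun j => by
    rw [one_mul]; exact norm_imV_le _
  rwa [one_mul] at this

lemma l2_reV_le (G : ZMod N → Cn n) : l2 (fun l => reV (G l)) ≤ l2 G := by
  have : l2 (fun l => reV (G l)) ≤ 1 * l2 G := l2_le_of_le zero_le_one fun j => by
    rw [one_mul]; exact norm_reV_le _
  rwa [one_mul] at this

lemma l2_corr_le {K : ℕ} (hN : N = 2 * K + 1) (G : ZMod N → Cn n) : l2 (corr K G) ≤ 6 * l2 G := by
  have hs := sqrt_pos_of_neZero (N := N)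
  set η := (N : ℝ)⁻¹ • ∑ l, imV (G l) with hη
  have e : corr K G = (fun j : ZMod N => ((node j).im * kapCirc (node j)) • η)
      + (fun j : ZMod N => reV (conjPolyV K (fun l => imV (G l)) (node j))) - fun j => reV (G j) := rfl
  have h1 : l2 (fun j : ZMod N => ((node j).im * kapCirc (node j)) • η) ≤ √N * (4 * ‖η‖) :=
    l2_le_of_le_const (by positivity) fun j => by
      rw [norm_smul]; gcongr; exact abs_im_mul_kapCirc_le (norm_node j)
  have h2 : √N * ‖η‖ ≤ l2 G := by
    have := norm_mean_imV_le G
    rw [le_div_iff₀ hs] at this; linarith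
  have h3 := (l2_reV_conjPolyV_le hN fun l => imV (G l)).trans (l2_imV_le G)
  have h4 := l2_reV_le G
  rw [e]
  refine (l2_sub_le _ _).trans ?_
  linarith [l2_add_le (fun j : ZMod N => ((node j).im * kapCirc (node j)) • η)
      (fun j : ZMod N => reV (conjPolyV K (fun l => imV (G l)) (node j)))]

lemma norm_exp_mul_node_sub_le (j : ZMod N) {α : ℝ} (h0 : 0 ≤ α) (h1 : α ≤ 2 * Real.pi / N) :
    ‖Complex.exp (α * Complex.I) * node j - node j‖ ≤ 7 / N := by
  have : Complex.exp (α * Complex.I) * node j - node j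
      = (Complex.exp (Complex.I * α) - 1) * node j := by rw [mul_comm Complex.I]; ring
  rw [this, norm_mul, norm_node, mul_one]
  refine (Real.norm_exp_I_mul_ofReal_sub_one_le).trans ?_
  rw [Real.norm_of_nonneg h0]
  refine h1.trans ?_
  gcongr
  linarith [Real.pi_lt_d2]

lemma node_succ (j : ZMod N) :
    node (j + 1) = Complex.exp ((2 * Real.pi / N : ℝ) * Complex.I) * node j := by
  rw [← node_one, node, node, node, ← AddChar.map_add_eq_mul, add_comm]

lemma norm_node_succ_sub_le (j : ZMod N) : ‖node (j + 1) - node j‖ ≤ 7 / N := by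
  rw [node_succ]
  exact norm_exp_mul_node_sub_le j (by have := Real.pi_pos; positivity) le_rfl

lemma diff_corr (K : ℕ) (G : ZMod N → Cn n) :
    diff (corr K G) = (fun j : ZMod N => ((node (j + 1)).im * kapCirc (node (j + 1))
        - (node j).im * kapCirc (node j)) • ((N : ℝ)⁻¹ • ∑ l, imV (G l)))
      + (fun j : ZMod N => reV (conjPolyV K (diff fun l => imV (G l)) (node j)))
      - fun j => reV (diff G j) := by
  funext j
  rw [show diff (corr K G) j = corr K G (j + 1) - corr K G j from rfl]
  simp only [corr, Pi.add_apply, Pi.sub_apply, conjPolyV_diff, reV_sub, sub_smul,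
    show diff G j = G (j + 1) - G j from rfl]
  abel

lemma sob_corr_le {K : ℕ} (hN : N = 2 * K + 1) (G : ZMod N → Cn n) :
    sob (corr K G) ≤ 300 * sob G := by
  have hs := sqrt_pos_of_neZero (N := N)
  have hN0 : (0 : ℝ) < N := Nat.cast_pos.2 (NeZero.pos N)
  have hsq : √(N : ℝ) * √N = N := Real.mul_self_sqrt hN0.le
  set η := (N : ℝ)⁻¹ • ∑ l, imV (G l) with hη
  have h2 : ‖η‖ ≤ l2 G / √N := norm_mean_imV_le G
  have h1 : l2 (fun j : ZMod N => ((node (j + 1)).im * kapCirc (node (j + 1))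
        - (node j).im * kapCirc (node j)) • η) ≤ √N * (28 * (7 / N) * ‖η‖) :=
    l2_le_of_le_const (by positivity) fun j => by
      rw [norm_smul]; gcongr
      refine (abs_im_mul_kapCirc_sub_le (norm_node _) (norm_node _)).trans ?_
      gcongr
      exact norm_node_succ_sub_le j
  have hd : (diff fun l => imV (G l)) = fun l => imV (diff G l) := by
    funext l; simp only [diff, imV_sub]
  have h3 := l2_reV_conjPolyV_le hN (diff fun l => imV (G l))
  have h3' : l2 (diff fun l => imV (G l)) ≤ l2 (diff G) := by rw [hd]; exact l2_imV_le (diff G)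
  have h4 := l2_reV_le (diff G)
  have h5 : l2 (diff (corr K G)) ≤ √N * (28 * (7 / N) * ‖η‖) + 2 * l2 (diff G) := by
    rw [diff_corr]
    refine (l2_sub_le _ _).trans ?_
    linarith [l2_add_le (fun j : ZMod N => ((node (j + 1)).im * kapCirc (node (j + 1))
        - (node j).im * kapCirc (node j)) • η)
      (fun j : ZMod N => reV (conjPolyV K (diff fun l => imV (G l)) (node j)))]
  have h6 : √N * l2 (diff (corr K G)) ≤ 196 * ‖η‖ + 2 * (√N * l2 (diff G)) := by
    calc _ ≤ √N * (√N * (28 * (7 / N) * ‖η‖) + 2 * l2 (diff G)) := by gcongr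
      _ = (√N * √N) * (196 / N * ‖η‖) + 2 * (√N * l2 (diff G)) := by ring
      _ = _ := by rw [hsq]; field_simp
  have h7 : l2 (corr K G) / √N ≤ 6 * (l2 G / √N) := by
    rw [← mul_div_assoc]; gcongr; exact l2_corr_le hN G
  have h8 : 0 ≤ √N * l2 (diff G) := mul_nonneg hs.le (l2_nonneg _)
  have h9 : 0 ≤ l2 G / √N := div_nonneg (l2_nonneg _) hs.le
  unfold sob
  linarith

/-- A bound for the solution `κ v` of the Bishop equation with `g = 0`. -/
lemma sob_kapCirc_smul_le (v : Rn n) :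
    sob (fun j : ZMod N => kapCirc (node j) • v) ≤ 172 * ‖v‖ := by
  have hs := sqrt_pos_of_neZero (N := N)
  have hN0 : (0 : ℝ) < N := Nat.cast_pos.2 (NeZero.pos N)
  have hsq : √(N : ℝ) * √N = N := Real.mul_self_sqrt hN0.le
  have h1 : l2 (fun j : ZMod N => kapCirc (node j) • v) ≤ √N * (4 * ‖v‖) :=
    l2_le_of_le_const (by positivity) fun j => by
      obtain ⟨a, b⟩ := kapCirc_bounds (norm_node j)
      rw [norm_smul, Real.norm_of_nonneg (by linarith)]; gcongr
  have h2 : l2 (diff fun j : ZMod N => kapCirc (node j) • v) ≤ √N * (24 * (7 / N) * ‖v‖) :=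
    l2_le_of_le_const (by positivity) fun j => by
      simp only [diff, ← sub_smul]
      rw [norm_smul]; gcongr
      refine (abs_kapCirc_sub_le (norm_node _) (norm_node _)).trans ?_
      gcongr
      exact norm_node_succ_sub_le j
  have h3 : l2 (fun j : ZMod N => kapCirc (node j) • v) / √N ≤ 4 * ‖v‖ := by
    rw [div_le_iff₀ hs]; linarith
  have h4 : √N * l2 (diff fun j : ZMod N => kapCirc (node j) • v) ≤ 168 * ‖v‖ := by
    calc _ ≤ √N * (√N * (24 * (7 / N) * ‖v‖)) := by gcongr
      _ = (√N * √N) * (168 / N * ‖v‖) := by ring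
      _ = _ := by rw [hsq]; field_simp
  unfold sob; linarith

/-- Solvability of the discrete Bishop equation: the equation is a contraction in `ℓ²`. -/
lemma exists_bishop_solution {K : ℕ} (hN : N = 2 * K + 1) {g : Rn n → Cn n} {δ : ℝ} (hδ : 0 ≤ δ)
    (hδ1 : δ ≤ 1 / 10 ^ 9) (hg : ∀ x y, ‖g x - g y‖ ≤ δ * ‖x - y‖) (v : Rn n) :
    ∃ x : ZMod N → Rn n, x = (fun j => kapCirc (node j) • v) + corr K fun j => g (x j) := by
  let X := PiLp 2 (fun _ : ZMod N => Rn n)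
  let T : X → X := fun x => WithLp.toLp 2 ((fun j => kapCirc (node j) • v) + corr K fun j => g (x j))
  have hT : ContractingWith (1 / 2) T := by
    refine ⟨by rw [← NNReal.coe_lt_coe]; norm_num, LipschitzWith.of_dist_le_mul fun x y => ?_⟩
    rw [dist_eq_norm, dist_eq_norm]
    have e : T x - T y = WithLp.toLp 2 (corr K fun j => g (x j) - g (y j)) := by
      change WithLp.toLp 2 _ - WithLp.toLp 2 _ = _
      rw [corr_sub, ← WithLp.toLp_sub, add_sub_add_left_eq_sub]
    rw [e]
    have h1 := l2_corr_le hN (fun j => g (x j) - g (y j))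
    have h2 : l2 (fun j => g (x j) - g (y j)) ≤ δ * l2 (fun j => x j - y j) :=
      l2_le_of_le hδ fun j => hg _ _
    have h3 : l2 (fun j => x j - y j) = ‖x - y‖ := rfl
    have h4 : l2 (corr K fun j => g (x j) - g (y j))
      = ‖(WithLp.toLp 2 (corr K fun j => g (x j) - g (y j)) : X)‖ := rfl
    rw [← h4]
    rw [h3] at h2
    have := norm_nonneg (x - y)
    push_cast
    nlinarith
  refine ⟨(ContractingWith.fixedPoint T hT : X).ofLp, ?_⟩
  exact (congrArg WithLp.ofLp (hT.fixedPoint_isFixedPt)).symm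

set_option maxHeartbeats 1000000 in
/-- The family of analytic discs attached to the totally real manifold `{x + g x}`, which is a small
perturbation of `ℝⁿ`. The disc `φ v` depends on a vector `v ∈ ℝⁿ`; it has its centre at the
origin, is attached to the manifold at the nodes, at the points with coordinates `x v j`, and has a
pole at `1/2`. For every node the coordinate of the point of attachment depends on `v` in a
bi-Lipschitz way. -/
theorem exists_attached_discs {K : ℕ} (hN : N = 2 * K + 1) {g : Rn n → Cn n} {δ : ℝ} (hδ : 0 ≤ δ)
    (hδ1 : δ ≤ 1 / 10 ^ 9) (g0 : g 0 = 0) (hg : ∀ x y, ‖g x - g y‖ ≤ δ * ‖x - y‖)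
    (hg2 : ∀ x y x' y', ‖x‖ ≤ 1000 → ‖y‖ ≤ 1000 → ‖x'‖ ≤ 1000 → ‖y'‖ ≤ 1000 →
      ‖(g y - g x) - (g y' - g x')‖ ≤
        δ * (‖(y - x) - (y' - x')‖ + (‖x - x'‖ + ‖y - y'‖) * ‖y' - x'‖)) :
    ∃ (x : Rn n → ZMod N → Rn n) (φ : Rn n → ℂ → Cn n),
      (∀ v, ‖v‖ ≤ 1 → ∀ j, ‖x v j‖ ≤ 1000) ∧
      (∀ v v', ‖v‖ ≤ 1 → ‖v'‖ ≤ 1 → ∀ j, ‖v - v'‖ ≤ 3 * ‖x v j - x v' j‖) ∧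
      (∀ v v', ‖v‖ ≤ 1 → ‖v'‖ ≤ 1 → ∀ j, ‖x v j - x v' j‖ ≤ 1000 * ‖v - v'‖) ∧
      (∀ v, φ v 0 = 0) ∧
      (∀ v j, φ v (node j) = ofE (x v j) + g (x v j)) ∧
      (∀ v ζ, ζ ≠ 1 / 2 → ζ ≠ 2 → DifferentiableAt ℂ (φ v) ζ) ∧
      (∀ v, ‖v‖ ≤ 1 → ∀ ζ : ℂ, ‖ζ‖ ≤ 1 → 1 / 3 ≤ ‖ζ - 1 / 2‖ → ‖φ v ζ‖ ≤ 1000) ∧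
      (∀ v, ‖v‖ ≤ 1 → ∀ (j : ZMod N) (α : ℝ), 0 ≤ α → α ≤ 2 * Real.pi / N →
        ‖φ v (Complex.exp (α * Complex.I) * node j) - φ v (node j)‖ ≤ 1000 / √N) := by
  have hs := sqrt_pos_of_neZero (N := N)
  choose x hx using exists_bishop_solution (N := N) hN hδ hδ1 hg
  let y : Rn n → ZMod N → Rn n := fun v j => imV (g (x v j))
  let η : Rn n → Rn n := fun v => (N : ℝ)⁻¹ • ∑ l, y v l
  let φ : Rn n → ℂ → Cn n := fun v ζ => kap ζ • ofE v + kapI ζ • ofE (η v) + conjPolyV K (y v) ζ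
  have hsob : ∀ v, sob (x v) ≤ 344 * ‖v‖ := by
    intro v
    have h1 := sob_comp_le hδ g0 hg (x v)
    have h2 := sob_corr_le hN fun j => g (x v j)
    have h3 := sob_add_le (fun j => kapCirc (node j) • v) (corr K fun j => g (x v j))
    rw [← hx v] at h3
    have h4 := sob_kapCirc_smul_le (N := N) v
    nlinarith [sob_nonneg (x v)]
  have hxb : ∀ v, ‖v‖ ≤ 1 → ∀ j, ‖x v j‖ ≤ 1000 := by
    intro v hv j
    have := norm_le_sob (x v) j
    linarith [hsob v]
  -- The solutions `x v` differ from `κ v` by a map with small Lipschitz constant in `v`. The supremum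
  -- over the nodes is controlled by the Sobolev norm, which needs the second differences of `g`.
  have hd : ∀ v v', ‖v‖ ≤ 1 → ‖v'‖ ≤ 1 →
      sob (corr K fun j => g (x v j) - g (x v' j)) ≤ 1 / 9 * ‖v - v'‖ := by
    intro v v' hv hv'
    set D := corr K fun j => g (x v j) - g (x v' j) with hD
    have h1 := sob_comp_sub_le hδ hg hg2 (hxb v hv) (hxb v' hv')
    have h2 := sob_corr_le hN fun j => g (x v j) - g (x v' j)
    have e : x v - x v' = (fun j : ZMod N => kapCirc (node j) • (v - v')) + D := by
      have e1 : (fun j : ZMod N => kapCirc (node j) • (v - v'))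
          = (fun j => kapCirc (node j) • v) - fun j => kapCirc (node j) • v' := by
        funext j; simp [smul_sub]
      rw [e1, hD, corr_sub]
      nth_rewrite 1 [hx v]
      nth_rewrite 1 [hx v']
      abel
    have h3 := sob_add_le (fun j : ZMod N => kapCirc (node j) • (v - v')) D
    rw [← e] at h3
    have h4 := sob_kapCirc_smul_le (N := N) (v - v')
    have h5 : δ * (1 + 2 * sob (x v')) ≤ 1 / 10 ^ 6 := by
      have := hsob v'
      have := sob_nonneg (x v')
      nlinarith
    have h6 : δ * (1 + 2 * sob (x v')) * sob (x v - x v') ≤ 1 / 10 ^ 6 * sob (x v - x v') :=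
      mul_le_mul_of_nonneg_right h5 (sob_nonneg _)
    rw [← hD] at h2
    linarith [sob_nonneg D, norm_nonneg (v - v')]
  have hcorr : ∀ v j, corr K (fun j => g (x v j)) j = x v j - kapCirc (node j) • v := by
    intro v j
    have e1 := congrFun (hx v) j
    simp only [Pi.add_apply] at e1
    exact eq_sub_of_add_eq' e1.symm
  have hdiff : ∀ v v', ‖v‖ ≤ 1 → ‖v'‖ ≤ 1 → ∀ j,
      ‖(x v j - x v' j) - kapCirc (node j) • (v - v')‖ ≤ 1 / 9 * ‖v - v'‖ := by
    intro v v' hv hv' j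
    have h1 := (norm_le_sob _ j).trans (hd v v' hv hv')
    rw [corr_sub] at h1
    have e : (corr K (fun j => g (x v j)) - corr K fun j => g (x v' j)) j
        = (x v j - x v' j) - kapCirc (node j) • (v - v') := by
      rw [Pi.sub_apply, hcorr, hcorr, smul_sub]
      abel
    rwa [e] at h1
  have hsoby : ∀ v, ‖v‖ ≤ 1 → sob (y v) ≤ 1 / 10 ^ 6 := by
    intro v hv
    have h1 : sob (y v) ≤ δ * sob (x v) := sob_comp_le (g := fun z => imV (g z)) hδ
      (by ext i; simp [g0]) (fun a b => by
        rw [← imV_sub]; exact (norm_imV_le _).trans (hg a b)) (x v)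
    have := hsob v
    nlinarith [sob_nonneg (x v)]
  have hη : ∀ v, ‖v‖ ≤ 1 → ‖η v‖ ≤ 1 / 10 ^ 6 := by
    intro v hv
    have h1 := norm_mean_le_l2 (y v)
    have h2 : l2 (y v) / √N ≤ sob (y v) := by
      have := mul_nonneg hs.le (l2_nonneg (diff (y v)))
      unfold sob; linarith
    exact h1.trans (h2.trans (hsoby v hv))
  refine ⟨x, φ, hxb, ?_, ?_, ?_, ?_, ?_, ?_, ?_⟩
  · intro v v' hv hv' j
    have h1 := hdiff v v' hv hv' j
    obtain ⟨h2, _⟩ := kapCirc_bounds (norm_node j)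
    have h3 := norm_le_norm_add_norm_sub' (kapCirc (node j) • (v - v')) (x v j - x v' j)
    rw [norm_smul, Real.norm_of_nonneg (by linarith),
      norm_sub_rev (kapCirc (node j) • (v - v'))] at h3
    nlinarith [norm_nonneg (v - v')]
  · intro v v' hv hv' j
    have h1 := hdiff v v' hv hv' j
    obtain ⟨h2, h2'⟩ := kapCirc_bounds (norm_node j)
    have h3 := norm_le_norm_add_norm_sub' (x v j - x v' j) (kapCirc (node j) • (v - v'))
    rw [norm_smul, Real.norm_of_nonneg (by linarith)] at h3
    nlinarith [norm_nonneg (v - v')]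
  · intro v
    simp only [φ, kap_zero, kapI_zero, conjPolyV_zero, η]
    simp
  · intro v j
    have him := conjPolyV_im hN (y v) j
    have hre : ((node j).im * kapCirc (node j)) • η v + reV (conjPolyV K (y v) (node j))
        - reV (g (x v j)) = x v j - kapCirc (node j) • v := hcorr v j
    have hφ : φ v (node j) = (kapCirc (node j) : ℂ) • ofE v
        + (((node j).im * kapCirc (node j) : ℝ) : ℂ) • ofE (η v) + conjPolyV K (y v) (node j) := by
      rw [← kap_of_norm (norm_node j), ← kapI_of_norm (norm_node j)]
    rw [hφ]
    generalize conjPolyV K (y v) (node j) = p at him hre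
    generalize (node j).im * kapCirc (node j) = s at hre
    generalize kapCirc (node j) = r at hre
    ext i
    have him' : (p i).im = (g (x v j) i).im := congrArg (fun z : Rn n => z i) him
    have hre' := congrArg (fun z : Rn n => z i) hre
    simp only [PiLp.add_apply, PiLp.sub_apply, PiLp.smul_apply, reV_apply, smul_eq_mul] at hre'
    simp only [PiLp.add_apply, PiLp.smul_apply, ofE_apply, smul_eq_mul]
    apply Complex.ext
    · simp only [Complex.add_re, ← Complex.ofReal_mul, Complex.ofReal_re]
      linarith
    · simp only [Complex.add_im, ← Complex.ofReal_mul, Complex.ofReal_im]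
      linarith
  · intro v ζ h1 h2
    obtain ⟨a, b⟩ := differentiableAt_kap h1 h2
    have c := differentiable_conjPolyV K (y v) ζ
    exact ((a.smul_const _).add (b.smul_const _)).add c
  · intro v hv ζ h1 h2
    obtain ⟨a, b⟩ := norm_kap_le h1 h2
    have c := norm_conjPolyV_le hN (y v) h1
    have d := hη v hv
    have e := hsoby v hv
    have f := norm_add₃_le (a := kap ζ • ofE v) (b := kapI ζ • ofE (η v)) (c := conjPolyV K (y v) ζ)
    rw [norm_smul, norm_smul, norm_ofE, norm_ofE] at f
    change ‖kap ζ • ofE v + kapI ζ • ofE (η v) + conjPolyV K (y v) ζ‖ ≤ _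
    have : ‖kap ζ‖ * ‖v‖ ≤ 6 * 1 := by gcongr
    have : ‖kapI ζ‖ * ‖η v‖ ≤ 6 * (1 / 10 ^ 6) := by gcongr
    linarith
  · intro v hv j α h0 h1
    have hz : ‖Complex.exp (α * Complex.I) * node j‖ = 1 := by
      rw [norm_mul, norm_node, Complex.norm_exp_ofReal_mul_I, one_mul]
    set ζ := Complex.exp (α * Complex.I) * node j with hζ
    have hj := norm_node j
    have hclose := norm_exp_mul_node_sub_le j h0 h1
    rw [← hζ] at hclose
    have hN1 : (7 : ℝ) / N ≤ 7 / √N := by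
      have : √(N : ℝ) * √N = N := Real.mul_self_sqrt (Nat.cast_nonneg N)
      have : √(N : ℝ) ≤ N := by nlinarith [one_le_sqrt (N := N)]
      gcongr
    have a : ‖kap ζ - kap (node j)‖ ≤ 24 * ‖ζ - node j‖ := by
      rw [kap_of_norm hz, kap_of_norm hj, ← Complex.ofReal_sub, Complex.norm_real]
      exact abs_kapCirc_sub_le hz hj
    have b : ‖kapI ζ - kapI (node j)‖ ≤ 28 * ‖ζ - node j‖ := by
      rw [kapI_of_norm hz, kapI_of_norm hj, ← Complex.ofReal_sub, Complex.norm_real]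
      exact abs_im_mul_kapCirc_sub_le hz hj
    have c := norm_conjPolyV_rotate_le hN (y v) j h0 h1
    rw [← hζ] at c
    have d := l2_diff_le_sob (y v)
    have d' : sob (y v) / √N ≤ 1 / √N := by
      gcongr; exact (hsoby v hv).trans (by norm_num)
    have e : φ v ζ - φ v (node j) = (kap ζ - kap (node j)) • ofE v
        + (kapI ζ - kapI (node j)) • ofE (η v)
        + (conjPolyV K (y v) ζ - conjPolyV K (y v) (node j)) := by
      simp only [φ, sub_smul]; abel
    have f := norm_add₃_le (a := (kap ζ - kap (node j)) • ofE v)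
      (b := (kapI ζ - kapI (node j)) • ofE (η v))
      (c := conjPolyV K (y v) ζ - conjPolyV K (y v) (node j))
    rw [e]
    refine f.trans ?_
    rw [norm_smul, norm_smul, norm_ofE, norm_ofE]
    have h7 : ‖ζ - node j‖ ≤ 7 * (1 / √N) := by rw [mul_one_div]; linarith
    have i1 : ‖kap ζ - kap (node j)‖ * ‖v‖ ≤ (24 * (7 * (1 / √N))) * 1 := by
      gcongr; linarith
    have i2 : ‖kapI ζ - kapI (node j)‖ * ‖η v‖ ≤ (28 * (7 * (1 / √N))) * 1 := by
      gcongr; · linarith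
      · exact (hη v hv).trans (by norm_num)
    have i3 : 0 ≤ 1 / √(N : ℝ) := by positivity
    rw [show (1000 : ℝ) / √N = 1000 * (1 / √N) by ring]
    linarith

end Bishop

end Plurithin

namespace Plurithin

open Real Metric Filter Topology

/-! ### Sub-mean value inequalities -/

section Jensen

lemma circleAverage_norm_sub_sq (a ζ : ℂ) (h : ℝ) :
    circleAverage (fun z => ‖z - a‖ ^ 2) ζ h = ‖ζ - a‖ ^ 2 + h ^ 2 := by
  set q : ℂ → ℂ := fun z => 2 * starRingEnd ℂ (ζ - a) * (z - ζ) with hq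
  have hqd : Differentiable ℂ q := by unfold q; fun_prop
  have h1 : circleAverage q ζ h = 0 := by
    rw [hqd.diffContOnCl.circleAverage]; simp [hq]
  have h2 : circleAverage (Complex.reCLM ∘ q) ζ h = 0 := by
    rw [Complex.reCLM.circleAverage_comp_comm hqd.continuous.continuousOn.circleIntegrable', h1]
    simp
  have h3 : circleAverage (fun z => ‖z - a‖ ^ 2) ζ h
      = circleAverage (fun z => (‖ζ - a‖ ^ 2 + h ^ 2) + (Complex.reCLM ∘ q) z) ζ h := by
    apply circleAverage_congr_sphere
    intro z hz
    rw [mem_sphere, dist_eq_norm] at hz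
    have e1 : ‖z - a‖ ^ 2 = ‖(ζ - a) + (z - ζ)‖ ^ 2 := by congr 2; ring
    have e2 : h ^ 2 = ‖z - ζ‖ ^ 2 := by rw [hz, sq_abs]
    simp only [Function.comp, hq, e1, e2, Complex.reCLM_apply]
    simp only [← Complex.normSq_eq_norm_sq, Complex.normSq_apply]
    simp
    ring
  rw [h3, circleAverage_fun_add (circleIntegrable_const _ _ _)
    ((Complex.reCLM.continuous.comp hqd.continuous).continuousOn.circleIntegrable'), h2,
    circleAverage_const]
  simp

lemma circleAverage_zero_norm (W : ℂ → ℝ) (z : ℂ) :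
    circleAverage W 0 ‖z‖ = (2 * π)⁻¹ * ∫ α in 0..2 * π, W (circleMap 0 1 α * z) := by
  rw [circleAverage_eq_integral_add (Complex.arg z), smul_eq_mul]
  congr 2
  funext α
  congr 1
  simp only [circleMap, zero_add, Complex.ofReal_one, one_mul, Complex.ofReal_add, add_mul,
    Complex.exp_add]
  conv_rhs => rw [← Complex.norm_mul_exp_arg_mul_I z]
  ring

lemma circleAverage_rotate (W : ℂ → ℝ) (ζ : ℂ) (h α : ℝ) :
    circleAverage W (circleMap 0 1 α * ζ) h
      = (2 * π)⁻¹ * ∫ τ in 0..2 * π, W (circleMap 0 1 α * circleMap ζ h τ) := by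
  rw [circleAverage_eq_integral_add α, smul_eq_mul]
  congr 2
  funext τ
  congr 1
  simp only [circleMap, zero_add, Complex.ofReal_one, one_mul, Complex.ofReal_add, add_mul,
    Complex.exp_add]
  ring

/-- A continuous function which satisfies the sub-mean value inequality on small circles up to an
error `O(h³)` satisfies it exactly on the unit circle. The function is averaged over rotations,
after which it is constant on circles, and the maximum principle applies. -/
theorem le_circleAverage_of_asymptotic {W : ℂ → ℝ} (hW : Continuous W)
    (hsub : ∀ r < 1, ∃ C h₀ : ℝ, 0 < h₀ ∧ ∀ ζ : ℂ, ‖ζ‖ ≤ r → ∀ h, 0 < h → h < h₀ →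
      W ζ ≤ circleAverage W ζ h + C * h ^ 3) : W 0 ≤ circleAverage W 0 1 := by
  have hA : Continuous fun z : ℂ => circleAverage W 0 ‖z‖ := hW.circleAverage.comp continuous_norm
  have h2π : 0 < (2 * π)⁻¹ := by positivity
  have key : ∀ r, 0 < r → r < 1 → W 0 ≤ circleAverage W 0 r := by
    intro r hr0 hr1
    obtain ⟨C, h₀, hh₀, hC⟩ := hsub r hr1
    -- the rotational average inherits the asymptotic inequality
    have hAsub : ∀ ζ : ℂ, ‖ζ‖ ≤ r → ∀ h, 0 < h → h < h₀ →
        circleAverage W 0 ‖ζ‖ ≤ circleAverage (fun z => circleAverage W 0 ‖z‖) ζ h + C * h ^ 3 := by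
      intro ζ hζ h h0 h1
      have e1 : circleAverage (fun z => circleAverage W 0 ‖z‖) ζ h
          = (2 * π)⁻¹ * ∫ α in 0..2 * π, circleAverage W (circleMap 0 1 α * ζ) h := by
        rw [circleAverage_def]
        simp_rw [circleAverage_zero_norm W, circleAverage_rotate, smul_eq_mul,
          intervalIntegral.integral_const_mul]
        congr 2
        apply MeasureTheory.intervalIntegral_intervalIntegral_swap
        refine (Continuous.continuousOn ?_).integrableOn_compact
          (isCompact_uIcc.prod isCompact_uIcc) |>.mono_set
            (Set.prod_mono Set.uIoc_subset_uIcc Set.uIoc_subset_uIcc)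
        fun_prop
      have e2 : circleAverage W 0 ‖ζ‖ - C * h ^ 3
          = (2 * π)⁻¹ * ∫ α in 0..2 * π, (W (circleMap 0 1 α * ζ) - C * h ^ 3) := by
        rw [circleAverage_zero_norm, intervalIntegral.integral_sub]
        · rw [mul_sub]
          congr 1
          rw [intervalIntegral.integral_const, smul_eq_mul, sub_zero, ← mul_assoc,
            inv_mul_cancel₀ (by positivity), one_mul]
        · exact Continuous.intervalIntegrable (by fun_prop) _ _
        · exact continuous_const.intervalIntegrable _ _
      rw [← sub_le_iff_le_add, e1, e2]
      gcongr
      refine intervalIntegral.integral_mono_on (by positivity) ?_ ?_ ?_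
      · exact Continuous.intervalIntegrable (by fun_prop) _ _
      · refine Continuous.intervalIntegrable ?_ _ _
        simp_rw [circleAverage_rotate]
        refine continuous_const.mul ?_
        exact intervalIntegral.continuous_parametric_intervalIntegral_of_continuous' (by fun_prop) _ _
      · intro α _
        have := hC (circleMap 0 1 α * ζ) (by simpa using hζ) h h0 h1
        linarith
    have key2 : ∀ η, 0 < η → W 0 ≤ circleAverage W 0 r + η * r ^ 2 := by
      intro η hη
      set B : ℂ → ℝ := fun z => circleAverage W 0 ‖z‖ + η * ‖z - 0‖ ^ 2 with hB
      have hBc : Continuous B := by unfold B; fun_prop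
      obtain ⟨ζ, hζ, hmax⟩ := (isCompact_closedBall (0 : ℂ) r).exists_isMaxOn
        ⟨0, by simpa using hr0.le⟩ hBc.continuousOn
      have hζr : ‖ζ‖ ≤ r := by simpa using hζ
      have h00 : W 0 ≤ B ζ := by
        have : B 0 ≤ B ζ := hmax (by simpa using hr0.le)
        simpa [hB, circleAverage_zero] using this
      rcases hζr.lt_or_eq with hlt | heq
      · exfalso
        obtain ⟨h, hpos, hlt0, hltr, hC3⟩ : ∃ h, 0 < h ∧ h < h₀ ∧ h < r - ‖ζ‖ ∧ C * h < η := by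
          refine ⟨min (min (h₀ / 2) ((r - ‖ζ‖) / 2)) (η / (2 * (|C| + 1))), ?_, ?_, ?_, ?_⟩
          · have : 0 < r - ‖ζ‖ := by linarith
            positivity
          · exact lt_of_le_of_lt ((min_le_left _ _).trans (min_le_left _ _)) (by linarith)
          · exact lt_of_le_of_lt ((min_le_left _ _).trans (min_le_right _ _)) (by linarith)
          · have hp : 0 ≤ min (min (h₀ / 2) ((r - ‖ζ‖) / 2)) (η / (2 * (|C| + 1))) := by
              have : 0 < r - ‖ζ‖ := by linarith
              positivity
            calc _ ≤ (|C| + 1) * (η / (2 * (|C| + 1))) := by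
                  apply mul_le_mul _ (min_le_right _ _) hp (by positivity)
                  linarith [le_abs_self C]
              _ = η / 2 := by field_simp
              _ < η := by linarith
        have h1 := hAsub ζ hζr h hpos hlt0
        have h2 : circleAverage B ζ h = circleAverage (fun z => circleAverage W 0 ‖z‖) ζ h
            + η * (‖ζ - 0‖ ^ 2 + h ^ 2) := by
          rw [hB, circleAverage_fun_add hA.continuousOn.circleIntegrable'
            (by apply ContinuousOn.circleIntegrable'; fun_prop),
            ← circleAverage_norm_sub_sq 0 ζ h]
          congr 1
          exact circleAverage_fun_smul (a := η) (f := fun z : ℂ => ‖z - 0‖ ^ 2)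
        have h3 : circleAverage B ζ h ≤ B ζ := by
          refine circleAverage_mono_on_of_le_circle hBc.continuousOn.circleIntegrable' ?_
          intro z hz
          apply hmax
          rw [mem_sphere, dist_eq_norm, abs_of_pos hpos] at hz
          rw [mem_closedBall, dist_zero_right]
          have := norm_le_norm_add_norm_sub' z ζ
          linarith
        have h4 : B ζ = circleAverage W 0 ‖ζ‖ + η * ‖ζ - 0‖ ^ 2 := rfl
        have h5 : 0 < h ^ 2 := by positivity
        nlinarith
      · rw [hB] at h00; simp only [heq, sub_zero] at h00; exact h00
    refine le_of_forall_pos_le_add fun ε hε => ?_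
    have := key2 (ε / r ^ 2) (by positivity)
    rwa [div_mul_cancel₀ _ (by positivity)] at this
  have hlim : Tendsto (fun r => circleAverage W 0 r) (𝓝[<] 1) (𝓝 (circleAverage W 0 1)) :=
    (hW.circleAverage.tendsto 1).mono_left nhdsWithin_le_nhds
  refine ge_of_tendsto hlim ?_
  filter_upwards [Ioo_mem_nhdsLT (zero_lt_one (α := ℝ))] with r hr
  exact key r hr.1 hr.2

end Jensen

section Composition

variable {n : ℕ}

/-- Composition of a `C^{1,1}` function that has the sub-mean value property on a complex line with
a holomorphic disc tangent to the line: up to the order `h²`, the deviation of the disc from its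
tangent line contributes the circle average of a holomorphic function that vanishes at the
centre. -/
lemma comp_holomorphic_le_circleAverage {U : Cn n → ℝ} {L : ℝ} (hU : ContDiff ℝ 1 U)
    (hL : ∀ x y, ‖fderiv ℝ U x - fderiv ℝ U y‖ ≤ L * ‖x - y‖) (hL0 : 0 ≤ L)
    {φ : ℂ → Cn n} {ζ : ℂ} {w : Cn n} {h C : ℝ} (hh : 0 < h)
    (hφ : ∀ z ∈ closedBall ζ h, DifferentiableAt ℂ φ z)
    (hT : ∀ z ∈ closedBall ζ h, ‖φ z - (φ ζ + (z - ζ) • w)‖ ≤ C * h ^ 2)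
    (hsub : U (φ ζ) ≤ circleAverage (fun z => U (φ ζ + (z - ζ) • w)) ζ h) :
    U (φ ζ) ≤ circleAverage (fun z => U (φ z)) ζ h + L * (h * ‖w‖ + C * h ^ 2) * (C * h ^ 2) := by
  have hCh : 0 ≤ C * h ^ 2 := le_trans (norm_nonneg _) (hT ζ (mem_closedBall_self hh.le))
  set p : ℂ → Cn n := fun z => φ ζ + (z - ζ) • w with hp
  set q : ℂ → Cn n := fun z => φ z - p z with hq
  have hpd : Differentiable ℂ p := by unfold p; fun_prop
  have hφc : ContinuousOn φ (closedBall ζ h) := fun z hz =>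
    (hφ z hz).continuousAt.continuousWithinAt
  have hqd : DiffContOnCl ℂ q (ball ζ |h|) := by
    rw [abs_of_pos hh]
    refine ⟨fun z hz => ?_, ?_⟩
    · exact ((hφ z (ball_subset_closedBall hz)).sub (hpd z)).differentiableWithinAt
    · rw [closure_ball _ hh.ne']; exact hφc.sub hpd.continuous.continuousOn
  have hqc : ContinuousOn q (sphere ζ |h|) := by
    rw [abs_of_pos hh]
    exact (hφc.sub hpd.continuous.continuousOn).mono sphere_subset_closedBall
  have hφc' : ContinuousOn (fun z => U (φ z)) (sphere ζ |h|) := by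
    rw [abs_of_pos hh]
    exact hU.continuous.comp_continuousOn (hφc.mono sphere_subset_closedBall)
  have hUp : Continuous fun z => U (p z) := hU.continuous.comp hpd.continuous
  have h1 : circleAverage (fderiv ℝ U (φ ζ) ∘ q) ζ h = 0 := by
    rw [(fderiv ℝ U (φ ζ)).circleAverage_comp_comm hqc.circleIntegrable', hqd.circleAverage]
    simp [hq, hp]
  set ε := L * (h * ‖w‖ + C * h ^ 2) * (C * h ^ 2) with hε
  have h2 : ∀ z ∈ sphere ζ |h|, U (p z) + (fderiv ℝ U (φ ζ) ∘ q) z ≤ U (φ z) + ε := by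
    intro z hz
    rw [abs_of_pos hh] at hz
    have hz' : ‖z - ζ‖ = h := by rwa [mem_sphere, dist_eq_norm] at hz
    have hqz : ‖φ z - p z‖ ≤ C * h ^ 2 := hT z (sphere_subset_closedBall hz)
    have h3 : ‖U (φ z) - U (p z) - fderiv ℝ U (φ ζ) (φ z - p z)‖
        ≤ (L * (h * ‖w‖ + C * h ^ 2)) * ‖φ z - p z‖ := by
      refine (convex_segment (p z) (φ z)).norm_image_sub_le_of_norm_fderiv_le' (𝕜 := ℝ)
        (fun x _ => (hU.differentiable one_ne_zero) x) (fun x hx => ?_) (left_mem_segment ℝ _ _)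
        (right_mem_segment ℝ _ _)
      refine (hL _ _).trans ?_
      gcongr
      have e1 : ‖x - p z‖ ≤ ‖φ z - p z‖ := norm_sub_le_of_mem_segment hx
      have e2 : ‖p z - φ ζ‖ = h * ‖w‖ := by
        rw [hp]; simp only [add_sub_cancel_left, norm_smul, hz']
      calc ‖x - φ ζ‖ = ‖(p z - φ ζ) + (x - p z)‖ := by congr 1; abel
        _ ≤ ‖p z - φ ζ‖ + ‖x - p z‖ := norm_add_le _ _
        _ ≤ h * ‖w‖ + C * h ^ 2 := by linarith
    have h4 : (L * (h * ‖w‖ + C * h ^ 2)) * ‖φ z - p z‖ ≤ ε := by rw [hε]; gcongr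
    have h5 := (abs_le.1 ((Real.norm_eq_abs _).symm.le.trans (h3.trans h4))).1
    simp only [Function.comp, hq]
    linarith
  have hi1 : CircleIntegrable (fderiv ℝ U (φ ζ) ∘ q) ζ h :=
    ((fderiv ℝ U (φ ζ)).continuous.comp_continuousOn hqc).circleIntegrable'
  have h3 := circleAverage_mono (hUp.continuousOn.circleIntegrable'.fun_add hi1)
    (hφc'.circleIntegrable'.fun_add (circleIntegrable_const ε _ _)) h2
  rw [circleAverage_fun_add hUp.continuousOn.circleIntegrable' hi1,
    circleAverage_fun_add hφc'.circleIntegrable' (circleIntegrable_const ε _ _), h1,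
    circleAverage_const] at h3
  linarith

end Composition

end Plurithin

namespace Plurithin

open Real Metric Filter Topology

/-! ### Subharmonic functions from discs with a pole -/

section DiscFunction

variable {n : ℕ}

/-- The subharmonic function on the unit disc obtained from a function `U ≤ 0` on `ℂⁿ` and a disc
`φ` with a pole at `1/2`. The quadratic term is nonpositive on the unit disc; it is so negative near
`1/2` that the function vanishes near the pole, but it exceeds `-1` at the centre. -/
noncomputable def discFun (U : Cn n → ℝ) (φ : ℂ → Cn n) (ζ : ℂ) : ℝ :=
  max (1 + U (φ ζ) + 12 / 25 * (‖ζ - 1 / 2‖ ^ 2 - 9 / 4)) 0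

lemma discFun_eq_zero {U : Cn n → ℝ} (hneg : ∀ z, U z ≤ 0) (φ : ℂ → Cn n) {ζ : ℂ}
    (hζ : ‖ζ - 1 / 2‖ ≤ 2 / 5) : discFun U φ ζ = 0 := by
  have := hneg (φ ζ)
  have h2 : ‖ζ - 1 / 2‖ ^ 2 ≤ (2 / 5) ^ 2 := by gcongr
  exact max_eq_right (by linarith)

/-- The sub-mean value inequality at the centre for `discFun`. -/
theorem discFun_zero_le_circleAverage {U : Cn n → ℝ} {L ρ : ℝ} (hU : ContDiff ℝ 1 U)
    (hL : ∀ x y, ‖fderiv ℝ U x - fderiv ℝ U y‖ ≤ L * ‖x - y‖) (hL0 : 0 ≤ L)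
    (hneg : ∀ z, U z ≤ 0) (hρ : 0 < ρ)
    (hsub : ∀ z w : Cn n, (∀ ζ : ℂ, ‖ζ‖ ≤ 1 → ‖z + ζ • w‖ < ρ) →
      U z ≤ circleAverage (fun ζ : ℂ => U (z + ζ • w)) 0 1)
    {φ : ℂ → Cn n} (hφ : ∀ ζ, ζ ≠ 1 / 2 → ζ ≠ 2 → DifferentiableAt ℂ φ ζ)
    (hφb : ∀ ζ : ℂ, ‖ζ‖ ≤ 1 → 1 / 3 ≤ ‖ζ - 1 / 2‖ → ‖φ ζ‖ ≤ ρ / 2) :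
    discFun U φ 0 ≤ circleAverage (discFun U φ) 0 1 := by
  set W := discFun U φ with hW
  -- bounds for the derivatives of the disc away from the pole
  set O : Set ℂ := {ζ | ζ ≠ 1 / 2 ∧ ζ ≠ 2} with hO
  have hOo : IsOpen O := isOpen_ne.inter isOpen_ne
  have hφO : DifferentiableOn ℂ φ O := fun ζ hζ => (hφ ζ hζ.1 hζ.2).differentiableWithinAt
  have hφO1 := hφO.deriv hOo
  have hφO2 := hφO1.deriv hOo
  set K : Set ℂ := closedBall 0 1 ∩ {ζ | 1 / 3 ≤ ‖ζ - 1 / 2‖} with hK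
  have hKc : IsCompact K := (isCompact_closedBall _ _).inter_right
    (isClosed_le continuous_const (by fun_prop))
  have hKO : K ⊆ O := by
    rintro ζ ⟨h1, h2⟩
    constructor
    · rintro rfl; norm_num at h2
    · rintro rfl; rw [mem_closedBall_zero_iff] at h1; norm_num at h1
  obtain ⟨M1, hM1⟩ := hKc.exists_bound_of_continuousOn (hφO1.continuousOn.mono hKO)
  obtain ⟨M2', hM2'⟩ := hKc.exists_bound_of_continuousOn (hφO2.continuousOn.mono hKO)
  set M2 := |M2'| with hM2
  have h0K : (0 : ℂ) ∈ K := ⟨by simp, by norm_num⟩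
  have hM10 : 0 ≤ M1 := (norm_nonneg _).trans (hM1 0 h0K)
  have hM20 : 0 ≤ M2 := abs_nonneg _
  -- continuity
  have hWc : ContinuousOn W (closedBall 0 1) := by
    intro ζ hζ
    apply ContinuousAt.continuousWithinAt
    by_cases h : ζ = 1 / 2
    · have : W =ᶠ[𝓝 ζ] fun _ => 0 := by
        filter_upwards [ball_mem_nhds ζ (by norm_num : (0 : ℝ) < 2 / 5)] with z hz
        rw [h, mem_ball, dist_eq_norm] at hz
        exact discFun_eq_zero hneg φ hz.le
      exact (continuousAt_congr this).2 continuousAt_const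
    · have h2 : ζ ≠ 2 := by
        rintro rfl; rw [mem_closedBall_zero_iff] at hζ; norm_num at hζ
      have h3 : ContinuousAt (fun z => U (φ z)) ζ :=
        hU.continuous.continuousAt.comp (hφ ζ h h2).continuousAt
      have h4 : ContinuousAt (fun z : ℂ => 12 / 25 * (‖z - 1 / 2‖ ^ 2 - 9 / 4)) ζ := by fun_prop
      exact ((continuousAt_const.add h3).add h4).max continuousAt_const
  -- `P` is the radial retraction onto the closed disc; it extends `W` to a continuous function on `ℂ`
  set P : ℂ → ℂ := fun ζ => ((max 1 ‖ζ‖)⁻¹ : ℝ) • ζ with hP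
  have hPc : Continuous P := by
    unfold P
    refine Continuous.smul (Continuous.inv₀ (continuous_const.max continuous_norm) fun ζ => ?_)
      continuous_id
    exact (lt_of_lt_of_le one_pos (le_max_left _ _)).ne'
  have hPm : ∀ ζ, P ζ ∈ closedBall (0 : ℂ) 1 := by
    intro ζ
    have hp : 0 < max 1 ‖ζ‖ := lt_of_lt_of_le one_pos (le_max_left _ _)
    rw [mem_closedBall_zero_iff, hP, norm_smul, norm_inv, Real.norm_of_nonneg hp.le,
      inv_mul_le_one₀ hp]
    exact le_max_right _ _
  have hPe : ∀ ζ, ‖ζ‖ ≤ 1 → P ζ = ζ := by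
    intro ζ hζ; simp [hP, max_eq_left hζ]
  have hWP : Continuous fun ζ => W (P ζ) := hWc.comp_continuous hPc hPm
  have hav : ∀ (ζ : ℂ) h, 0 ≤ h → ‖ζ‖ + h ≤ 1 →
      circleAverage (fun z => W (P z)) ζ h = circleAverage W ζ h := by
    intro ζ h h0 h1
    apply circleAverage_congr_sphere
    intro z hz
    rw [mem_sphere, dist_eq_norm, abs_of_nonneg h0] at hz
    have := norm_le_norm_add_norm_sub' z ζ
    simp only
    rw [hPe z (by linarith)]
  have main := le_circleAverage_of_asymptotic hWP ?_
  · rw [hav 0 1 zero_le_one (by simp), hPe 0 (by simp)] at main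
    exact main
  intro r hr
  refine ⟨L * (M1 + M2) * M2, min (min (1 / 15) (1 - r)) (ρ / (2 * (M1 + 1))), ?_, ?_⟩
  · have : 0 < 1 - r := by linarith
    positivity
  intro ζ hζ h h0 hlt
  have hh1 : h < 1 / 15 := lt_of_lt_of_le hlt ((min_le_left _ _).trans (min_le_left _ _))
  have hh2 : h < 1 - r := lt_of_lt_of_le hlt ((min_le_left _ _).trans (min_le_right _ _))
  have hh3 : h < ρ / (2 * (M1 + 1)) := lt_of_lt_of_le hlt (min_le_right _ _)
  have hsph : ∀ z ∈ closedBall ζ h, ‖z‖ ≤ 1 := by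
    intro z hz
    rw [mem_closedBall, dist_eq_norm] at hz
    have := norm_le_norm_add_norm_sub' z ζ
    linarith
  rw [hav ζ h h0.le (by linarith), hPe ζ (by linarith)]
  have hWi : CircleIntegrable W ζ h := by
    refine ContinuousOn.circleIntegrable h0.le (hWc.mono fun z hz => ?_)
    rw [mem_closedBall_zero_iff]
    exact hsph z (sphere_subset_closedBall hz)
  have hWnn : 0 ≤ circleAverage W ζ h := circleAverage_nonneg_of_nonneg fun z _ => le_max_right _ _
  have hE : 0 ≤ L * (M1 + M2) * M2 * h ^ 3 := by positivity
  by_cases hnear : ‖ζ - 1 / 2‖ ≤ 2 / 5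
  · rw [hW, discFun_eq_zero hneg φ hnear, ← hW]; linarith
  push Not at hnear
  have hballK : closedBall ζ h ⊆ K := by
    intro z hz
    refine ⟨by simpa using hsph z hz, ?_⟩
    rw [mem_closedBall, dist_eq_norm] at hz
    have := norm_le_norm_add_norm_sub' (ζ - 1 / 2) (z - 1 / 2)
    rw [show ζ - 1 / 2 - (z - 1 / 2) = -(z - ζ) by ring, norm_neg] at this
    change 1 / 3 ≤ ‖z - 1 / 2‖
    linarith
  have hζK : ζ ∈ K := hballK (mem_closedBall_self h0.le)
  have hdiff : ∀ z ∈ closedBall ζ h, DifferentiableAt ℂ φ z := fun z hz =>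
    hφ z (hKO (hballK hz)).1 (hKO (hballK hz)).2
  have hdiff1 : ∀ z ∈ closedBall ζ h, DifferentiableAt ℂ (deriv φ) z := fun z hz =>
    hφO1.differentiableAt (hOo.mem_nhds (hKO (hballK hz)))
  set w := deriv φ ζ with hw
  have hw1 : ‖w‖ ≤ M1 := hM1 ζ hζK
  have hderiv : ∀ z ∈ closedBall ζ h, ‖deriv φ z - w‖ ≤ M2 * h := by
    intro z hz
    have := (convex_closedBall ζ h).norm_image_sub_le_of_norm_deriv_le (𝕜 := ℂ) hdiff1
      (fun x hx => (hM2' x (hballK hx)).trans (le_abs_self _)) (mem_closedBall_self h0.le) hz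
    refine this.trans ?_
    rw [mem_closedBall, dist_eq_norm] at hz
    gcongr
  have hT : ∀ z ∈ closedBall ζ h, ‖φ z - (φ ζ + (z - ζ) • w)‖ ≤ M2 * h ^ 2 := by
    intro z hz
    have h1 : ∀ x ∈ closedBall ζ h, HasDerivWithinAt (fun x => φ x - (x - ζ) • w) (deriv φ x - w)
        (closedBall ζ h) x := by
      intro x hx
      have e := ((hasDerivAt_id x).sub_const ζ).smul_const w
      rw [one_smul] at e
      exact ((hdiff x hx).hasDerivAt.sub e).hasDerivWithinAt
    have := (convex_closedBall ζ h).norm_image_sub_le_of_norm_hasDerivWithin_le h1 hderiv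
      (mem_closedBall_self h0.le) hz
    simp only [sub_self, zero_smul, sub_zero] at this
    rw [show φ z - (φ ζ + (z - ζ) • w) = φ z - (z - ζ) • w - φ ζ by abel]
    refine this.trans ?_
    rw [mem_closedBall, dist_eq_norm] at hz
    calc M2 * h * ‖z - ζ‖ ≤ M2 * h * h := by gcongr
      _ = _ := by ring
  have hs : U (φ ζ) ≤ circleAverage (fun z => U (φ ζ + (z - ζ) • w)) ζ h := by
    rw [circleAverage_eq_circleAverage_zero_one]
    have := hsub (φ ζ) ((h : ℂ) • w) fun η hη => by
      have e1 := hφb ζ (by linarith) hζK.2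
      have e2 := norm_add_le (φ ζ) (η • (h : ℂ) • w)
      rw [norm_smul, norm_smul, Complex.norm_real, Real.norm_of_nonneg h0.le] at e2
      have e3 : ‖η‖ * (h * ‖w‖) ≤ 1 * (h * (M1 + 1)) := by gcongr; linarith
      rw [lt_div_iff₀ (by positivity)] at hh3
      linarith
    convert this using 2
    funext z
    rw [add_sub_cancel_right, smul_smul, mul_comm]
  have hcomp := comp_holomorphic_le_circleAverage hU hL hL0 h0 hdiff hT hs
  have hφc : ContinuousOn φ (sphere ζ h) := fun z hz =>
    (hdiff z (sphere_subset_closedBall hz)).continuousAt.continuousWithinAt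
  have hi1 : CircleIntegrable (fun z => 1 + U (φ z)) ζ h :=
    ((continuousOn_const.add (hU.continuous.comp_continuousOn hφc))).circleIntegrable h0.le
  have hi2 : CircleIntegrable (fun z : ℂ => 12 / 25 * (‖z - 1 / 2‖ ^ 2 - 9 / 4)) ζ h :=
    ContinuousOn.circleIntegrable h0.le (by fun_prop)
  have hq : 12 / 25 * (‖ζ - 1 / 2‖ ^ 2 - 9 / 4) ≤
      circleAverage (fun z : ℂ => 12 / 25 * (‖z - 1 / 2‖ ^ 2 - 9 / 4)) ζ h := by
    have e1 : circleAverage (fun z : ℂ => 12 / 25 * (‖z - 1 / 2‖ ^ 2 - 9 / 4)) ζ h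
        = 12 / 25 * circleAverage (fun z : ℂ => ‖z - 1 / 2‖ ^ 2 - 9 / 4) ζ h :=
      circleAverage_fun_smul (a := (12 / 25 : ℝ)) (f := fun z : ℂ => ‖z - 1 / 2‖ ^ 2 - 9 / 4)
    have e2 : circleAverage (fun z : ℂ => ‖z - 1 / 2‖ ^ 2 - 9 / 4) ζ h
        = ‖ζ - 1 / 2‖ ^ 2 + h ^ 2 - 9 / 4 := by
      rw [circleAverage_fun_sub (ContinuousOn.circleIntegrable h0.le (by fun_prop))
        (circleIntegrable_const _ _ _), circleAverage_norm_sub_sq, circleAverage_const]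
    rw [e1, e2]
    nlinarith [sq_nonneg h]
  have hU' : 1 + U (φ ζ) ≤ circleAverage (fun z => 1 + U (φ z)) ζ h
      + L * (h * ‖w‖ + M2 * h ^ 2) * (M2 * h ^ 2) := by
    have hi0 : CircleIntegrable (fun z => U (φ z)) ζ h :=
      (hU.continuous.comp_continuousOn hφc).circleIntegrable h0.le
    rw [circleAverage_fun_add (circleIntegrable_const _ _ _) hi0, circleAverage_const]
    linarith
  have herr : L * (h * ‖w‖ + M2 * h ^ 2) * (M2 * h ^ 2) ≤ L * (M1 + M2) * M2 * h ^ 3 := by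
    have e1 : h * ‖w‖ + M2 * h ^ 2 ≤ h * (M1 + M2) := by
      have : h * ‖w‖ ≤ h * M1 := by gcongr
      have : M2 * h ^ 2 ≤ M2 * h := by gcongr; nlinarith
      linarith
    calc _ ≤ L * (h * (M1 + M2)) * (M2 * h ^ 2) := by gcongr
      _ = _ := by ring
  have hle : circleAverage (fun z => 1 + U (φ z)) ζ h
      + circleAverage (fun z : ℂ => 12 / 25 * (‖z - 1 / 2‖ ^ 2 - 9 / 4)) ζ h
        ≤ circleAverage W ζ h := by
    rw [← circleAverage_fun_add hi1 hi2]
    exact circleAverage_mono (hi1.fun_add hi2) hWi fun z _ => le_max_left _ _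
  refine max_le ?_ (by linarith)
  linarith

end DiscFunction

end Plurithin

namespace Plurithin

open Real Metric Filter Topology MeasureTheory

/-! ### Smoothing -/

section Mollification

variable {n : ℕ}

/-- Averaging the sub-mean value inequality against a weight `ψ` of small support. -/
lemma integral_mul_le_mean {μ : Measure (Cn n)} [SFinite μ] {ψ f c : Cn n → ℝ} {ε : ℝ}
    (hψi : Integrable ψ μ) (hψ0 : ∀ y, 0 ≤ ψ y) (hψε : ∀ y, ε ≤ ‖y‖ → ψ y = 0)
    (hf : Measurable f) (hf0 : ∀ z, 0 ≤ f z) (hf1 : ∀ z, f z ≤ 1)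
    {T : ℝ → Cn n → Cn n} (hT : Continuous (Function.uncurry T))
    (hci : Integrable (fun y => ψ y * c y) μ)
    (hc : ∀ y, ‖y‖ < ε → c y ≤ (2 * π)⁻¹ * ∫ θ in 0..2 * π, f (T θ y)) :
    ∫ y, ψ y * c y ∂μ ≤ (2 * π)⁻¹ * ∫ θ in 0..2 * π, ∫ y, ψ y * f (T θ y) ∂μ := by
  have hint : Integrable (Function.uncurry fun θ y => ψ y * f (T θ y))
      ((volume.restrict (Set.uIoc 0 (2 * π))).prod μ) := by
    have h1 : Integrable (fun p : ℝ × Cn n => ψ p.2)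
        ((volume.restrict (Set.uIoc 0 (2 * π))).prod μ) := by
      have : IsFiniteMeasure (volume.restrict (Set.uIoc 0 (2 * π))) :=
        ⟨by rw [Measure.restrict_apply_univ, Set.uIoc]; exact measure_Ioc_lt_top⟩
      exact hψi.comp_snd _
    refine h1.mono (h1.aestronglyMeasurable.mul
      (hf.comp hT.measurable).aestronglyMeasurable) (Eventually.of_forall fun p => ?_)
    change ‖ψ p.2 * f (T p.1 p.2)‖ ≤ ‖ψ p.2‖
    rw [norm_mul, Real.norm_of_nonneg (hf0 _)]
    exact mul_le_of_le_one_right (norm_nonneg _) (hf1 _)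
  rw [intervalIntegral_integral_swap hint, ← integral_const_mul]
  refine integral_mono hci (Integrable.const_mul ?_ _) fun y => ?_
  · have := hint.integral_prod_right
    refine this.congr (Eventually.of_forall fun y => ?_)
    have h2π : (0 : ℝ) ≤ 2 * π := by positivity
    simp [intervalIntegral.integral_of_le h2π, Set.uIoc_of_le h2π]
  · simp only [intervalIntegral.integral_const_mul]
    rcases lt_or_ge ‖y‖ ε with h | h
    · calc ψ y * c y ≤ ψ y * ((2 * π)⁻¹ * ∫ θ in 0..2 * π, f (T θ y)) :=
            mul_le_mul_of_nonneg_left (hc y h) (hψ0 y)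
        _ = _ := by ring
    · simp [hψε y h]

/-- A nonnegative radial function of integral one with support in a small ball. -/
lemma exists_radial_mollifier (μ : Measure (Cn n)) [μ.IsAddHaarMeasure] {ε : ℝ} (hε : 0 < ε) :
    ∃ ψ : Cn n → ℝ, ContDiff ℝ 2 ψ ∧ HasCompactSupport ψ ∧ (∀ y, 0 ≤ ψ y) ∧
      (∀ y, ε ≤ ‖y‖ → ψ y = 0) ∧ ∫ y, ψ y ∂μ = 1 ∧ ∀ y z, ‖y‖ = ‖z‖ → ψ y = ψ z := by
  set χ : Cn n → ℝ := fun y => Real.smoothTransition (1 - (ε ^ 2)⁻¹ * ‖y‖ ^ 2) with hχ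
  have hχd : ContDiff ℝ 2 χ := by
    refine (Real.smoothTransition.contDiff (n := 2)).comp ?_
    exact contDiff_const.sub (contDiff_const.mul (contDiff_norm_sq ℂ))
  have hχε : ∀ y, ε ≤ ‖y‖ → χ y = 0 := by
    intro y hy
    apply Real.smoothTransition.zero_of_nonpos
    have h1 : ε ^ 2 ≤ ‖y‖ ^ 2 := by gcongr
    have h2 : (ε ^ 2)⁻¹ * ε ^ 2 = 1 := inv_mul_cancel₀ (by positivity)
    have h3 : (ε ^ 2)⁻¹ * ε ^ 2 ≤ (ε ^ 2)⁻¹ * ‖y‖ ^ 2 := by gcongr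
    linarith
  have hχc : HasCompactSupport χ := by
    refine HasCompactSupport.intro (isCompact_closedBall (0 : Cn n) ε) fun y hy => ?_
    rw [mem_closedBall_zero_iff, not_le] at hy
    exact hχε y hy.le
  have hχ0 : ∀ y, 0 ≤ χ y := fun y => Real.smoothTransition.nonneg _
  have hpos : 0 < ∫ y, χ y ∂μ := by
    refine hχd.continuous.integral_pos_of_hasCompactSupport_nonneg_nonzero hχc hχ0 (x := 0) ?_
    simp [hχ, Real.smoothTransition.one]
  obtain ⟨c, hc⟩ : ∃ c, c = (∫ y, χ y ∂μ)⁻¹ := ⟨_, rfl⟩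
  have hc0 : 0 ≤ c := by rw [hc]; positivity
  have hχr : ∀ y z, ‖y‖ = ‖z‖ → χ y = χ z := fun y z h => by simp only [hχ, h]
  clear_value χ
  refine ⟨fun y => c * χ y, (contDiff_const (c := c)).mul hχd, hχc.mul_left, ?_, ?_, ?_, ?_⟩
  · intro y; exact mul_nonneg hc0 (hχ0 y)
  · intro y hy; simp [hχε y hy]
  · rw [integral_const_mul, hc, inv_mul_cancel₀ hpos.ne']
  · intro y z h; simp only [hχr y z h]

/-- Smoothing of a bounded function with the sub-mean value property on the complex affine discs
in a ball. The smoothed function has the same property in a smaller ball, is not smaller at the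
centre, and vanishes where the given function vanishes in a ball of radius `ε`. -/
lemma exists_mollification {f : Cn n → ℝ} (hf : Measurable f) (hf0 : ∀ z, 0 ≤ f z)
    (hf1 : ∀ z, f z ≤ 1) (hfc : HasCompactSupport f) {ρ ε : ℝ} (hε : 0 < ε) (hερ : 2 * ε ≤ ρ)
    (hsub : ∀ z w : Cn n, (∀ ζ : ℂ, ‖ζ‖ ≤ 1 → ‖z + ζ • w‖ < ρ) →
      f z ≤ circleAverage (fun ζ : ℂ => f (z + ζ • w)) 0 1) :
    ∃ (V : Cn n → ℝ) (L : ℝ), ContDiff ℝ 1 V ∧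
      (∀ x y, ‖fderiv ℝ V x - fderiv ℝ V y‖ ≤ L * ‖x - y‖) ∧ 0 ≤ L ∧ (∀ z, 0 ≤ V z) ∧
      (∀ z, V z ≤ 1) ∧
      (∀ z w : Cn n, (∀ ζ : ℂ, ‖ζ‖ ≤ 1 → ‖z + ζ • w‖ < ρ / 2) →
        V z ≤ circleAverage (fun ζ : ℂ => V (z + ζ • w)) 0 1) ∧
      f 0 ≤ V 0 ∧ ∀ z, (∀ y, ‖y - z‖ < ε → f y = 0) → V z = 0 := by
  set μ : Measure (Cn n) := Measure.hausdorffMeasure (Module.finrank ℝ (Cn n)) with hμ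
  have : μ.IsAddHaarMeasure := isAddHaarMeasure_hausdorffMeasure
  obtain ⟨ψ, hψd, hψc, hψ0, hψε, hψ1, hψr⟩ := exists_radial_mollifier μ hε
  have hψi : Integrable ψ μ := hψd.continuous.integrable_of_hasCompactSupport hψc
  set V : Cn n → ℝ := fun z => ∫ y, ψ y * f (z - y) ∂μ with hV
  have hVconv : V = MeasureTheory.convolution ψ f (ContinuousLinearMap.lsmul ℝ ℝ) μ := by
    funext z; simp [hV, MeasureTheory.convolution]
  have hfb : ∀ᵐ z ∂μ, ‖f z‖ ≤ (1 : ℝ) :=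
    Eventually.of_forall fun z => by rw [Real.norm_of_nonneg (hf0 z)]; exact hf1 z
  have hfl : LocallyIntegrable f μ := by
    refine (locallyIntegrable_const (1 : ℝ)).mono hf.aestronglyMeasurable ?_
    filter_upwards [hfb] with z hz; simpa using hz
  have hV2 : ContDiff ℝ 2 V := by
    rw [hVconv]
    exact hψc.contDiff_convolution_left _ (n := 2) hψd hfl
  have hVc : HasCompactSupport V := by
    rw [hVconv]; exact hψc.convolution _ hfc
  obtain ⟨L, hL⟩ := ContDiff.lipschitzWith_of_hasCompactSupport (𝕂 := ℝ) (hVc.fderiv ℝ)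
    (hV2.fderiv_right (m := 1) (by norm_num)) one_ne_zero
  have hint : ∀ z, Integrable (fun y => ψ y * f (z - y)) μ := by
    intro z
    refine hψi.mono (hψi.aestronglyMeasurable.mul
      (hf.comp (measurable_const.sub measurable_id)).aestronglyMeasurable)
      (Eventually.of_forall fun y => ?_)
    rw [norm_mul, Real.norm_of_nonneg (hf0 _)]
    exact mul_le_of_le_one_right (norm_nonneg _) (hf1 _)
  refine ⟨V, L, hV2.of_le (by norm_num), ?_, L.2, ?_, ?_, ?_, ?_, ?_⟩
  · intro x y
    have := hL.dist_le_mul x y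
    rwa [dist_eq_norm, dist_eq_norm] at this
  · exact fun z => integral_nonneg fun y => mul_nonneg (hψ0 y) (hf0 _)
  · intro z
    rw [← hψ1]
    exact integral_mono (hint z) hψi fun y => mul_le_of_le_one_right (hψ0 y) (hf1 _)
  · intro z w hzw
    rw [circleAverage_def, smul_eq_mul]
    refine integral_mul_le_mean (T := fun θ y => z + circleMap 0 1 θ • w - y) hψi hψ0 hψε hf hf0 hf1
      (by fun_prop) (hint z) fun y hy => ?_
    have := hsub (z - y) w fun ζ hζ => by
      have h1 := hzw ζ hζ
      have h2 := norm_sub_le (z + ζ • w) y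
      rw [show z - y + ζ • w = z + ζ • w - y by abel]
      linarith
    rw [circleAverage_def, smul_eq_mul] at this
    convert this using 5
    abel
  -- As `ψ` and `μ` are invariant under `y ↦ e^{iθ} y`, the sub-mean value inequality of `f` on the
  -- discs through `0` can be averaged.
  · have h0 : ∀ θ : ℝ, ∫ y, ψ y * f (0 - circleMap 0 1 θ • y) ∂μ = V 0 := by
      intro θ
      have hc1 : ‖circleMap 0 1 θ‖ = 1 := by simp
      have hc0 : circleMap 0 1 θ ≠ 0 := by rw [← norm_pos_iff, hc1]; exact one_pos
      let e : Cn n ≃ᵢ Cn n := IsometryEquiv.mk' (fun y => circleMap 0 1 θ • y)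
        (fun y => (circleMap 0 1 θ)⁻¹ • y) (fun y => smul_inv_smul₀ hc0 y)
        (Isometry.of_dist_eq fun x y => by rw [dist_smul₀, hc1, one_mul])
      have he : ∀ y, e y = circleMap 0 1 θ • y := fun y => rfl
      have hmp : MeasurePreserving e μ μ := e.measurePreserving_hausdorffMeasure _
      have := hmp.integral_comp e.toHomeomorph.measurableEmbedding (fun y => ψ y * f (0 - y))
      rw [hV]
      simp only
      rw [← this]
      congr 1
      funext y
      rw [he]
      congr 1
      exact hψr _ _ (by rw [norm_smul]; simp)
    have h1 : f 0 = ∫ y, ψ y * f 0 ∂μ := by rw [integral_mul_const, hψ1, one_mul]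
    have h2 : V 0 = (2 * π)⁻¹ * ∫ θ in 0..2 * π, ∫ y, ψ y * f (0 - circleMap 0 1 θ • y) ∂μ := by
      simp_rw [h0]
      rw [intervalIntegral.integral_const, smul_eq_mul, sub_zero, ← mul_assoc,
        inv_mul_cancel₀ (by positivity), one_mul]
    rw [h1, h2]
    refine integral_mul_le_mean (T := fun θ y => 0 - circleMap 0 1 θ • y) hψi hψ0 hψε hf hf0 hf1
      (by fun_prop) (hψi.mul_const _) fun y hy => ?_
    have := hsub 0 (-y) fun ζ hζ => by
      rw [zero_add, norm_smul, norm_neg]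
      nlinarith [norm_nonneg y]
    rw [circleAverage_def, smul_eq_mul] at this
    convert this using 5
    simp
  · intro z hz
    rw [hV]
    have : ∀ y, ψ y * f (z - y) = 0 := by
      intro y
      rcases lt_or_ge ‖y‖ ε with h | h
      · rw [hz (z - y) (by simpa using h), mul_zero]
      · rw [hψε y h, zero_mul]
    simp [this]

end Mollification

end Plurithin

namespace Plurithin

open Real Metric Filter Topology MeasureTheory

/-! ### Plurisubharmonic functions -/

section Psh

variable {n : ℕ}

/-- Plurisubharmonicity is invariant under complex affine changes of coordinates. -/
lemma IsPlurisubharmonicOn.comp_affine {u : Cn n → EReal} {G : Set (Cn n)}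
    (hu : IsPlurisubharmonicOn u G) (z₀ : Cn n) (A : Cn n →L[ℂ] Cn n) :
    IsPlurisubharmonicOn (fun z => u (z₀ + A z)) ((fun z => z₀ + A z) ⁻¹' G) where
  lt_top z hz := hu.lt_top _ hz
  usc := by
    intro z hz y hy
    have hc : ContinuousWithinAt (fun z => z₀ + A z) ((fun z => z₀ + A z) ⁻¹' G) z := by fun_prop
    exact (hc.tendsto_nhdsWithin (fun x hx => hx)).eventually (hu.usc _ hz y hy)
  submean z w h := by
    have := hu.submean (z₀ + A z) (A w) fun ζ hζ => by
      have := h ζ hζ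
      simpa [add_assoc] using this
    simpa [circleMean, add_assoc] using this

/-- An integrable real majorant on the circle bounds the extended-real mean by a Lebesgue integral. -/
lemma circleMean_le {u : Cn n → EReal} {z w : Cn n} {g : ℝ → ℝ}
    (hg : IntegrableOn g (Set.Ioc 0 (2 * π)))
    (hug : ∀ θ : ℝ, u (z + Complex.exp (θ * Complex.I) • w) ≤ g θ) :
    circleMean u z w ≤ (((2 * π)⁻¹ * ∫ θ in 0..2 * π, g θ : ℝ) : EReal) := by
  have h2π : 0 < 2 * π := by positivity
  set P : ENNReal := ∫⁻ θ in Set.Ioc 0 (2 * π), ENNReal.ofReal (g θ) with hP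
  set Q : ENNReal := ∫⁻ θ in Set.Ioc 0 (2 * π), ENNReal.ofReal (-g θ) with hQ
  have hPt : P ≠ ⊤ := hg.lintegral_lt_top.ne
  have hQt : Q ≠ ⊤ := hg.neg.lintegral_lt_top.ne
  have hd : ∀ X : ENNReal, X ≠ ⊤ →
      ((X / ENNReal.ofReal (2 * π) : ENNReal) : EReal) = ((X.toReal / (2 * π) : ℝ) : EReal) := by
    intro X hX
    have h1 : X / ENNReal.ofReal (2 * π) ≠ ⊤ :=
      ENNReal.div_ne_top hX (by simpa using h2π)
    rw [← EReal.coe_ennreal_toReal h1, ENNReal.toReal_div, ENNReal.toReal_ofReal h2π.le]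
  have e : (((2 * π)⁻¹ * ∫ θ in 0..2 * π, g θ : ℝ) : EReal)
      = ((P / ENNReal.ofReal (2 * π) : ENNReal) : EReal)
        - ((Q / ENNReal.ofReal (2 * π) : ENNReal) : EReal) := by
    rw [hd P hPt, hd Q hQt, ← EReal.coe_sub, intervalIntegral.integral_of_le h2π.le,
      integral_eq_lintegral_pos_part_sub_lintegral_neg_part hg]
    congr 1
    ring
  rw [e]
  unfold circleMean
  refine EReal.sub_le_sub ?_ ?_
  · rw [EReal.coe_ennreal_le_coe_ennreal_iff]
    refine ENNReal.div_le_div_right (lintegral_mono fun θ => ?_) _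
    rw [← EReal.real_coe_toENNReal]
    exact EReal.toENNReal_le_toENNReal (hug θ)
  · rw [EReal.coe_ennreal_le_coe_ennreal_iff]
    refine ENNReal.div_le_div_right (lintegral_mono fun θ => ?_) _
    rw [← EReal.real_coe_toENNReal]
    refine EReal.toENNReal_le_toENNReal ?_
    rw [EReal.coe_neg, EReal.neg_le_neg_iff]
    exact hug θ

/-- Truncation from below and normalisation of a plurisubharmonic function near a point. By upper
semicontinuity the normalised function almost attains its upper bound `1` at the point. -/
lemma exists_normalisation {u : Cn n → EReal} {G : Set (Cn n)} (hG : IsOpen G)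
    (hu : IsPlurisubharmonicOn u G) (h0 : 0 ∈ G) {c : ℝ} (hc : (c : EReal) < u 0) {η : ℝ}
    (hη : 0 < η) :
    ∃ ρ > 0, ball 0 ρ ⊆ G ∧ ∃ f : Cn n → ℝ, Measurable f ∧ (∀ z, 0 ≤ f z) ∧ (∀ z, f z ≤ 1) ∧
      HasCompactSupport f ∧ 1 - η ≤ f 0 ∧ (∀ z ∈ ball 0 ρ, u z < c → f z = 0) ∧
      ∀ z w : Cn n, (∀ ζ : ℂ, ‖ζ‖ ≤ 1 → ‖z + ζ • w‖ < ρ) →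
        f z ≤ circleAverage (fun ζ : ℂ => f (z + ζ • w)) 0 1 := by
  have h2π : 0 < 2 * π := by positivity
  obtain ⟨U0, hU0⟩ : ∃ U0 : ℝ, u 0 = U0 :=
    ⟨(u 0).toReal, (EReal.coe_toReal (hu.lt_top 0 h0).ne (ne_bot_of_gt hc)).symm⟩
  have hcU : c < U0 := by rw [hU0] at hc; exact_mod_cast hc
  -- `f = (max u c - c) / (C - c)`, where `C > u 0` bounds `u` near `0` and is close to `u 0`.
  set C := U0 + η * (U0 - c) with hC
  have hUC : U0 < C := by
    have : 0 < η * (U0 - c) := mul_pos hη (by linarith)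
    linarith
  have hnb : ∀ᶠ z in 𝓝 (0 : Cn n), z ∈ G ∧ u z < C := by
    have h1 : ∀ᶠ z in 𝓝[G] (0 : Cn n), u z < C := hu.usc 0 h0 C (by
      change u 0 < C
      rw [hU0]; exact_mod_cast hUC)
    rw [hG.nhdsWithin_eq h0] at h1
    exact (hG.eventually_mem h0).and h1
  obtain ⟨ρ, hρ, hball⟩ := Metric.eventually_nhds_iff_ball.1 hnb
  have hCc : 0 < C - c := by linarith
  classical
  set f : Cn n → ℝ := fun z => if z ∈ ball 0 ρ then ((max (u z) c).toReal - c) / (C - c) else 0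
    with hf
  have hmax : ∀ z ∈ ball (0 : Cn n) ρ, ((max (u z) c).toReal : EReal) = max (u z) c := by
    intro z hz
    refine EReal.coe_toReal (max_lt (hu.lt_top z (hball z hz).1) (EReal.coe_lt_top c)).ne ?_
    exact ne_bot_of_gt (lt_of_lt_of_le (EReal.bot_lt_coe c) (le_max_right _ _))
  have hge : ∀ z ∈ ball (0 : Cn n) ρ, c ≤ (max (u z) c).toReal := by
    intro z hz
    have : (c : EReal) ≤ ((max (u z) c).toReal : EReal) := by rw [hmax z hz]; exact le_max_right _ _
    exact_mod_cast this
  have hle : ∀ z ∈ ball (0 : Cn n) ρ, (max (u z) c).toReal ≤ C := by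
    intro z hz
    have : ((max (u z) c).toReal : EReal) ≤ C := by
      rw [hmax z hz]
      exact max_le (hball z hz).2.le (by exact_mod_cast (by linarith : c ≤ C))
    exact_mod_cast this
  have hf0 : ∀ z, 0 ≤ f z := by
    intro z
    by_cases hz : z ∈ ball (0 : Cn n) ρ
    · simp only [hf, if_pos hz]
      have := hge z hz
      exact div_nonneg (by linarith) hCc.le
    · simp only [hf, if_neg hz]; exact le_rfl
  have hf1 : ∀ z, f z ≤ 1 := by
    intro z
    by_cases hz : z ∈ ball (0 : Cn n) ρ
    · simp only [hf, if_pos hz]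
      have := hle z hz
      rw [div_le_one hCc]; linarith
    · simp only [hf, if_neg hz]; exact zero_le_one
  have hfm : Measurable f := by
    refine measurable_of_restrict_of_restrict_compl (s := ball (0 : Cn n) ρ) measurableSet_ball ?_ ?_
    · have h1 : Measurable ((ball (0 : Cn n) ρ).domRestrict u) :=
        (upperSemicontinuousOn_iff_restrict.2
          (hu.usc.mono fun z hz => (hball z hz).1)).measurable
      have h2 : (ball (0 : Cn n) ρ).domRestrict f
          = fun z => ((max ((ball (0 : Cn n) ρ).domRestrict u z) c).toReal - c) / (C - c) := by
        funext z; simp only [Set.domRestrict_apply, hf, if_pos z.2]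
      rw [h2]
      exact ((h1.max measurable_const).ereal_toReal.sub_const c).div_const _
    · have : (ball (0 : Cn n) ρ)ᶜ.domRestrict f = fun _ => 0 := by
        funext z
        have := z.2
        rw [Set.mem_compl_iff] at this
        simp only [Set.domRestrict_apply, hf, if_neg this]
      rw [this]; exact measurable_const
  refine ⟨ρ, hρ, fun z hz => (hball z hz).1, f, hfm, hf0, hf1, ?_, ?_, ?_, ?_⟩
  · refine HasCompactSupport.intro (isCompact_closedBall (0 : Cn n) ρ) fun z hz => ?_
    have : z ∉ ball (0 : Cn n) ρ := fun h => hz (ball_subset_closedBall h)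
    simp only [hf, if_neg this]
  · have h1 : max (u 0) c = (U0 : EReal) := by
      rw [hU0]; exact max_eq_left (by exact_mod_cast hcU.le)
    simp only [hf, if_pos (mem_ball_self hρ), h1, EReal.toReal_coe]
    rw [le_div_iff₀ hCc, hC]
    nlinarith [mul_pos hη hη]
  · intro z hz huz
    simp only [hf, if_pos hz, max_eq_right huz.le, EReal.toReal_coe, sub_self, zero_div]
  · intro z w hzw
    have hz : z ∈ ball (0 : Cn n) ρ := by simpa using hzw 0 (by simp)
    have hcirc : ∀ θ : ℝ, z + Complex.exp (θ * Complex.I) • w ∈ ball (0 : Cn n) ρ := by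
      intro θ
      rw [mem_ball_zero_iff]
      exact hzw _ (by rw [Complex.norm_exp_ofReal_mul_I])
    have hav : circleAverage (fun ζ : ℂ => f (z + ζ • w)) 0 1
        = (2 * π)⁻¹ * ∫ θ in 0..2 * π, f (z + Complex.exp (θ * Complex.I) • w) := by
      simp [circleAverage_def, circleMap]
    rcases le_or_gt (u z) c with h | h
    · have : f z = 0 := by
        simp only [hf, if_pos hz, max_eq_right h, EReal.toReal_coe, sub_self, zero_div]
      rw [this]
      exact circleAverage_nonneg_of_nonneg fun _ _ => hf0 _
    · have hfθ : Measurable fun θ : ℝ => f (z + Complex.exp (θ * Complex.I) • w) :=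
        hfm.comp (by fun_prop)
      have hfi : IntegrableOn (fun θ : ℝ => f (z + Complex.exp (θ * Complex.I) • w))
          (Set.Ioc 0 (2 * π)) := by
        refine Measure.integrableOn_of_bounded (M := 1) measure_Ioc_lt_top.ne
          hfθ.aestronglyMeasurable (Eventually.of_forall fun θ => ?_)
        rw [Real.norm_of_nonneg (hf0 _)]; exact hf1 _
      have hgi : IntegrableOn (fun θ : ℝ => c + (C - c) * f (z + Complex.exp (θ * Complex.I) • w))
          (Set.Ioc 0 (2 * π)) :=
        (integrableOn_const measure_Ioc_lt_top.ne).add (hfi.const_mul _)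
      have h1 := (hu.submean z w fun ζ hζ => (hball _ (by
        rw [mem_ball_zero_iff]; exact hzw ζ hζ)).1).trans (circleMean_le hgi fun θ => by
          have e1 : c + (C - c) * f (z + Complex.exp (θ * Complex.I) • w)
              = (max (u (z + Complex.exp (θ * Complex.I) • w)) c).toReal := by
            simp only [hf, if_pos (hcirc θ)]
            field_simp
            ring
          rw [e1, hmax _ (hcirc θ)]
          exact le_max_left _ _)
      rw [intervalIntegral.integral_add intervalIntegrable_const (by
          rw [intervalIntegrable_iff_integrableOn_Ioc_of_le h2π.le]; exact hfi.const_mul _),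
        intervalIntegral.integral_const, intervalIntegral.integral_const_mul] at h1
      have h2 : (max (u z) c).toReal ≤ (2 * π)⁻¹ * ((2 * π - 0) • c
          + (C - c) * ∫ θ in 0..2 * π, f (z + Complex.exp (θ * Complex.I) • w)) := by
        have := hmax z hz
        rw [max_eq_left h.le] at this ⊢
        rw [← this] at h1
        exact_mod_cast h1
      rw [hav]
      simp only [hf, if_pos hz]
      rw [div_le_iff₀ hCc]
      simp only [hf] at h2
      have h3 : ∀ X : ℝ, (2 * π)⁻¹ * ((2 * π - 0) • c + (C - c) * X)
          = c + (2 * π)⁻¹ * X * (C - c) := by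
        intro X; rw [smul_eq_mul]; field_simp; ring
      rw [h3] at h2
      linarith

end Psh

end Plurithin

namespace Plurithin

open Real Metric Filter Topology MeasureTheory

/-! ### Selection of a disc and rescaling -/

section Selection

variable {n N : ℕ} [NeZero N]

/-- Among the discs of a family whose points of attachment depend on the parameter in a bi-Lipschitz
way there is one for which few points of attachment lie in a given open set of small measure. -/
lemma exists_few_bad_nodes {x : Rn n → ZMod N → Rn n} {R : ℝ}
    (hanti : ∀ v v', ‖v‖ ≤ 1 → ‖v'‖ ≤ 1 → ∀ j, ‖v - v'‖ ≤ 3 * ‖x v j - x v' j‖)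
    (hlip : ∀ v v', ‖v‖ ≤ 1 → ‖v'‖ ≤ 1 → ∀ j, ‖x v j - x v' j‖ ≤ R * ‖v - v'‖)
    {O : Set (Rn n)} (hO : IsOpen O)
    (hμ : (100 : ENNReal) * (3 ^ n * μH[(n : ℝ)] O) < μH[(n : ℝ)] (ball (0 : Rn n) 1)) :
    ∃ v : Rn n, ‖v‖ ≤ 1 ∧ 100 * Nat.card {j : ZMod N // x v j ∈ O} ≤ N := by
  classical
  by_contra! hcon
  set B : Set (Rn n) := ball 0 1 with hB
  set E : ZMod N → Set (Rn n) := fun j => B ∩ (fun v => x v j) ⁻¹' O with hE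
  have hEm : ∀ j, MeasurableSet (E j) := by
    intro j
    refine (ContinuousOn.isOpen_inter_preimage ?_ isOpen_ball hO).measurableSet
    have : LipschitzOnWith R.toNNReal (fun v => x v j) B := by
      refine LipschitzOnWith.of_dist_le_mul fun v hv v' hv' => ?_
      rw [dist_eq_norm, dist_eq_norm]
      refine (hlip v v' (mem_ball_zero_iff.1 hv).le (mem_ball_zero_iff.1 hv').le j).trans ?_
      gcongr
      exact le_coe_toNNReal R
    exact this.continuousOn
  have hEle : ∀ j, μH[(n : ℝ)] (E j) ≤ 3 ^ n * μH[(n : ℝ)] O := by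
    intro j
    have h1 : E j = (Subtype.val : B → Rn n) '' ((fun v : B => x v j) ⁻¹' O) := by
      ext v; constructor
      · rintro ⟨a, b⟩; exact ⟨⟨v, a⟩, b, rfl⟩
      · rintro ⟨⟨v, a⟩, b, rfl⟩; exact ⟨a, b⟩
    have h2 : AntilipschitzWith 3 (fun v : B => x v j) := by
      refine AntilipschitzWith.of_le_mul_dist fun v v' => ?_
      rw [Subtype.dist_eq, dist_eq_norm, dist_eq_norm]
      exact hanti v v' (mem_ball_zero_iff.1 v.2).le (mem_ball_zero_iff.1 v'.2).le j
    rw [h1, isometry_subtype_coe.hausdorffMeasure_image (Or.inl (Nat.cast_nonneg n))]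
    refine (h2.hausdorffMeasure_preimage_le (Nat.cast_nonneg n) O).trans (le_of_eq ?_)
    simp
  -- If every disc had more than `N / 100` bad nodes, integration over `v` would contradict `hμ`.
  have hsum : ∀ v ∈ B, (N : ENNReal) ≤ 100 * ∑ j, (E j).indicator 1 v := by
    intro v hv
    have h1 := hcon v (mem_ball_zero_iff.1 hv).le
    have h2 : ∑ j, (E j).indicator (1 : Rn n → ENNReal) v
        = (Nat.card {j : ZMod N // x v j ∈ O} : ENNReal) := by
      rw [Nat.card_eq_fintype_card, Fintype.card_subtype, Finset.card_filter]
      push_cast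
      refine Finset.sum_congr rfl fun j _ => ?_
      simp [Set.indicator, hE, hv]
    rw [h2]
    exact_mod_cast h1.le
  have h1 : (N : ENNReal) * μH[(n : ℝ)] B
      ≤ 100 * ∑ j : ZMod N, μH[(n : ℝ)] (E j) := by
    calc (N : ENNReal) * μH[(n : ℝ)] B = ∫⁻ _v in B, (N : ENNReal) ∂μH[(n : ℝ)] := by
          rw [setLIntegral_const]
      _ ≤ ∫⁻ v in B, 100 * ∑ j, (E j).indicator 1 v ∂μH[(n : ℝ)] :=
          setLIntegral_mono' measurableSet_ball hsum
      _ ≤ ∫⁻ v, 100 * ∑ j, (E j).indicator 1 v ∂μH[(n : ℝ)] := setLIntegral_le_lintegral _ _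
      _ = 100 * ∑ j : ZMod N, μH[(n : ℝ)] (E j) := by
          rw [lintegral_const_mul, lintegral_finsetSum]
          · simp_rw [lintegral_indicator_one (hEm _)]
          · exact fun j _ => measurable_one.indicator (hEm j)
          · exact Finset.measurable_sum _ fun j _ => measurable_one.indicator (hEm j)
  have h2 : 100 * ∑ j : ZMod N, μH[(n : ℝ)] (E j)
      ≤ N * (100 * (3 ^ n * μH[(n : ℝ)] O)) := by
    calc _ ≤ 100 * ∑ _j : ZMod N, 3 ^ n * μH[(n : ℝ)] O := by gcongr with j; exact hEle j
      _ = _ := by simp [ZMod.card]; ring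
  have h3 : (N : ENNReal) * (100 * (3 ^ n * μH[(n : ℝ)] O)) < N * μH[(n : ℝ)] B :=
    ENNReal.mul_lt_mul_right (by exact_mod_cast NeZero.ne N) (ENNReal.natCast_ne_top N) hμ
  exact absurd (h1.trans h2) (not_le.2 h3)

/-- The circle average of a function which vanishes on most arcs between neighbouring nodes. -/
lemma circleAverage_le_card_div {W : ℂ → ℝ} (hW : CircleIntegrable W 0 1)
    (h1 : ∀ ζ : ℂ, ‖ζ‖ = 1 → W ζ ≤ 1) (s : Set (ZMod N))
    (hs : ∀ j ∉ s, ∀ α : ℝ, 0 ≤ α → α ≤ 2 * π / N →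
      W (Complex.exp (α * Complex.I) * node j) ≤ 0) :
    circleAverage W 0 1 ≤ Nat.card s / N := by
  classical
  have hN0 : (0 : ℝ) < N := Nat.cast_pos.2 (NeZero.pos N)
  have hπ := Real.pi_pos
  set a : ℕ → ℝ := fun k => k * (2 * π / N) with ha
  have hai : ∀ k, a k ≤ a (k + 1) := fun k => by simp only [ha]; push_cast; gcongr; linarith
  have hmem : ∀ k < N, Set.uIcc (a k) (a (k + 1)) ⊆ Set.uIcc 0 (2 * π) := by
    intro k hk
    rw [Set.uIcc_of_le (hai k), Set.uIcc_of_le (by positivity)]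
    refine Set.Icc_subset_Icc (by simp only [ha]; positivity) ?_
    have : ((k + 1 : ℕ) : ℝ) ≤ N := by exact_mod_cast hk
    calc a (k + 1) ≤ N * (2 * π / N) := by simp only [ha]; gcongr
      _ = 2 * π := by field_simp
  have hint : ∀ k < N, IntervalIntegrable (fun θ => W (circleMap 0 1 θ)) volume (a k) (a (k + 1)) :=
    fun k hk => IntervalIntegrable.mono_set hW (hmem k hk)
  have hsum := intervalIntegral.sum_integral_adjacent_intervals (n := N) hint
  have ha0 : a 0 = 0 := by simp [ha]
  have haN : a N = 2 * π := by simp only [ha]; field_simp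
  rw [ha0, haN] at hsum
  have hterm : ∀ k ∈ Finset.range N, ∫ θ in a k..a (k + 1), W (circleMap 0 1 θ)
      ≤ (2 * π / N) * (if (k : ZMod N) ∈ s then 1 else 0) := by
    intro k hk
    rw [Finset.mem_range] at hk
    have hconst : ∫ _θ in a k..a (k + 1), (if (k : ZMod N) ∈ s then (1 : ℝ) else 0)
        = (2 * π / N) * (if (k : ZMod N) ∈ s then 1 else 0) := by
      rw [intervalIntegral.integral_const, smul_eq_mul]
      congr 1
      simp only [ha]; push_cast; ring
    rw [← hconst]
    refine intervalIntegral.integral_mono_on (hai k) (hint k hk) intervalIntegrable_const ?_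
    intro θ hθ
    split_ifs with hks
    · exact h1 _ (by simp)
    · have e : circleMap 0 1 θ = Complex.exp ((θ - a k : ℝ) * Complex.I) * node (k : ZMod N) := by
        have := ZMod.stdAddChar_coe (N := N) k
        simp only [Int.cast_natCast] at this
        rw [node, this, ← Complex.exp_add]
        simp only [circleMap, zero_add, Complex.ofReal_one, one_mul, ha]
        congr 1
        push_cast
        field_simp
        ring
      rw [e]
      refine hs _ hks _ (by linarith [hθ.1]) ?_
      have : a (k + 1) = a k + 2 * π / N := by simp only [ha]; push_cast; ring
      linarith [hθ.2]
  have hcard : ∑ k ∈ Finset.range N, (if (k : ZMod N) ∈ s then (1 : ℝ) else 0) = Nat.card s := by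
    rw [sum_range_natCast (fun j => if j ∈ s then (1 : ℝ) else 0), Nat.card_eq_fintype_card,
      Finset.sum_boole, ← Fintype.card_subtype]
  rw [circleAverage_def, smul_eq_mul, ← hsum]
  calc (2 * π)⁻¹ * ∑ k ∈ Finset.range N, ∫ θ in a k..a (k + 1), W (circleMap 0 1 θ)
      ≤ (2 * π)⁻¹ * ∑ k ∈ Finset.range N, (2 * π / N) * (if (k : ZMod N) ∈ s then 1 else 0) := by
        gcongr with k hk; exact hterm k hk
    _ = Nat.card s / N := by
        rw [← Finset.mul_sum, hcard]; field_simp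

end Selection

section Scaling

variable {n : ℕ}

/-- A `C²` map which vanishes to first order at `0` becomes small in `C^{1,1}` under rescaling. -/
lemma exists_rescaling {g : Rn n → Cn n} (hg : ContDiffAt ℝ 2 g 0) (g0 : g 0 = 0)
    (dg0 : fderiv ℝ g 0 = 0) {r δ : ℝ} (hr : 0 < r) (hδ : 0 < δ) :
    ∃ t, 0 < t ∧ t ≤ r ∧ ∃ G : Rn n → Cn n, G 0 = 0 ∧ (∀ x y, ‖G x - G y‖ ≤ δ * ‖x - y‖) ∧
      (∀ x, ‖x‖ ≤ 1000 → t • G x = g (t • x)) ∧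
      ∀ x y x' y', ‖x‖ ≤ 1000 → ‖y‖ ≤ 1000 → ‖x'‖ ≤ 1000 → ‖y'‖ ≤ 1000 →
      ‖(G y - G x) - (G y' - G x')‖ ≤
        δ * (‖(y - x) - (y' - x')‖ + (‖x - x'‖ + ‖y - y'‖) * ‖y' - x'‖) := by
  have hd1 : ContDiffAt ℝ 1 (fderiv ℝ g) 0 := hg.fderiv_right (by norm_num)
  obtain ⟨L, s, hs, hL⟩ := hd1.exists_lipschitzOnWith
  have hdiff : ∀ᶠ x in 𝓝 (0 : Rn n), DifferentiableAt ℝ g x := by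
    filter_upwards [hg.eventually (by simp)] with x hx
    exact hx.differentiableAt (by norm_num)
  obtain ⟨r₁, hr₁, hball⟩ := Metric.eventually_nhds_iff_ball.1
    ((eventually_mem_set.2 hs).and hdiff)
  -- `CE` is the factor lost in extending a Lipschitz map from a ball to all of `ℝⁿ`.
  obtain ⟨CE, hCE⟩ : ∃ CE : ℝ, CE = (lipschitzExtensionConstant (Cn n) : ℝ) := ⟨_, rfl⟩
  have hCE0 : 0 ≤ CE := by rw [hCE]; exact NNReal.coe_nonneg _
  set M : ℝ := (1 + CE) * (L * 1000) + 1 with hM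
  have hM0 : 0 < M := by positivity
  set t := min (min r (r₁ / 2000)) (δ / M) with ht
  have ht0 : 0 < t := by positivity
  have htr1 : t * 1000 < r₁ := by
    have : t ≤ r₁ / 2000 := (min_le_left _ _).trans (min_le_right _ _)
    linarith
  have htM : t * M ≤ δ := by
    have : t ≤ δ / M := min_le_right _ _
    rwa [le_div_iff₀ hM0] at this
  set δ' : ℝ := L * 1000 * t with hδ'
  have hδ'0 : 0 ≤ δ' := by positivity
  have hδ1 : (1 + CE) * δ' ≤ δ := by
    rw [hδ']
    have : (1 + CE) * (L * 1000 * t) = t * (M - 1) := by rw [hM]; ring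
    rw [this]; linarith
  have hδ'δ : δ' ≤ δ := by nlinarith
  have hin : ∀ x : Rn n, ‖x‖ ≤ 1000 → t • x ∈ ball (0 : Rn n) r₁ := by
    intro x hx
    rw [mem_ball_zero_iff, norm_smul, Real.norm_of_nonneg ht0.le]
    exact lt_of_le_of_lt (by gcongr) htr1
  set γ : Rn n → Cn n := fun x => t⁻¹ • g (t • x) with hγ
  have hγd : ∀ x : Rn n, ‖x‖ ≤ 1000 → HasFDerivAt γ (fderiv ℝ g (t • x)) x := by
    intro x hx
    have h1 : HasFDerivAt (fun x : Rn n => t • x) (t • ContinuousLinearMap.id ℝ (Rn n)) x :=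
      (hasFDerivAt_id x).const_smul t
    have h2 := ((hball _ (hin x hx)).2.hasFDerivAt.comp x h1).const_smul t⁻¹
    have e : fderiv ℝ g (t • x)
        = t⁻¹ • (fderiv ℝ g (t • x)).comp (t • ContinuousLinearMap.id ℝ (Rn n)) := by
      ext v; simp [smul_smul, inv_mul_cancel₀ ht0.ne']
    rw [e]
    exact h2
  have hLip : ∀ x y : Rn n, ‖x‖ ≤ 1000 → ‖y‖ ≤ 1000 →
      ‖fderiv ℝ g (t • x) - fderiv ℝ g (t • y)‖ ≤ L * t * ‖x - y‖ := by
    intro x y hx hy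
    have := hL.dist_le_mul _ (hball _ (hin x hx)).1 _ (hball _ (hin y hy)).1
    rw [dist_eq_norm, dist_eq_norm, ← smul_sub, norm_smul, Real.norm_of_nonneg ht0.le] at this
    linarith
  have hbd : ∀ x : Rn n, ‖x‖ ≤ 1000 → ‖fderiv ℝ g (t • x)‖ ≤ δ' := by
    intro x hx
    have := hLip x 0 hx (by simp)
    rw [smul_zero, dg0, sub_zero, sub_zero] at this
    refine this.trans ?_
    rw [hδ']
    have : L * t * ‖x‖ ≤ L * t * 1000 := by gcongr
    linarith
  have hconv : Convex ℝ (closedBall (0 : Rn n) 1000) := convex_closedBall _ _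
  have hγlip : LipschitzOnWith δ'.toNNReal γ (closedBall 0 1000) := by
    refine LipschitzOnWith.of_dist_le_mul fun x hx y hy => ?_
    rw [dist_eq_norm, dist_eq_norm, Real.coe_toNNReal _ hδ'0]
    exact hconv.norm_image_sub_le_of_norm_hasFDerivWithin_le
      (fun z hz => (hγd z (mem_closedBall_zero_iff.1 hz)).hasFDerivWithinAt)
      (fun z hz => hbd z (mem_closedBall_zero_iff.1 hz)) hy hx
  obtain ⟨G, hG, hGγ⟩ := hγlip.extend_finite_dimension
  have hGγ' : ∀ x, ‖x‖ ≤ 1000 → G x = γ x := fun x hx =>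
    (hGγ (mem_closedBall_zero_iff.2 hx)).symm
  refine ⟨t, ht0, (min_le_left _ _).trans (min_le_left _ _), G, ?_, ?_, ?_, ?_⟩
  · rw [hGγ' 0 (by simp), hγ]; simp [g0]
  · intro x y
    have := hG.dist_le_mul x y
    rw [dist_eq_norm, dist_eq_norm, NNReal.coe_mul, Real.coe_toNNReal _ hδ'0, ← hCE] at this
    refine this.trans ?_
    gcongr
    nlinarith
  · intro x hx
    rw [hGγ' x hx, hγ]; simp only [smul_smul, mul_inv_cancel₀ ht0.ne', one_smul]
  · intro x y x' y' hx hy hx' hy'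
    rw [hGγ' x hx, hGγ' y hy, hGγ' x' hx', hGγ' y' hy']
    set X : ℝ → Rn n := fun s => x + s • (y - x) with hX
    set X' : ℝ → Rn n := fun s => x' + s • (y' - x') with hX'
    have hXm : ∀ s ∈ Set.Icc (0 : ℝ) 1, ‖X s‖ ≤ 1000 := fun s hs =>
      mem_closedBall_zero_iff.1 (hconv.add_smul_sub_mem (mem_closedBall_zero_iff.2 hx)
        (mem_closedBall_zero_iff.2 hy) hs)
    have hXm' : ∀ s ∈ Set.Icc (0 : ℝ) 1, ‖X' s‖ ≤ 1000 := fun s hs =>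
      mem_closedBall_zero_iff.1 (hconv.add_smul_sub_mem (mem_closedBall_zero_iff.2 hx')
        (mem_closedBall_zero_iff.2 hy') hs)
    have hXd : ∀ (x y : Rn n) (s : ℝ), HasDerivAt (fun s : ℝ => x + s • (y - x)) (y - x) s := by
      intro x y s
      have := ((hasDerivAt_id s).smul_const (y - x)).const_add x
      rwa [one_smul] at this
    set e := ‖(y - x) - (y' - x')‖ with he
    set m := ‖x - x'‖ + ‖y - y'‖ with hm
    have hderiv : ∀ s ∈ Set.Icc (0 : ℝ) 1, HasDerivWithinAt (fun s => γ (X s) - γ (X' s))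
        (fderiv ℝ g (t • X s) (y - x) - fderiv ℝ g (t • X' s) (y' - x')) (Set.Icc 0 1) s := by
      intro s hs
      exact (((hγd _ (hXm s hs)).comp_hasDerivAt s (hXd x y s)).sub
        ((hγd _ (hXm' s hs)).comp_hasDerivAt s (hXd x' y' s))).hasDerivWithinAt
    have hbound : ∀ s ∈ Set.Ico (0 : ℝ) 1,
        ‖fderiv ℝ g (t • X s) (y - x) - fderiv ℝ g (t • X' s) (y' - x')‖
          ≤ δ' * (e + m * ‖y' - x'‖) := by
      intro s hs
      have hs' : s ∈ Set.Icc (0 : ℝ) 1 := ⟨hs.1, hs.2.le⟩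
      have e1 : fderiv ℝ g (t • X s) (y - x) - fderiv ℝ g (t • X' s) (y' - x')
          = fderiv ℝ g (t • X s) ((y - x) - (y' - x'))
            + (fderiv ℝ g (t • X s) - fderiv ℝ g (t • X' s)) (y' - x') := by
        rw [sub_apply, map_sub (fderiv ℝ g (t • X s)) (y - x) (y' - x')]; abel
      have e2 : ‖X s - X' s‖ ≤ m := by
        have : X s - X' s = (1 - s) • (x - x') + s • (y - y') := by
          simp only [hX, hX', smul_sub, sub_smul, one_smul]; abel
        rw [this]
        refine (norm_add_le _ _).trans ?_
        rw [norm_smul, norm_smul, Real.norm_of_nonneg (by linarith [hs.2]),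
          Real.norm_of_nonneg hs.1, hm]
        have : (1 - s) * ‖x - x'‖ ≤ 1 * ‖x - x'‖ := by gcongr; linarith [hs.1]
        have : s * ‖y - y'‖ ≤ 1 * ‖y - y'‖ := by gcongr; exact hs.2.le
        linarith
      have e3 : ‖fderiv ℝ g (t • X s) - fderiv ℝ g (t • X' s)‖ ≤ δ' * m := by
        refine (hLip _ _ (hXm s hs') (hXm' s hs')).trans ?_
        calc L * t * ‖X s - X' s‖ ≤ L * t * m := by gcongr
          _ ≤ δ' * m := by
            gcongr; rw [hδ']
            have : 0 ≤ (L : ℝ) * t := by positivity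
            nlinarith
      rw [e1]
      refine (norm_add_le _ _).trans ?_
      calc _ ≤ δ' * e + (δ' * m) * ‖y' - x'‖ := by
            gcongr
            · exact (ContinuousLinearMap.le_opNorm _ _).trans (by gcongr; exact hbd _ (hXm s hs'))
            · exact (ContinuousLinearMap.le_opNorm _ _).trans (by gcongr)
        _ = _ := by ring
    have h1 := norm_image_sub_le_of_norm_deriv_le_segment_01' hderiv hbound
    simp only [hX, hX', one_smul, zero_smul, add_zero, add_sub_cancel] at h1
    rw [show γ y - γ x - (γ y' - γ x') = γ y - γ y' - (γ x - γ x') by abel]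
    refine h1.trans ?_
    gcongr

end Scaling

end Plurithin

namespace Plurithin

open Real Metric Filter Topology MeasureTheory

/-! ### Non-thinness of totally real graphs -/

lemma continuous_ofE {n : ℕ} : Continuous (ofE : Rn n → Cn n) :=
  AddMonoidHomClass.continuous_of_bound
    (AddMonoidHom.mk' (ofE : Rn n → Cn n) fun x y => by ext i; simp) 1
    fun x => by simp [norm_ofE]

lemma ofE_smul {n : ℕ} (t : ℝ) (x : Rn n) : ofE (t • x) = t • ofE x := by ext i; simp

instance isAddHaarMeasure_hausdorff_Rn (n : ℕ) :
    (μH[(n : ℝ)] : Measure (Rn n)).IsAddHaarMeasure := by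
  have := isAddHaarMeasure_hausdorffMeasure (E := Rn n)
  rwa [finrank_euclideanSpace_fin] at this

/-- If `u` is plurisubharmonic and `c < u 0`, then `u < c` cannot hold almost everywhere near `0` on a
`C²` graph over `ℝⁿ` which is tangent to `ℝⁿ` at `0`. Otherwise most of the boundary of a suitable
attached disc would lie in the open set `u < c`, against the sub-mean value inequality at its
centre. -/
theorem not_ae_lt_on_graph {n : ℕ} {g : Rn n → Cn n} (hg : ContDiffAt ℝ 2 g 0) (g0 : g 0 = 0)
    (dg0 : fderiv ℝ g 0 = 0) {u : Cn n → EReal} {G : Set (Cn n)} (hG : IsOpen G)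
    (hu : IsPlurisubharmonicOn u G) (h0 : 0 ∈ G) {c : ℝ} (hc : (c : EReal) < u 0) {r : ℝ}
    (hr : 0 < r) :
    ¬ ∀ᵐ x ∂(μH[(n : ℝ)] : Measure (Rn n)), ‖x‖ < r → u (ofE x + g x) < c := by
  intro hae
  obtain ⟨ρ, hρ, hball, f, hfm, hf0, hf1, hfc, hfη, hfc0, hfsub⟩ :=
    exists_normalisation hG hu h0 hc (η := 1 / 50) (by norm_num)
  obtain ⟨t, ht0, htr, γ, γ0, hγ1, hγg, hγ2⟩ := exists_rescaling hg g0 dg0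
    (r := min (r / 2000) (ρ / 8000)) (δ := 1 / 10 ^ 9) (by positivity) (by norm_num)
  have htr1 : t ≤ r / 2000 := htr.trans (min_le_left _ _)
  have htρ : t ≤ ρ / 8000 := htr.trans (min_le_right _ _)
  set V : Set (Cn n) := ball 0 ρ ∩ u ⁻¹' Set.Iio (c : EReal) with hV
  have hVo : IsOpen V := by
    obtain ⟨v, hv, hv'⟩ := upperSemicontinuousOn_iff_preimage_Iio.1 (hu.usc.mono hball) (c : EReal)
    rw [hV, hv']
    exact isOpen_ball.inter hv
  set p : Rn n → Cn n := fun x => t • (ofE x + γ x) with hp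
  have hγc : Continuous γ := by
    refine (LipschitzWith.of_dist_le_mul (K := (1 / 10 ^ 9 : NNReal)) fun x y => ?_).continuous
    rw [dist_eq_norm, dist_eq_norm]
    simpa using hγ1 x y
  have hpc : Continuous p := (continuous_ofE.add hγc).const_smul t
  have hpρ : ∀ x, ‖x‖ ≤ 1000 → ‖p x‖ < ρ := by
    intro x hx
    have h1 := hγ1 x 0
    rw [γ0, sub_zero, sub_zero] at h1
    rw [hp, norm_smul, Real.norm_of_nonneg ht0.le]
    have h2 : ‖ofE x + γ x‖ ≤ 2000 := by
      refine (norm_add_le _ _).trans ?_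
      rw [norm_ofE]; linarith
    calc t * ‖ofE x + γ x‖ ≤ ρ / 8000 * 2000 := by gcongr
      _ < ρ := by linarith
  -- Apart from a null set, the relevant part of the graph lies in the open set `V`.
  have hbad : μH[(n : ℝ)] {x : Rn n | ‖x‖ ≤ 1000 ∧ p x ∉ V} = 0 := by
    rw [ae_iff] at hae
    refine measure_mono_null (t := (fun x : Rn n => t • x) ⁻¹'
      {a | ¬ (‖a‖ < r → u (ofE a + g a) < c)}) ?_ ?_
    · rintro x ⟨hx, hxV⟩ hx'
      refine hxV ⟨mem_ball_zero_iff.2 (hpρ x hx), ?_⟩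
      have e : p x = ofE (t • x) + g (t • x) := by
        rw [ofE_smul, ← hγg x hx, ← smul_add]
      rw [Set.mem_preimage, Set.mem_Iio, e]
      refine hx' ?_
      rw [norm_smul, Real.norm_of_nonneg ht0.le]
      calc t * ‖x‖ ≤ r / 2000 * 1000 := by gcongr
        _ < r := by linarith
    · rw [Measure.addHaar_preimage_smul _ ht0.ne', hae, mul_zero]
  have h3 : (100 * 3 ^ n : ENNReal) ≠ 0 := by positivity
  have h3' : (100 * 3 ^ n : ENNReal) ≠ ⊤ := by finiteness
  obtain ⟨O, hBO, hO, hμO⟩ := Set.exists_isOpen_lt_of_lt {x : Rn n | ‖x‖ ≤ 1000 ∧ p x ∉ V}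
    (μH[(n : ℝ)] (ball (0 : Rn n) 1) / (100 * 3 ^ n)) (by
      rw [hbad]
      exact ENNReal.div_pos (measure_ball_pos _ _ one_pos).ne' h3')
  have hμO' : (100 : ENNReal) * (3 ^ n * μH[(n : ℝ)] O) < μH[(n : ℝ)] (ball (0 : Rn n) 1) := by
    rw [ENNReal.lt_div_iff_mul_lt (Or.inl h3) (Or.inl h3')] at hμO
    rwa [← mul_assoc, mul_comm]
  have hKc : IsCompact (p '' (closedBall 0 1000 \ O)) :=
    ((isCompact_closedBall _ _).diff hO).image hpc
  have hKV : p '' (closedBall 0 1000 \ O) ⊆ V := by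
    rintro _ ⟨x, ⟨hx, hxO⟩, rfl⟩
    by_contra h
    exact hxO (hBO ⟨mem_closedBall_zero_iff.1 hx, h⟩)
  -- By compactness this part stays at a distance `d` from the complement of `V`, if `O` is removed.
  obtain ⟨d, hd, hdV⟩ := hKc.exists_thickening_subset_open hVo hKV
  obtain ⟨Vm, L, hVm1, hVmL, hL0, hVm0, hVmle, hVmsub, hfVm, hVmz⟩ :=
    exists_mollification hfm hf0 hf1 hfc (ρ := ρ) (ε := min (d / 2) (ρ / 2)) (by positivity)
      (by have := min_le_right (d / 2) (ρ / 2); linarith) hfsub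
  have hVmK : ∀ x, ‖x‖ ≤ 1000 → x ∉ O → ∀ z, ‖z - p x‖ < d / 2 → Vm z = 0 := by
    intro x hx hxO z hz
    refine hVmz z fun y hy => ?_
    have hyV : y ∈ V := by
      refine hdV (mem_thickening_iff.2
        ⟨p x, ⟨x, ⟨mem_closedBall_zero_iff.2 hx, hxO⟩, rfl⟩, ?_⟩)
      have := min_le_left (d / 2) (ρ / 2)
      calc dist y (p x) ≤ dist y z + dist z (p x) := dist_triangle _ _ _
        _ < d := by rw [dist_eq_norm, dist_eq_norm]; linarith
    exact hfc0 y hyV.1 hyV.2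
  -- The number of nodes is so large that a disc moves by less than `d / 2` between two nodes.
  obtain ⟨K, hK⟩ := exists_nat_gt ((2000 * t / d) ^ 2)
  obtain ⟨N, hN⟩ : ∃ N, N = 2 * K + 1 := ⟨_, rfl⟩
  have : NeZero N := ⟨by omega⟩
  have hNd : t * (1000 / √N) < d / 2 := by
    have h1 : 2000 * t / d < √N := by
      refine Real.lt_sqrt_of_sq_lt (hK.trans_le ?_)
      rw [hN]; exact_mod_cast (by omega : K ≤ 2 * K + 1)
    have h2 : 0 < √(N : ℝ) := lt_of_le_of_lt (by positivity) h1
    rw [div_lt_iff₀ hd] at h1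
    rw [mul_div_assoc', div_lt_iff₀ h2]
    linarith
  obtain ⟨x, φ, hx1, hxa, hxl, hφ0, hφn, hφd, hφb, hφα⟩ :=
    exists_attached_discs hN (by norm_num) le_rfl γ0 hγ1 hγ2
  obtain ⟨v, hv, hvO⟩ := exists_few_bad_nodes hxa hxl hO hμO'
  set U : Cn n → ℝ := fun z => Vm z - 1 with hU
  set ψ : ℂ → Cn n := fun ζ => t • φ v ζ with hψ
  have hψd : ∀ ζ, ζ ≠ 1 / 2 → ζ ≠ 2 → DifferentiableAt ℂ ψ ζ := fun ζ h1 h2 =>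
    (hφd v ζ h1 h2).const_smul t
  have hUd : ∀ z, fderiv ℝ U z = fderiv ℝ Vm z := fun z => fderiv_sub_const _
  have hsub : discFun U ψ 0 ≤ circleAverage (discFun U ψ) 0 1 := by
    refine discFun_zero_le_circleAverage (L := L) (ρ := ρ / 2) (hVm1.sub contDiff_const)
      (fun x y => by rw [hUd, hUd]; exact hVmL x y) hL0 (fun z => sub_nonpos.2 (hVmle z))
      (by positivity) ?_ hψd ?_
    · intro z w hzw
      have h1 := hVmsub z w hzw
      have hi : CircleIntegrable (fun ζ : ℂ => Vm (z + ζ • w)) 0 1 :=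
        (hVm1.continuous.comp (by fun_prop)).continuousOn.circleIntegrable zero_le_one
      have h2 := circleAverage_fun_sub hi (circleIntegrable_const (1 : ℝ) (0 : ℂ) 1)
      rw [circleAverage_const] at h2
      linarith
    · intro ζ h1 h2
      rw [hψ]; simp only
      rw [norm_smul, Real.norm_of_nonneg ht0.le]
      calc t * ‖φ v ζ‖ ≤ ρ / 8000 * 1000 := by gcongr; exact hφb v hv ζ h1 h2
        _ ≤ ρ / 2 / 2 := by linarith
  have hcirc : ∀ ζ : ℂ, ‖ζ‖ = 1 → discFun U ψ ζ ≤ Vm (ψ ζ) := by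
    intro ζ hζ
    have h1 : ‖ζ - 1 / 2‖ ≤ 3 / 2 := by
      refine (norm_sub_le _ _).trans ?_
      rw [hζ]; norm_num
    have h2 : ‖ζ - 1 / 2‖ ^ 2 ≤ (3 / 2) ^ 2 := by gcongr
    rw [discFun]
    refine max_le ?_ (hVm0 _)
    simp only [hU]
    linarith
  have hcont : CircleIntegrable (discFun U ψ) 0 1 := by
    refine ContinuousOn.circleIntegrable zero_le_one fun ζ hζ => ContinuousAt.continuousWithinAt ?_
    have hζ1 : ‖ζ‖ = 1 := mem_sphere_zero_iff_norm.1 hζ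
    have hc1 : ContinuousAt ψ ζ := by
      refine (hψd ζ ?_ ?_).continuousAt <;> rintro rfl <;> norm_num at hζ1
    have hc2 : ContinuousAt (fun ζ => U (ψ ζ)) ζ :=
      (hVm1.continuous.sub continuous_const).continuousAt.comp hc1
    have hc3 : ContinuousAt (fun ζ : ℂ => (12 / 25 * (‖ζ - 1 / 2‖ ^ 2 - 9 / 4) : ℝ)) ζ := by
      fun_prop
    exact ((continuousAt_const.add hc2).add hc3).max continuousAt_const
  have havg := circleAverage_le_card_div hcont
    (fun ζ hζ => (hcirc ζ hζ).trans (hVmle _)) {j | x v j ∈ O} (by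
      intro j hj α h1 h2
      refine (hcirc _ ?_).trans (le_of_eq ?_)
      · rw [norm_mul, Complex.norm_exp_ofReal_mul_I, one_mul, norm_node]
      · refine hVmK _ (hx1 v hv j) hj _ ?_
        have : ψ (Complex.exp (α * Complex.I) * node j) - p (x v j)
            = t • (φ v (Complex.exp (α * Complex.I) * node j) - φ v (node j)) := by
          rw [hφn v j, smul_sub]
        rw [this, norm_smul, Real.norm_of_nonneg ht0.le]
        exact lt_of_le_of_lt (by gcongr; exact hφα v hv j α h1 h2) hNd)
  have hN0 : (0 : ℝ) < N := Nat.cast_pos.2 (NeZero.pos N)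
  have hcard : (Nat.card ({j | x v j ∈ O} : Set (ZMod N)) : ℝ) / N ≤ 1 / 100 := by
    rw [div_le_iff₀ hN0]
    have : (100 : ℝ) * Nat.card {j : ZMod N // x v j ∈ O} ≤ N := by exact_mod_cast hvO
    have e : Nat.card ({j | x v j ∈ O} : Set (ZMod N)) = Nat.card {j : ZMod N // x v j ∈ O} := rfl
    rw [e]; linarith
  -- At the centre the quadratic term is `-24/25`, while `Vm 0 ≥ 49/50`.
  have hcentre : 1 / 50 ≤ discFun U ψ 0 := by
    refine le_max_of_le_left ?_
    have e : ψ 0 = 0 := by rw [hψ]; simp [hφ0]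
    rw [e]
    simp only [hU]
    norm_num
    linarith
  linarith

end Plurithin

namespace Plurithin

open Real Metric Filter Topology MeasureTheory

/-! ### Totally real slices of generic submanifolds -/

section Slices

/-- Almost every `n`-dimensional slice through `0` of a null set is null; in particular, the vectors
spanning such a slice can be found in any given open set. -/
lemma exists_slice_ae_notMem {F : Type*} [NormedAddCommGroup F] [NormedSpace ℝ F]
    [FiniteDimensional ℝ F] [MeasurableSpace F] [BorelSpace F] (ν : Measure F)
    [ν.IsAddHaarMeasure] {n : ℕ} (hn : 1 ≤ n) {A : Set F} (hA : ν A = 0) {W : Set (Fin n → F)}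
    (hW : IsOpen W) (hW0 : W.Nonempty) :
    ∃ s ∈ W, ∀ᵐ x ∂(μH[(n : ℝ)] : Measure (Rn n)), ∑ j, x j • s j ∉ A := by
  have : Nonempty (Fin n) := ⟨⟨0, hn⟩⟩
  have : Nontrivial (Rn n) := inferInstance
  set B := toMeasurable ν A with hB
  have hBm : MeasurableSet B := measurableSet_toMeasurable _ _
  have hB0 : ν B = 0 := by rw [hB, measure_toMeasurable, hA]
  set σ : Measure (Fin n → F) := Measure.pi fun _ => ν with hσ
  -- For `x ≠ 0` the map `s ↦ ∑ j, x j • s j` is linear and onto, so the preimage of a null set is null.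
  have h1 : ∀ᵐ x ∂(μH[(n : ℝ)] : Measure (Rn n)), ∀ᵐ s ∂σ, ∑ j, x j • s j ∈ Bᶜ := by
    have h0 : ∀ᵐ x ∂(μH[(n : ℝ)] : Measure (Rn n)), x ≠ 0 := by
      rw [ae_iff]; simp
    filter_upwards [h0] with x hx
    obtain ⟨i, hi⟩ : ∃ i, x i ≠ 0 := by
      by_contra! h
      exact hx (by ext i; simpa using h i)
    set L : (Fin n → F) →ₗ[ℝ] F := ∑ j, x j • LinearMap.proj j with hL
    have hLs : ∀ s, L s = ∑ j, x j • s j := fun s => by simp [hL]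
    have hsurj : Function.Surjective L := by
      intro y
      refine ⟨Pi.single i ((x i)⁻¹ • y), ?_⟩
      rw [hLs, Finset.sum_eq_single i]
      · simp [smul_smul, mul_inv_cancel₀ hi]
      · intro j _ hj; simp [Pi.single_eq_of_ne hj]
      · simp
    simp_rw [← hLs]
    rw [ae_comp_linearMap_mem_iff L σ ν hsurj hBm.compl]
    exact measure_eq_zero_iff_ae_notMem.1 hB0
  rw [Measure.ae_ae_comm] at h1
  · obtain ⟨s, hsW, hs⟩ :=
      ((frequently_ae_mem_iff.2 (hW.measure_pos σ hW0).ne').and_eventually h1).exists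
    refine ⟨s, hsW, ?_⟩
    filter_upwards [hs] with x hx hxA
    exact hx (subset_toMeasurable ν A hxA)
  · refine hBm.compl.preimage (Continuous.measurable ?_)
    fun_prop

/-- Near each of its points, a `C²` submanifold is parametrized by a linear space which contains
the tangent space, in such a way that a linear projection inverts the parametrization. -/
lemma IsC2Submanifold.exists_parametrization {n m : ℕ} {M : Set (Cn n)}
    (hM : IsC2Submanifold m M) {z₀ : Cn n} (hz₀ : z₀ ∈ M) :
    ∃ (F : Submodule ℝ (Cn n)) (Γ : F → Cn n) (Q : Cn n →L[ℝ] F), Module.finrank ℝ F = m ∧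
      ContDiffAt ℝ 2 Γ 0 ∧ Γ 0 = z₀ ∧ HasFDerivAt Γ F.subtypeL 0 ∧
      (∀ᶠ p in 𝓝 0, Γ p ∈ M ∧ Q (Γ p - z₀) = p) ∧ tangentSpace M z₀ ⊆ F := by
  obtain ⟨k, hmk, hloc⟩ := hM
  obtain ⟨U, hU, hzU, ρ, hρ, hsurj, hMU⟩ := hloc z₀ hz₀
  set D := fderiv ℝ ρ z₀ with hD
  have hDs : Function.Surjective D := hsurj z₀ ⟨hz₀, hzU⟩
  have hρz : ContDiffAt ℝ 2 ρ z₀ := hρ.contDiffAt (hU.mem_nhds hzU)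
  have hρd : HasFDerivAt ρ D z₀ := (hρz.differentiableAt (by norm_num)).hasFDerivAt
  have hρ0 : ρ z₀ = 0 := by
    have : z₀ ∈ M ∩ U := ⟨hz₀, hzU⟩
    rw [hMU] at this
    exact this.2
  set F : Submodule ℝ (Cn n) := D.ker with hF
  have hFD : ∀ v, v ∈ F ↔ D v = 0 := fun v => LinearMap.mem_ker
  obtain ⟨Q, hQ⟩ := Submodule.ClosedComplemented.of_finiteDimensional F
  have hbij : Function.Bijective (D.prod Q) := by
    constructor
    · rw [injective_iff_map_eq_zero]
      intro v hv
      have h1 : D v = 0 := congrArg Prod.fst hv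
      have h2 : Q v = 0 := congrArg Prod.snd hv
      have h3 := hQ ⟨v, (hFD v).2 h1⟩
      rw [h2] at h3
      exact (congrArg Subtype.val h3).symm
    · rintro ⟨a, b⟩
      obtain ⟨w, hw⟩ := hDs a
      refine ⟨w - Q w + b, ?_⟩
      have h1 : D (Q w) = 0 := (hFD _).1 (Q w).2
      have h2 : D b = 0 := (hFD _).1 b.2
      refine Prod.ext ?_ ?_
      · simp [hw, h1, h2]
      · simp [hQ]
  set e : Cn n ≃L[ℝ] EuclideanSpace ℝ (Fin k) × F :=
    (LinearEquiv.ofBijective (D.prod Q : Cn n →ₗ[ℝ] EuclideanSpace ℝ (Fin k) × F)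
      hbij).toContinuousLinearEquiv with he
  have hev : ∀ v, e v = (D v, Q v) := fun v => rfl
  -- `Φ` straightens `M`; its local inverse, restricted to `{0} × F`, is the parametrization.
  set Φ : Cn n → EuclideanSpace ℝ (Fin k) × F := fun z => (ρ z, Q (z - z₀)) with hΦ
  have hΦz : Φ z₀ = 0 := by simp [hΦ, hρ0]
  have hΦc : ContDiffAt ℝ 2 Φ z₀ :=
    hρz.prodMk (Q.contDiff.contDiffAt.comp z₀ (contDiffAt_id.sub contDiffAt_const))
  have hΦd : HasFDerivAt Φ (e : Cn n →L[ℝ] EuclideanSpace ℝ (Fin k) × F) z₀ :=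
    hρd.prodMk (Q.hasFDerivAt.comp z₀ ((hasFDerivAt_id z₀).sub_const z₀))
  have hΦs : HasStrictFDerivAt Φ (e : Cn n →L[ℝ] EuclideanSpace ℝ (Fin k) × F) z₀ :=
    hΦc.hasStrictFDerivAt' hΦd (by norm_num)
  set Ψ := hΦs.localInverse with hΨ
  have hΨc : ContDiffAt ℝ 2 Ψ 0 := by
    have := hΦc.to_localInverse hΦd (by norm_num)
    rwa [hΦz] at this
  have hΨd : HasFDerivAt Ψ (e.symm : EuclideanSpace ℝ (Fin k) × F →L[ℝ] Cn n) 0 := by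
    have := hΦs.to_localInverse.hasFDerivAt
    rwa [hΦz] at this
  have hΨ0 : Ψ 0 = z₀ := by
    have := hΦs.localInverse_apply_image
    rwa [hΦz] at this
  have hΨr : ∀ᶠ y in 𝓝 0, Φ (Ψ y) = y := by
    have := hΦs.eventually_right_inverse
    rwa [hΦz] at this
  set ι : F →L[ℝ] EuclideanSpace ℝ (Fin k) × F := ContinuousLinearMap.inr ℝ _ F with hι
  have hι0 : ι 0 = 0 := map_zero _
  have hιt : Tendsto ι (𝓝 0) (𝓝 0) := by
    have := ι.continuous.tendsto 0
    rwa [hι0] at this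
  refine ⟨F, fun p => Ψ (ι p), Q, ?_, ?_, ?_, ?_, ?_, ?_⟩
  · have h1 := LinearMap.finrank_range_add_finrank_ker (D : Cn n →ₗ[ℝ] EuclideanSpace ℝ (Fin k))
    rw [LinearMap.range_eq_top.2 hDs, finrank_top, finrank_euclideanSpace_fin] at h1
    have h2 : Module.finrank ℝ (Cn n) = 2 * n := by
      rw [← Module.finrank_mul_finrank ℝ ℂ (Cn n), Complex.finrank_real_complex,
        finrank_euclideanSpace_fin]
    have h3 : Module.finrank ℝ F
        = Module.finrank ℝ (D : Cn n →ₗ[ℝ] EuclideanSpace ℝ (Fin k)).ker := rfl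
    omega
  · refine ContDiffAt.comp (0 : F) ?_ ι.contDiff.contDiffAt
    rwa [hι0]
  · simp only [hι0, hΨ0]
  · have h1 : HasFDerivAt (fun p => Ψ (ι p)) ((e.symm : _ →L[ℝ] Cn n).comp ι) 0 := by
      refine HasFDerivAt.comp (0 : F) ?_ ι.hasFDerivAt
      rwa [hι0]
    convert h1 using 1
    ext1 v
    simp only [ContinuousLinearMap.comp_apply, ContinuousLinearEquiv.coe_coe]
    rw [ContinuousLinearEquiv.eq_symm_apply, hev]
    refine Prod.ext ?_ ?_
    · exact (hFD _).1 v.2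
    · exact hQ v
  · have h1 : ∀ᶠ p in 𝓝 (0 : F), Ψ (ι p) ∈ U := by
      refine (hΨc.continuousAt.tendsto.comp hιt).eventually_mem ?_
      rw [hΨ0]; exact hU.mem_nhds hzU
    filter_upwards [h1, hιt.eventually hΨr] with p hp1 hp2
    have h2 : ρ (Ψ (ι p)) = 0 := congrArg Prod.fst hp2
    refine ⟨?_, congrArg Prod.snd hp2⟩
    have : Ψ (ι p) ∈ M ∩ U := by rw [hMU]; exact ⟨hp1, h2⟩
    exact this.1
  · rintro v ⟨γ, γ0, hγM, hγv⟩
    refine (hFD v).2 ?_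
    have h1 : HasDerivAt (fun t => ρ (γ t)) (D v) 0 := by
      refine HasFDerivAt.comp_hasDerivAt (0 : ℝ) ?_ hγv
      rwa [γ0]
    have h2 : (fun t => ρ (γ t)) =ᶠ[𝓝 0] fun _ => 0 := by
      have hU' : ∀ᶠ t in 𝓝 (0 : ℝ), γ t ∈ U :=
        hγv.continuousAt.eventually_mem (by rw [γ0]; exact hU.mem_nhds hzU)
      filter_upwards [hγM, hU'] with t ht1 ht2
      have : γ t ∈ M ∩ U := ⟨ht1, ht2⟩
      rw [hMU] at this
      exact this.2
    exact h1.unique ((hasDerivAt_const (0 : ℝ) (0 : EuclideanSpace ℝ (Fin k))).congr_of_eventuallyEq h2)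

/-- A real subspace which spans `ℂⁿ` together with its image under `i` contains a complex basis. -/
lemma exists_linearIndependent_of_generic {n : ℕ} {F : Submodule ℝ (Cn n)}
    (hF : ∀ w : Cn n, ∃ a ∈ F, ∃ b ∈ F, w = a + Complex.I • b) :
    ∃ s : Fin n → F, LinearIndependent ℂ fun j => (s j : Cn n) := by
  have hspan : Submodule.span ℂ (F : Set (Cn n)) = ⊤ := by
    refine eq_top_iff.2 fun w _ => ?_
    obtain ⟨a, ha, b, hb, rfl⟩ := hF w
    exact Submodule.add_mem _ (Submodule.subset_span ha)
      (Submodule.smul_mem _ _ (Submodule.subset_span hb))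
  obtain ⟨f, hf, -, hfi⟩ := Submodule.exists_fun_fin_finrank_span_eq ℂ (F : Set (Cn n))
  have hr : n = Module.finrank ℂ (Submodule.span ℂ (F : Set (Cn n))) := by
    rw [hspan, finrank_top, finrank_euclideanSpace_fin]
  exact ⟨fun j => ⟨f (finCongr hr j), hf _⟩, hfi.comp _ (finCongr hr).injective⟩

end Slices

/-- A generic submanifold stays non-plurithin at each of its points after the removal of a null set,
which need not be contained in it. -/
theorem IsGeneric.not_isPlurithinAt_diff {n m : ℕ} (hn : 1 ≤ n) {M : Set (Cn n)}
    (hM : IsC2Submanifold m M) (hgen : IsGeneric M) {I : Set (Cn n)} (hI : μH[(m : ℝ)] I = 0)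
    {z₀ : Cn n} (hz₀ : z₀ ∈ M) : ¬ IsPlurithinAt (M \ I) z₀ := by
  rintro ⟨G, hG, hzG, u, hu, hlim⟩
  obtain ⟨c, hc1, hc2⟩ := EReal.lt_iff_exists_real_btwn.1 hlim
  have hsmall := eventually_lt_of_limsup_lt hc1
  rw [eventually_nhdsWithin_iff] at hsmall
  obtain ⟨F, Γ, Q, hFm, hΓ2, hΓ0, hΓd, hΓM, hTF⟩ := hM.exists_parametrization hz₀
  obtain ⟨s₀, hs₀⟩ := exists_linearIndependent_of_generic (F := F) fun w => by
    obtain ⟨a, ha, b, hb, h⟩ := hgen z₀ hz₀ w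
    exact ⟨a, hTF ha, b, hTF hb, h⟩
  -- The parameters of the points of `I`.
  set A : Set F := (fun z => Q (z - z₀)) '' I with hA
  have hA0 : (μH[(m : ℝ)] : Measure F) A = 0 := by
    have hlip : LipschitzWith ‖Q‖₊ fun z => Q (z - z₀) := by
      have := Q.lipschitz.comp (LipschitzWith.id.sub (LipschitzWith.const z₀))
      rw [add_zero, mul_one] at this
      exact this
    have := hlip.hausdorffMeasure_image_le (Nat.cast_nonneg m) I
    rw [hI, mul_zero] at this
    exact le_antisymm this bot_le
  have : (μH[(m : ℝ)] : Measure F).IsAddHaarMeasure := by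
    have := isAddHaarMeasure_hausdorffMeasure (E := F)
    rwa [hFm] at this
  obtain ⟨s, hs, hsA⟩ := exists_slice_ae_notMem (μH[(m : ℝ)] : Measure F) hn hA0
    (W := {s : Fin n → F | LinearIndependent ℂ fun j => (s j : Cn n)})
    (isOpen_setOfPred_linearIndependent.preimage (by fun_prop)) ⟨s₀, hs₀⟩
  have : Nonempty (Fin n) := ⟨⟨0, hn⟩⟩
  set b := basisOfLinearIndependentOfCardEqFinrank hs (by simp) with hb
  have hbs : ∀ j, b j = s j := fun j => by rw [hb]; simp
  -- The complex linear change of coordinates which maps `ℝⁿ` to the real span of the vectors `s j`.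
  set T : Cn n ≃L[ℂ] Cn n :=
    ((EuclideanSpace.equiv (Fin n) ℂ).toLinearEquiv.trans b.equivFun.symm).toContinuousLinearEquiv
    with hT
  set S : Rn n →L[ℝ] F := ∑ j, (EuclideanSpace.proj (𝕜 := ℝ) j).smulRight (s j) with hS
  have hSx : ∀ x, S x = ∑ j, x j • s j := fun x => by simp [hS, sum_apply]
  have hTS : ∀ x : Rn n, T (ofE x) = S x := by
    intro x
    have h1 : T (ofE x) = ∑ j, (ofE x j) • b j := by
      rw [hT]; simp [Module.Basis.equivFun_symm_apply]
    rw [h1, hSx]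
    simp [hbs]
  have hTr : ∀ x, (T.symm.toContinuousLinearMap.restrictScalars ℝ) (S x) = ofE x := by
    intro x
    simp [← hTS]
  set R : Cn n →L[ℝ] Cn n := T.symm.toContinuousLinearMap.restrictScalars ℝ with hR
  set E : Rn n →L[ℝ] Cn n := R.comp (F.subtypeL.comp S) with hE
  have hEx : ∀ x, E x = ofE x := hTr
  set g : Rn n → Cn n := fun x => R (Γ (S x) - z₀) - E x with hg
  have hS0 : S 0 = 0 := map_zero S
  have hΓS : ContDiffAt ℝ 2 (fun x => Γ (S x)) 0 :=
    ContDiffAt.comp (0 : Rn n) (by rwa [hS0]) S.contDiff.contDiffAt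
  have hg2 : ContDiffAt ℝ 2 g 0 :=
    (R.contDiff.contDiffAt.comp (0 : Rn n) (hΓS.sub contDiffAt_const)).sub E.contDiff.contDiffAt
  have g0 : g 0 = 0 := by simp [hg, hΓ0]
  have dg0 : fderiv ℝ g 0 = 0 := by
    have h1 : HasFDerivAt (fun x => Γ (S x)) (F.subtypeL.comp S) 0 :=
      HasFDerivAt.comp (0 : Rn n) (by rwa [hS0]) S.hasFDerivAt
    have h2 : HasFDerivAt g (E - E) 0 :=
      (R.hasFDerivAt.comp (0 : Rn n) (h1.sub_const z₀)).sub E.hasFDerivAt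
    rw [h2.fderiv, sub_self]
  have hTg : ∀ x, z₀ + T (ofE x + g x) = Γ (S x) := by
    intro x
    have : ofE x + g x = T.symm (Γ (S x) - z₀) := by
      rw [hg, ← hEx]; simp [hR]
    rw [this, T.apply_symm_apply]; abel
  have hcont : ContinuousAt (fun x => Γ (S x)) 0 := hΓS.continuousAt
  have hev : ∀ᶠ x in 𝓝 (0 : Rn n), (Γ (S x) ∈ M ∧ Q (Γ (S x) - z₀) = S x) ∧
      (Γ (S x) ∈ (M \ I) \ {z₀} → u (Γ (S x)) < c) := by
    have hSt : Tendsto S (𝓝 0) (𝓝 0) := by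
      have := S.continuous.tendsto 0
      rwa [hS0] at this
    have hΓt : Tendsto (fun x => Γ (S x)) (𝓝 0) (𝓝 z₀) := by
      have := hcont.tendsto
      rwa [hS0, hΓ0] at this
    exact (hSt.eventually hΓM).and (hΓt.eventually hsmall)
  obtain ⟨r, hr, hball⟩ := Metric.eventually_nhds_iff_ball.1 hev
  refine not_ae_lt_on_graph hg2 g0 dg0
    (hG.preimage (by fun_prop : Continuous fun z => z₀ + T.toContinuousLinearMap z))
    (hu.comp_affine z₀ T.toContinuousLinearMap) (by simpa using hzG) (c := c) (by simpa using hc2)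
    hr ?_
  have : Nontrivial (Rn n) := inferInstance
  have hne : ∀ᵐ x ∂(μH[(n : ℝ)] : Measure (Rn n)), x ≠ 0 := by
    rw [ae_iff]; simp
  filter_upwards [hsA, hne] with x hxA hx0 hxr
  obtain ⟨⟨hxM, hxQ⟩, hxu⟩ := hball x (mem_ball_zero_iff.2 hxr)
  change u (z₀ + T (ofE x + g x)) < c
  rw [hTg]
  refine hxu ⟨⟨hxM, fun hxI => hxA ⟨_, hxI, ?_⟩⟩, fun hxz => hx0 ?_⟩
  · simp only
    rw [hxQ, hSx]
  · have h1 : S x = 0 := by rw [← hxQ, Set.mem_singleton_iff.1 hxz, sub_self, map_zero]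
    have h2 : ofE x = 0 := by rw [← hEx, hE]; simp [h1]
    rw [← norm_eq_zero, ← norm_ofE, h2, norm_zero]

end Plurithin

theorem mainTheorem1 (n m : ℕ) (hn : 1 ≤ n) (M : Set (Plurithin.Cn n))
    (hM : Plurithin.IsC2Submanifold m M) (hgen : Plurithin.IsGeneric M)
    (I : Set (Plurithin.Cn n)) (hIM : I ⊆ M)
    (hI : MeasureTheory.Measure.hausdorffMeasure (m : ℝ) I = 0) :
    ∀ z₀ ∈ M, ¬ Plurithin.IsPlurithinAt (M \ I) z₀ :=
  fun _ hz₀ => hgen.not_isPlurithinAt_diff hn hM hI hz₀
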